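/- Let $l\ge 4$. On $M=\mathbb R^{l(l+1)/2}$ with coordinates $x_i$ ($1\le i\le l$) and $y_{[jk]}$ ($1\le j<k\le l$) put $$X_i=\frac{\partial}{\partial x_i}-\sum_{p=i+1}^{l}x_p\frac{\partial}{\partial y_{[ip]}},\qquad X_1'=X_1+y_{[12]}\frac{\partial}{\partial y_{[34]}},\qquad X_i'=X_i\ (i\ge 2),$$ and let $D=\langle X_1,\dots,X_l\rangle$, $D'=\langle X_1',\dots,X_l'\rangle$. Let $\mathfrak g=\mathfrak{so}(l,l+1)$ be the Lie algebra of the matrices $\begin{pmatrix}A&X&Y\\-Z^t&0&-X^t\\T&Z&-A^t\end{pmatrix}$ with $A,Y,T\in\mathrm{Mat}_l(\mathbb R)$, $Y,T$ skew-symmetric, $X,Z\in\mathbb R^l$, with the grading $\mathfrak g=\mathfrak g_{-2}\oplus\dots\oplus\mathfrak g_2$ whose components are given by $Y,X,A,Z,T$; let $G=SO(l,l+1)$, and let $P\subset G$ be the parabolic subgroup with Lie algebra $\mathfrak p=\mathfrak g_0\oplus\mathfrak g_1\oplus\mathfrak g_2$ that stabilizes the corresponding filtration of $\mathbb R^{2l+1}$;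 let $\mathfrak p_+=\mathfrak g_1\oplus\mathfrak g_2$. A Cartan connection $\omega$ of type $(G,P)$ is adapted to a rank $l$ distribution if the distribution is the subbundle corresponding to $(\mathfrak g_{-1}\oplus\mathfrak p)/\mathfrak p$. Its curvature function $\kappa$ takes values in $\bigwedge^2\mathfrak p_+\otimes\mathfrak g$, where $\mathfrak p_+\cong(\mathfrak g/\mathfrak p)^*$ by an invariant form; $\omega$ is regular if $\kappa$ has only components of positive homogeneity, and normal if $\partial^*\kappa=0$, where $$\partial^*(Z_0\wedge Z_1\otimes X)=Z_0\otimes[Z_1,X]-Z_1\otimes[Z_0,X]-[Z_0,Z_1]\otimes X .$$ Let $\kappa_{1,1}$ be the component of $\kappa$ in $\mathfrak g_1\wedge\mathfrak g_1\otimes\mathfrak g$. Let $\tilde G=SO(l+1,l+1)$, with its $|1|$-grading of $\mathfrak{so}(l+1,l+1)$ and the stabilizer $\tilde P$ of the corresponding isotropic subspace of dimension $l+1$; a Cartan connection of type $(\tilde G,\tilde P)$ is called almost spinorial, and regularity and normality are defined as above. The standard inclusion $\alpha:\mathfrak{so}(l,l+1)\to\mathfrak{so}(l+1,l+1)$ (which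 maps $\mathfrak p$ into $\tilde{\mathfrak p}$ and induces an isomorphism $\mathfrak g/\mathfrak p\cong\tilde{\mathfrak g}/\tilde{\mathfrak p}$) extends every Cartan connection $\omega$ of type $(G,P)$ to an almost spinorial Cartan connection on the same base manifold: if $\theta=s^*\omega$ for a local section $s$, the extension is determined by $\alpha\circ\theta$. Then: 1. $D$ is a distribution of rank $l$ which is non-degenerate ($D+[D,D]=TM$), and it admits an adapted regular normal Cartan connection of type $(G,P)$ on $M\times P$ with $\kappa=0$; thus $D$ is the flat model. 2. $D'$ is a non-degenerate distribution of rank $l$. 3. $D'$ admits an adapted regular normal Cartan connection of type $(G,P)$ on $M\times P$. One such connection is determined by the form $\theta$ on $M$ that maps $X_i'$ to the $i$-th standard basis element of $\mathfrak g_{-1}$ (with $X=e_i$) and $-\partial/\partial y_{[jk]}$ to the basis element of $\mathfrak g_{-2}$ with $Y=e_je_k^t-e_ke_j^t$. 4. For every regular normal Cartan connection of type $(G,P)$ that is adapted to $D'$ (over an arbitrary open subset of $M$, on the product bundle), the curvature function $\kappa$ vanishes at no point, $\kappa_{1,1}=0$, and the extension by $\alpha$ is a regular normal almost spinorial Cartan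 connection. 5. $D'$ is not locally equivalent to $D$: no diffeomorphism between non-empty open subsets of $M$ maps $D'$ to $D$. -/

import Mathlib

open scoped ContDiff TensorProduct Matrix Topology

noncomputable section

namespace FreeDistribution

/-! ### Graded orthogonal Lie algebras and their parabolic subgroups -/

section Model

variable {n : Type} [Fintype n] [DecidableEq n]

/-- The filtration component `𝔤^k` of `𝔤 = so(J)`, where `J` is a symmetric form and `wt` assigns
integer weights to the basis vectors: the matrix entry `(i, j)` has degree `wt i - wt j`, and
`𝔤^k` consists of the matrices of `so(J)` whose entries of degree less than `k` vanish.
Thus `𝔭 = 𝔤^0` is the parabolic subalgebra and `𝔭₊ = 𝔤^1`. -/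
def filt (J : Matrix n n ℝ) (wt : n → ℤ) (k : ℤ) : Submodule ℝ (Matrix n n ℝ) where
  carrier := {A | A ∈ skewAdjointMatricesSubmodule J ∧ ∀ i j, wt i - wt j < k → A i j = 0}
  add_mem' := by
    rintro A B ⟨hA, hA'⟩ ⟨hB, hB'⟩
    exact ⟨add_mem hA hB, fun i j h => by simp [hA' i j h, hB' i j h]⟩
  zero_mem' := ⟨zero_mem _, fun _ _ _ => rfl⟩
  smul_mem' := by
    rintro c A ⟨hA, hA'⟩
    exact ⟨(skewAdjointMatricesSubmodule J).smul_mem c hA,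
      fun i j h => by simp [hA' i j h]⟩

/-- The grading component `𝔤_k` of `so(J)`. -/
def gradeSet (J : Matrix n n ℝ) (wt : n → ℤ) (k : ℤ) : Set (Matrix n n ℝ) :=
  {A | A ∈ skewAdjointMatricesSubmodule J ∧ ∀ i j, wt i - wt j ≠ k → A i j = 0}

/-- The parabolic subgroup `P` of `G = SO(J)`: the matrices of determinant one that preserve `J`
and the filtration of the standard representation by weights. -/
def parabolic (J : Matrix n n ℝ) (wt : n → ℤ) : Set (Matrix n n ℝ) :=
  {p | pᵀ * J * p = J ∧ p.det = 1 ∧ ∀ i j, wt i < wt j → p i j = 0}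

/-- The codifferential `∂*` on `⋀² 𝔭₊ ⊗ 𝔤`, with values in `𝔭₊ ⊗ 𝔤`:
`∂*(Z₀ ∧ Z₁ ⊗ X) = Z₀ ⊗ [Z₁, X] - Z₁ ⊗ [Z₀, X] - [Z₀, Z₁] ⊗ X`,
applied to `κ = ½ ∑ₐ ∑_b Z a ∧ Z b ⊗ κ (e a) (e b)`, where `e` represents a basis of `𝔤/𝔭` and
`Z` is the basis of `𝔭₊` that is dual to it with respect to an invariant form on `𝔤`. -/
def codiff {ι : Type} [Fintype ι] (e Z : ι → Matrix n n ℝ)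
    (κ : Matrix n n ℝ → Matrix n n ℝ → Matrix n n ℝ) : Matrix n n ℝ ⊗[ℝ] Matrix n n ℝ :=
  (2⁻¹ : ℝ) • ∑ a, ∑ b, (Z a ⊗ₜ[ℝ] ⁅Z b, κ (e a) (e b)⁆ - Z b ⊗ₜ[ℝ] ⁅Z a, κ (e a) (e b)⁆
    - ⁅Z a, Z b⁆ ⊗ₜ[ℝ] κ (e a) (e b))

end Model

/-! ### Cartan connections

A Cartan connection of type `(G, P)` on a principal bundle `𝒢 → U` with a section `s : U → 𝒢` is
described by the `𝔤`-valued one-form `θ = s^* ω` on `U`. The section identifies `𝒢` with `U × P`,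
and tangent vectors at `(x, p)` with pairs `(v, ξ)`, `v` in `T_x U` and `ξ` in `𝔭`, where `ξ`
stands for the value at `(x, p)` of the fundamental vector field of `ξ`. -/

section Cartan

variable {E : Type} [NormedAddCommGroup E] [NormedSpace ℝ E]
variable {n : Type} [Fintype n] [DecidableEq n]

/-- A smooth `so(J)`-valued one-form `θ` on the open set `U` which induces isomorphisms
`T_x U ≅ 𝔤/𝔭`: the pull-back of a Cartan connection of type `(G, P)` along a section. -/
structure IsCartanGauge (J : Matrix n n ℝ) (wt : n → ℤ) (U : Set E)
    (θ : E → E →ₗ[ℝ] Matrix n n ℝ) : Prop where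
  isOpen : IsOpen U
  smooth : ∀ v i j, ContDiffOn ℝ ∞ (fun x => θ x v i j) U
  mem : ∀ x ∈ U, ∀ v, θ x v ∈ skewAdjointMatricesSubmodule J
  iso : ∀ x ∈ U, ∀ A ∈ skewAdjointMatricesSubmodule J, ∃! v, A - θ x v ∈ filt J wt 0

/-- The Cartan connection `ω` on `U × P` determined by `θ`; it restricts to `θ` on `U × {1}`,
reproduces fundamental vector fields, and is equivariant. -/
def cartanForm (θ : E → E →ₗ[ℝ] Matrix n n ℝ) (x : E) (p : Matrix n n ℝ) (v : E)
    (ξ : Matrix n n ℝ) : Matrix n n ℝ :=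
  p⁻¹ * θ x v * p + ξ

/-- The equivariance `R_q^* ω = Ad(q⁻¹) ω`. -/
theorem cartanForm_equivariant (θ : E → E →ₗ[ℝ] Matrix n n ℝ) (x : E) (p q : Matrix n n ℝ) (v : E)
    (ξ : Matrix n n ℝ) :
    cartanForm θ x (p * q) v (q⁻¹ * ξ * q) = q⁻¹ * cartanForm θ x p v ξ * q := by
  simp only [cartanForm, Matrix.mul_inv_rev, mul_add, add_mul, mul_assoc]

/-- The curvature two-form `dθ + ½ [θ, θ]` of the one-form `θ`. -/
def curvatureForm (θ : E → E →ₗ[ℝ] Matrix n n ℝ) (x v w : E) : Matrix n n ℝ :=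
  Matrix.of (fun i j => fderiv ℝ (fun y => θ y w i j) x v - fderiv ℝ (fun y => θ y v i j) x w)
    + ⁅θ x v, θ x w⁆

/-- The projection to `T_x U` of the tangent vector `ω⁻¹(A)` at `(x, p)`. -/
def omegaInv (J : Matrix n n ℝ) (wt : n → ℤ) (θ : E → E →ₗ[ℝ] Matrix n n ℝ) (x : E)
    (p A : Matrix n n ℝ) : E :=
  Classical.epsilon fun v => ∃ ξ ∈ filt J wt 0, cartanForm θ x p v ξ = A

/-- The curvature function `κ(A, B) = Ω(ω⁻¹(A), ω⁻¹(B))` of the Cartan connection at the point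
`(x, p)` of `U × P`; the curvature form `Ω` of `ω` is horizontal and equivariant, so that at
`(x, p)` it is `Ad(p⁻¹)` of the curvature form of `θ`. -/
def kappa (J : Matrix n n ℝ) (wt : n → ℤ) (θ : E → E →ₗ[ℝ] Matrix n n ℝ) (x : E)
    (p A B : Matrix n n ℝ) : Matrix n n ℝ :=
  p⁻¹ * curvatureForm θ x (omegaInv J wt θ x p A) (omegaInv J wt θ x p B) * p

/-- Regularity: the curvature function has only components of positive homogeneity. -/
def IsRegular (J : Matrix n n ℝ) (wt : n → ℤ) (U : Set E)
    (θ : E → E →ₗ[ℝ] Matrix n n ℝ) : Prop :=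
  ∀ x ∈ U, ∀ p ∈ parabolic J wt, ∀ i j : ℤ, ∀ A ∈ filt J wt i, ∀ B ∈ filt J wt j,
    kappa J wt θ x p A B ∈ filt J wt (i + j + 1)

/-- Normality: `∂* κ = 0`. -/
def IsNormal {ι : Type} [Fintype ι] (J : Matrix n n ℝ) (wt : n → ℤ) (e Z : ι → Matrix n n ℝ)
    (U : Set E) (θ : E → E →ₗ[ℝ] Matrix n n ℝ) : Prop :=
  ∀ x ∈ U, ∀ p ∈ parabolic J wt, codiff e Z (kappa J wt θ x p) = 0

end Cartan

/-! ### The two models -/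

/-- Index pairs `[jk]` with `j < k`. -/
abbrev Pair (m : ℕ) : Type := {q : Fin m × Fin m // q.1 < q.2}

/-- Row and column indices of the blocks of sizes `l, 1, l`. -/
abbrev BIdx (l : ℕ) : Type := Fin l ⊕ Unit ⊕ Fin l

/-- Row and column indices of the blocks of sizes `l + 1, l + 1`; the index `0` of each block is
the additional one. -/
abbrev DIdx (l : ℕ) : Type := Fin (l + 1) ⊕ Fin (l + 1)

/-- The elementary skew-symmetric matrix with entries `1` at `q` and `-1` at the transposed
position. -/
def skewUnit {m : ℕ} (q : Pair m) : Matrix (Fin m) (Fin m) ℝ :=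
  Matrix.single q.1.1 q.1.2 1 - Matrix.single q.1.2 q.1.1 1

/-- The symmetric form with block rows `(0, 0, 1)`, `(0, 1, 0)`, `(1, 0, 0)`. -/
def JB (l : ℕ) : Matrix (BIdx l) (BIdx l) ℝ
  | .inl i, .inr (.inr j) => if i = j then 1 else 0
  | .inr (.inl _), .inr (.inl _) => 1
  | .inr (.inr i), .inl j => if i = j then 1 else 0
  | _, _ => 0

/-- The weights which give the grading `𝔤₋₂ ⊕ ... ⊕ 𝔤₂` of `so(l, l+1)`. -/
def wtB (l : ℕ) : BIdx l → ℤ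
  | .inl _ => -1
  | .inr (.inl _) => 0
  | .inr (.inr _) => 1

/-- The matrix in `so(l, l+1)` with block rows `(0, X, Y)`, `(0, 0, -Xᵗ)`, `(0, 0, 0)`, for `Y`
skew-symmetric. -/
def negB {l : ℕ} (X : Fin l → ℝ) (Y : Matrix (Fin l) (Fin l) ℝ) : Matrix (BIdx l) (BIdx l) ℝ
  | .inl i, .inr (.inl _) => X i
  | .inl i, .inr (.inr j) => Y i j
  | .inr (.inl _), .inr (.inr j) => -X j
  | _, _ => 0

/-- The basis `E_i`, `E_{[jk]}` of `𝔤₋`. -/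
def eB (l : ℕ) : Fin l ⊕ Pair l → Matrix (BIdx l) (BIdx l) ℝ
  | .inl i => negB (Pi.single i 1) 0
  | .inr q => negB 0 (skewUnit q)

/-- The matrix in `so(l, l+1)` with block rows `(0, 0, 0)`, `(-Zᵗ, 0, 0)`, `(T, Z, 0)`, for `T`
skew-symmetric. -/
def posB {l : ℕ} (Z : Fin l → ℝ) (T : Matrix (Fin l) (Fin l) ℝ) : Matrix (BIdx l) (BIdx l) ℝ
  | .inr (.inl _), .inl j => -Z j
  | .inr (.inr i), .inl j => T i j
  | .inr (.inr i), .inr (.inl _) => Z i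
  | _, _ => 0

/-- The basis `E^i`, `E^{[jk]}` of `𝔭₊`; it is dual to `eB l` with respect to `-½ tr(AB)`. -/
def zB (l : ℕ) : Fin l ⊕ Pair l → Matrix (BIdx l) (BIdx l) ℝ
  | .inl i => posB (Pi.single i 1) 0
  | .inr q => posB 0 (skewUnit q)

/-- The symmetric form with block rows `(0, 1)`, `(1, 0)`. -/
def JD (l : ℕ) : Matrix (DIdx l) (DIdx l) ℝ := Matrix.fromBlocks 0 1 1 0

/-- The weights which give the grading `𝔤₋₁ ⊕ 𝔤₀ ⊕ 𝔤₁` of `so(l+1, l+1)`. -/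
def wtD (l : ℕ) : DIdx l → ℤ
  | .inl _ => 0
  | .inr _ => 1

/-- The basis of `𝔤₋₁` in `so(l+1, l+1)`. -/
def eD (l : ℕ) (q : Pair (l + 1)) : Matrix (DIdx l) (DIdx l) ℝ :=
  Matrix.fromBlocks 0 (skewUnit q) 0 0

/-- The basis of `𝔭₊ = 𝔤₁` in `so(l+1, l+1)`; it is dual to `eD l` with respect to
`-½ tr(AB)`. -/
def zD (l : ℕ) (q : Pair (l + 1)) : Matrix (DIdx l) (DIdx l) ℝ :=
  Matrix.fromBlocks 0 0 (skewUnit q) 0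

/-- The isometric inclusion `ℝ^{l,l+1} → ℝ^{l+1,l+1}`, which is the identity on the two isotropic
subspaces of dimension `l` and maps the middle basis vector to `(f + f') / √2`, where `f`, `f'`
are the two additional basis vectors. -/
def inclD (l : ℕ) : Matrix (DIdx l) (BIdx l) ℝ
  | .inl a, .inl j => if a = j.succ then 1 else 0
  | .inl a, .inr (.inl _) => if a = 0 then (√2)⁻¹ else 0
  | .inr a, .inr (.inl _) => if a = 0 then (√2)⁻¹ else 0
  | .inr a, .inr (.inr j) => if a = j.succ then 1 else 0
  | _, _ => 0

/-- The injective Lie algebra homomorphism `α : so(l, l+1) → so(l+1, l+1)`. In the order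
`e₁, ..., e_l, f, f', e₁', ..., e_l'` of the basis, it maps the matrix with block rows
`(A, X, Y)`, `(-Zᵗ, 0, -Xᵗ)`, `(T, Z, -Aᵗ)` to the one with block rows
`(A, X/√2, X/√2, Y)`, `(-Zᵗ/√2, 0, 0, -Xᵗ/√2)`, `(-Zᵗ/√2, 0, 0, -Xᵗ/√2)`,
`(T, Z/√2, Z/√2, -Aᵗ)`. -/
def alpha (l : ℕ) : Matrix (BIdx l) (BIdx l) ℝ →ₗ[ℝ] Matrix (DIdx l) (DIdx l) ℝ where
  toFun A := inclD l * A * (inclD l)ᵀ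
  map_add' A B := by rw [Matrix.mul_add, Matrix.add_mul]
  map_smul' c A := by
    simp only [RingHom.id_apply]
    rw [Matrix.mul_smul, Matrix.smul_mul]

theorem inclD_isometry (l : ℕ) : (inclD l)ᵀ * inclD l = 1 := by
  have h2 : (√2)⁻¹ * (√2)⁻¹ + (√2)⁻¹ * (√2)⁻¹ = (1 : ℝ) := by
    rw [← mul_inv, Real.mul_self_sqrt (by norm_num)]
    norm_num
  ext i j
  rcases i with i | i | i <;> rcases j with j | j | j <;>
    simp [Matrix.mul_apply, inclD, Matrix.one_apply, Fin.succ_ne_zero, h2, eq_comm]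

/-- `α` is a homomorphism of Lie algebras. -/
theorem alpha_lie (l : ℕ) (A B : Matrix (BIdx l) (BIdx l) ℝ) :
    alpha l ⁅A, B⁆ = ⁅alpha l A, alpha l B⁆ := by
  have key : ∀ A B : Matrix (BIdx l) (BIdx l) ℝ,
      alpha l A * alpha l B = alpha l (A * B) := by
    intro A B
    calc alpha l A * alpha l B
        = inclD l * A * ((inclD l)ᵀ * inclD l) * B * (inclD l)ᵀ := by
          simp only [alpha, LinearMap.coe_mk, AddHom.coe_mk, Matrix.mul_assoc]
      _ = alpha l (A * B) := by
          rw [inclD_isometry]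
          simp only [alpha, LinearMap.coe_mk, AddHom.coe_mk, Matrix.mul_assoc, Matrix.one_mul]
  rw [Ring.lie_def, Ring.lie_def, map_sub, key, key]

/-! ### Distributions -/

/-- Coordinates `x_i` and `y_{[jk]}`, `j < k`. -/
abbrev Coord (l : ℕ) : Type := Fin l ⊕ Pair l

/-- The manifold of dimension `l (l + 1) / 2` with global coordinates `x_i`, `y_{[jk]}`. -/
abbrev M (l : ℕ) : Type := Coord l → ℝ

section Distribution

variable {E : Type} [NormedAddCommGroup E] [NormedSpace ℝ E]

/-- `D` is a smooth vector distribution of rank `k`. -/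
def IsDistribution (k : ℕ) (D : E → Submodule ℝ E) : Prop :=
  ∀ x, ∃ U : Set E, IsOpen U ∧ x ∈ U ∧ ∃ X : Fin k → E → E, (∀ i, ContDiffOn ℝ ∞ (X i) U) ∧
    ∀ y ∈ U, LinearIndependent ℝ (fun i => X i y) ∧
      D y = Submodule.span ℝ (Set.range fun i => X i y)

/-- Near `x`, the vector field `V` is a smooth section of `D`. -/
def IsSectionAt (D : E → Submodule ℝ E) (x : E) (V : E → E) : Prop :=
  ContDiffAt ℝ ∞ V x ∧ ∀ᶠ y in 𝓝 x, V y ∈ D y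

/-- `D` is non-degenerate: `D + [D, D]` is the whole tangent bundle. -/
def IsNondegenerate (D : E → Submodule ℝ E) : Prop :=
  ∀ x, D x ⊔ Submodule.span ℝ {w | ∃ V W : E → E, IsSectionAt D x V ∧ IsSectionAt D x W ∧
    w = VectorField.lieBracket ℝ V W x} = ⊤

/-- Some diffeomorphism between non-empty open subsets maps `D₁` to `D₂`. -/
def LocallyEquivalent (D₁ D₂ : E → Submodule ℝ E) : Prop :=
  ∃ φ : OpenPartialHomeomorph E E, φ.source.Nonempty ∧ ContDiffOn ℝ ∞ φ φ.source ∧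
    ContDiffOn ℝ ∞ φ.symm φ.target ∧
    ∀ x ∈ φ.source, (D₁ x).map (fderiv ℝ φ x : E →ₗ[ℝ] E) = D₂ (φ x)

end Distribution

/-- The vector field `∂/∂y_{[jk]}`. -/
def vecY {l : ℕ} (q : Pair l) : M l := Pi.single (.inr q) 1

/-- The vector fields `X_i = ∂/∂x_i - ∑_{p > i} x_p ∂/∂y_{[ip]}`. -/
def vecX {l : ℕ} (i : Fin l) (x : M l) : M l :=
  Pi.single (.inl i) 1 - ∑ q : Pair l, if q.1.1 = i then x (.inl q.1.2) • vecY q else 0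

/-- The index pair `[12]`. -/
def q12 {l : ℕ} (hl : 4 ≤ l) : Pair l := ⟨(⟨0, by omega⟩, ⟨1, by omega⟩), by simp⟩

/-- The index pair `[34]`. -/
def q34 {l : ℕ} (hl : 4 ≤ l) : Pair l := ⟨(⟨2, by omega⟩, ⟨3, by omega⟩), by simp⟩

/-- The vector fields `X'_1 = X_1 + y_{[12]} ∂/∂y_{[34]}` and `X'_i = X_i` for `i ≥ 2`. -/
def vecX' {l : ℕ} (hl : 4 ≤ l) (i : Fin l) (x : M l) : M l :=
  vecX i x + if i.val = 0 then x (.inr (q12 hl)) • vecY (q34 hl) else 0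

/-- The distribution `D` spanned by `X_1, ..., X_l`. -/
def flatD (l : ℕ) (x : M l) : Submodule ℝ (M l) := Submodule.span ℝ (Set.range fun i => vecX i x)

/-- The distribution `D'` spanned by `X'_1, ..., X'_l`. -/
def distD' {l : ℕ} (hl : 4 ≤ l) (x : M l) : Submodule ℝ (M l) :=
  Submodule.span ℝ (Set.range fun i => vecX' hl i x)

/-! ### Normal Cartan connections associated with a distribution -/

/-- `θ` is the pull-back to `U` of a regular normal Cartan connection of type `(G, P)`, for
`G = SO(l, l+1)`, which is adapted to `D`: the subspace of `T_x U` that corresponds to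
`𝔤^{-1}/𝔭` is `D x`. -/
structure IsNormalFor (l : ℕ) (D : M l → Submodule ℝ (M l)) (U : Set (M l))
    (θ : M l → M l →ₗ[ℝ] Matrix (BIdx l) (BIdx l) ℝ) : Prop where
  gauge : IsCartanGauge (JB l) (wtB l) U θ
  adapted : ∀ x ∈ U, ∀ v, v ∈ D x ↔ θ x v ∈ filt (JB l) (wtB l) (-1)
  regular : IsRegular (JB l) (wtB l) U θ
  normal : IsNormal (JB l) (wtB l) (eB l) (zB l) U θ

/-- `θ` is the pull-back to `U` of a normal almost spinorial Cartan connection, that is, a (regular)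
normal one of type `(G̃, P̃)`, for `G̃ = SO(l+1, l+1)`. -/
structure IsNormalSpinorial (l : ℕ) (U : Set (M l))
    (θ : M l → M l →ₗ[ℝ] Matrix (DIdx l) (DIdx l) ℝ) : Prop where
  gauge : IsCartanGauge (JD l) (wtD l) U θ
  regular : IsRegular (JD l) (wtD l) U θ
  normal : IsNormal (JD l) (wtD l) (eD l) (zD l) U θ

/-- The extension of a Cartan connection of type `(G, P)` to one of type `(G̃, P̃)`, on the bundle
`𝒢 ×_P P̃`, in terms of the pull-back along a section of `𝒢`. -/
def extend (l : ℕ) (θ : M l → M l →ₗ[ℝ] Matrix (BIdx l) (BIdx l) ℝ) :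
    M l → M l →ₗ[ℝ] Matrix (DIdx l) (DIdx l) ℝ :=
  fun x => alpha l ∘ₗ θ x

/-- `κ_{1,1} = 0`, where `κ_{1,1}` is the component of `κ` in `𝔤₁ ∧ 𝔤₁ ⊗ 𝔤`, that is, the
restriction of `κ` to `𝔤₋₁`. -/
def Kappa11Vanishes (l : ℕ) (U : Set (M l))
    (θ : M l → M l →ₗ[ℝ] Matrix (BIdx l) (BIdx l) ℝ) : Prop :=
  ∀ x ∈ U, ∀ p ∈ parabolic (JB l) (wtB l), ∀ A ∈ gradeSet (JB l) (wtB l) (-1),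
    ∀ B ∈ gradeSet (JB l) (wtB l) (-1), kappa (JB l) (wtB l) θ x p A B = 0

end FreeDistribution
end

open FreeDistribution

/-!
# A non-flat free distribution whose almost spinorial extension is normal

The two frames are treated together: `vecE hl ε` adds `ε y_{[12]} ∂/∂y_{[34]}` to `X_1`, so that
`ε = 0` gives `D` and `ε = 1` gives `D'`. The form `formE hl ε` maps the frame `X_i`,
`-∂/∂y_{[jk]}` to the standard basis of `𝔤₋`. As the brackets of the `X_i` reproduce those of
`𝔤₋₁`, its only curvature is `ε E^1 ∧ E^{[12]} ⊗ E_{[34]}` (`curvatureForm_formE`). The three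
elements `E^1`, `E^{[12]}`, `E_{[34]}` commute, the last two because `{1, 2}` and `{3, 4}` are
disjoint, and therefore `∂*` annihilates this tensor (`codiff_eq_zero_of_decomposable`). It has
homogeneity one and no component on `𝔤₋₁ ∧ 𝔤₋₁`. Thus `formE` is regular, normal, and has
`κ_{1,1} = 0`; it is flat for `ε = 0`, and its curvature vanishes nowhere for `ε ≠ 0`. The argument
for normality survives the extension: `α` maps `E_{[34]}` to a basis element, multiples of
`E^{[01]}` and `E^{[12]}` take the place of `E^1` and `E^{[12]}`, where `0` is the additional index,
and `{0, 1, 2}` and `{3, 4}` are still disjoint (`normalAt_extend_formE`).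

It remains to see that these properties, which do not depend on the section, hold for every regular
normal Cartan connection adapted to `D'`. This is a uniqueness statement: any such connection is
related to `formE` by a change of section (`gaugeRel_formE`). A change of section with values in
the Levi subgroup makes the difference `F` of the two forms have positive homogeneity
(`exists_gauge_levi`). If `F` has homogeneity at least `k ≥ 1`, the difference of the curvatures is
`∂F` up to terms of higher homogeneity (`kappa_sub_mem`). Both curvatures are in the kernel of `∂*`,
and `∂*` is adjoint to `∂` for the inner product `tr(AᵗB)` (`pairing_codiffTri`). Hence the lowest
component of `F` is a cocycle (`lieDiff_component_eq_zero`). For `l ≥ 4` the first cohomology of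
`𝔤₋` with values in `𝔤` vanishes in positive homogeneity (`cocycle_eq_lie`), so this component has
the form `[·, Z]` with `Z` in `𝔤_k`, and a change of section by `exp(-Z)` removes it
(`exists_gauge_step`). As `𝔤` has no components of degree greater than two, the procedure stops.

A diffeomorphism that maps `D'` to `D` would pull the flat connection of `D` back to a flat regular
normal connection adapted to `D'`, while all such connections of `D'` have non-vanishing curvature.
-/

noncomputable section

set_option linter.unusedSectionVars false

namespace FreeDistribution

/-! ### The weight filtration of matrices and the parabolic subgroup -/

section Filtration

variable {n : Type} [Fintype n] [DecidableEq n]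

/-- The matrices whose entries of degree less than `k` vanish, where the entry `(i, j)` has degree
`wt i - wt j`. This is the filtration of the full matrix algebra that induces `filt`; unlike the
latter it is closed under products. -/
def lowFil (wt : n → ℤ) (k : ℤ) : Submodule ℝ (Matrix n n ℝ) where
  carrier := {A | ∀ i j, wt i - wt j < k → A i j = 0}
  add_mem' := by
    intro A B hA hB i j h
    simp [hA i j h, hB i j h]
  zero_mem' := fun _ _ _ => rfl
  smul_mem' := by
    intro c A hA i j h
    simp [hA i j h]

variable {J : Matrix n n ℝ} {wt : n → ℤ} {k m : ℤ} {A B p q : Matrix n n ℝ}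

theorem lowFil_mono (h : m ≤ k) (hA : A ∈ lowFil wt k) : A ∈ lowFil wt m :=
  fun i j hij => hA i j (lt_of_lt_of_le hij h)

theorem filt_mono (h : m ≤ k) (hA : A ∈ filt J wt k) : A ∈ filt J wt m :=
  ⟨hA.1, lowFil_mono h hA.2⟩

theorem mul_mem_lowFil (hA : A ∈ lowFil wt k) (hB : B ∈ lowFil wt m) :
    A * B ∈ lowFil wt (k + m) := by
  intro i j hij
  rw [Matrix.mul_apply]
  refine Finset.sum_eq_zero fun r _ => ?_
  by_cases h : wt i - wt r < k
  · rw [hA i r h, zero_mul]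
  · rw [hB r j (by omega), mul_zero]

theorem lie_mem_lowFil (hA : A ∈ lowFil wt k) (hB : B ∈ lowFil wt m) :
    ⁅A, B⁆ ∈ lowFil wt (k + m) := by
  rw [Ring.lie_def]
  exact sub_mem (mul_mem_lowFil hA hB) (add_comm m k ▸ mul_mem_lowFil hB hA)

theorem one_mem_lowFil : (1 : Matrix n n ℝ) ∈ lowFil wt 0 := by
  intro i j hij
  rw [Matrix.one_apply_ne]
  rintro rfl
  omega

theorem trace_eq_zero_of_mem_lowFil (hA : A ∈ lowFil wt k) (hk : 0 < k) : A.trace = 0 :=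
  Finset.sum_eq_zero fun i _ => hA i i (by omega)

theorem lie_add_mat (A B C : Matrix n n ℝ) : ⁅A, B + C⁆ = ⁅A, B⁆ + ⁅A, C⁆ := by
  simp only [Ring.lie_def]; noncomm_ring

theorem add_lie_mat (A B C : Matrix n n ℝ) : ⁅A + B, C⁆ = ⁅A, C⁆ + ⁅B, C⁆ := by
  simp only [Ring.lie_def]; noncomm_ring

theorem lie_smul_mat (r : ℝ) (A B : Matrix n n ℝ) : ⁅A, r • B⁆ = r • ⁅A, B⁆ := by
  simp only [Ring.lie_def, Matrix.mul_smul, Matrix.smul_mul, smul_sub]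

theorem smul_lie_mat (r : ℝ) (A B : Matrix n n ℝ) : ⁅r • A, B⁆ = r • ⁅A, B⁆ := by
  simp only [Ring.lie_def, Matrix.mul_smul, Matrix.smul_mul, smul_sub]

theorem lie_skew_mat (A B : Matrix n n ℝ) : ⁅B, A⁆ = -⁅A, B⁆ := by
  simp only [Ring.lie_def, neg_sub]

theorem mem_so : A ∈ skewAdjointMatricesSubmodule J ↔ Aᵀ * J = -(J * A) := by
  rw [mem_skewAdjointMatricesSubmodule, Matrix.IsSkewAdjoint, Matrix.IsAdjointPair, Matrix.mul_neg]

theorem lie_mem_so (hA : A ∈ skewAdjointMatricesSubmodule J)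
    (hB : B ∈ skewAdjointMatricesSubmodule J) : ⁅A, B⁆ ∈ skewAdjointMatricesSubmodule J := by
  rw [mem_so] at *
  rw [Ring.lie_def, Matrix.transpose_sub, Matrix.transpose_mul, Matrix.transpose_mul,
    Matrix.sub_mul, Matrix.mul_assoc, hA, Matrix.mul_assoc, hB, Matrix.mul_neg,
    Matrix.mul_neg, ← Matrix.mul_assoc, ← Matrix.mul_assoc, hA, hB]
  noncomm_ring

/-- The component of degree `d` of a matrix. -/
def component (wt : n → ℤ) (d : ℤ) (A : Matrix n n ℝ) : Matrix n n ℝ :=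
  Matrix.of fun i j => if wt i - wt j = d then A i j else 0

theorem sub_component_mem_lowFil (hA : A ∈ lowFil wt k) :
    A - component wt k A ∈ lowFil wt (k + 1) := by
  intro i j hij
  rcases lt_or_eq_of_le (Int.lt_add_one_iff.1 hij) with h | h
  · simp [component, hA i j h]
  · simp [component, h]

/-- A symmetric involution `J` for which basis vectors of weights `a` and `b` pair to zero unless
`a + b` is a fixed constant, so that `so(J)` is graded by the weights. -/
structure IsGradedForm (J : Matrix n n ℝ) (wt : n → ℤ) (c : ℤ) : Prop where
  symm : Jᵀ = J
  sq : J * J = 1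
  supp : ∀ i j, J i j ≠ 0 → wt i + wt j = c

/-- The stabilizer in `O(J)` of the weight filtration. It contains `parabolic J wt`, and all
arguments about the parabolic subgroup apply to it. -/
def parab (J : Matrix n n ℝ) (wt : n → ℤ) : Set (Matrix n n ℝ) :=
  {p | pᵀ * J * p = J ∧ p ∈ lowFil wt 0}

theorem parabolic_subset_parab : parabolic J wt ⊆ parab J wt :=
  fun _ hp => ⟨hp.1, fun i j h => hp.2.2 i j (by omega)⟩

theorem one_mem_parab : (1 : Matrix n n ℝ) ∈ parab J wt :=
  ⟨by simp, one_mem_lowFil⟩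

theorem one_mem_parabolic : (1 : Matrix n n ℝ) ∈ parabolic J wt :=
  ⟨by simp, by simp, fun i j h => Matrix.one_apply_ne (by rintro rfl; omega)⟩

theorem mul_mem_parab (hp : p ∈ parab J wt) (hq : q ∈ parab J wt) : p * q ∈ parab J wt := by
  refine ⟨?_, by simpa using mul_mem_lowFil hp.2 hq.2⟩
  calc (p * q)ᵀ * J * (p * q) = qᵀ * (pᵀ * J * p) * q := by
        rw [Matrix.transpose_mul]; noncomm_ring
    _ = J := by rw [hp.1, hq.1]

namespace IsGradedForm

variable {c : ℤ} (hJ : IsGradedForm J wt c)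
include hJ

theorem mul_left_cancel (X : Matrix n n ℝ) : J * (J * X) = X := by
  rw [← Matrix.mul_assoc, hJ.sq, Matrix.one_mul]

theorem conj_transpose_mul (hp : pᵀ * J * p = J) : J * pᵀ * J * p = 1 := by
  rw [Matrix.mul_assoc, Matrix.mul_assoc, ← Matrix.mul_assoc pᵀ, hp, hJ.sq]

theorem inv_eq (hp : pᵀ * J * p = J) : p⁻¹ = J * pᵀ * J :=
  Matrix.inv_eq_left_inv (hJ.conj_transpose_mul hp)

theorem inv_mul (hp : p ∈ parab J wt) : p⁻¹ * p = 1 := by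
  rw [hJ.inv_eq hp.1, hJ.conj_transpose_mul hp.1]

theorem mul_inv (hp : p ∈ parab J wt) : p * p⁻¹ = 1 :=
  mul_eq_one_comm.1 (hJ.inv_mul hp)

theorem inv_mem (hp : p ∈ parab J wt) : p⁻¹ ∈ parab J wt := by
  have h1 := hJ.mul_inv hp
  refine ⟨?_, ?_⟩
  · calc (p⁻¹)ᵀ * J * p⁻¹ = (p⁻¹)ᵀ * (pᵀ * J * p) * p⁻¹ := by rw [hp.1]
      _ = (p * p⁻¹)ᵀ * J * (p * p⁻¹) := by rw [Matrix.transpose_mul]; noncomm_ring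
      _ = J := by rw [h1]; simp
  · rw [hJ.inv_eq hp.1]
    intro i j hij
    simp only [Matrix.mul_apply, Finset.sum_mul]
    refine Finset.sum_eq_zero fun r _ => Finset.sum_eq_zero fun s _ => ?_
    by_cases h1 : J i s = 0
    · simp [h1]
    by_cases h2 : J r j = 0
    · simp [h2]
    have h3 := hJ.supp _ _ h1
    have h4 := hJ.supp _ _ h2
    rw [Matrix.transpose_apply, hp.2 r s (by omega)]
    simp

theorem conj_mem_so (hp : p ∈ parab J wt) (hA : A ∈ skewAdjointMatricesSubmodule J) :
    p⁻¹ * A * p ∈ skewAdjointMatricesSubmodule J := by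
  rw [mem_so] at *
  have h1 : J * p⁻¹ = pᵀ * J := by
    rw [hJ.inv_eq hp.1, Matrix.mul_assoc, hJ.mul_left_cancel]
  have h2 : (p⁻¹)ᵀ * J = J * p := by
    rw [hJ.inv_eq hp.1]
    simp only [Matrix.transpose_mul, Matrix.transpose_transpose, hJ.symm, Matrix.mul_assoc, hJ.sq,
      Matrix.mul_one]
  calc (p⁻¹ * A * p)ᵀ * J = pᵀ * Aᵀ * ((p⁻¹)ᵀ * J) := by
        simp only [Matrix.transpose_mul, Matrix.mul_assoc]
    _ = pᵀ * (Aᵀ * J) * p := by rw [h2]; simp only [Matrix.mul_assoc]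
    _ = -((pᵀ * J) * A * p) := by rw [hA]; noncomm_ring
    _ = -(J * (p⁻¹ * A * p)) := by rw [← h1]; noncomm_ring

theorem conj_mem_lowFil (hp : p ∈ parab J wt) (hA : A ∈ lowFil wt k) :
    p⁻¹ * A * p ∈ lowFil wt k := by
  simpa using mul_mem_lowFil (mul_mem_lowFil (hJ.inv_mem hp).2 hA) hp.2

theorem conj_mem_filt (hp : p ∈ parab J wt) (hA : A ∈ filt J wt k) :
    p⁻¹ * A * p ∈ filt J wt k :=
  ⟨hJ.conj_mem_so hp hA.1, hJ.conj_mem_lowFil hp hA.2⟩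

theorem inv_inv (hp : p ∈ parab J wt) : p⁻¹⁻¹ = p :=
  Matrix.inv_eq_left_inv (hJ.mul_inv hp)

theorem conj_inv_mem_so (hp : p ∈ parab J wt) (hA : A ∈ skewAdjointMatricesSubmodule J) :
    p * A * p⁻¹ ∈ skewAdjointMatricesSubmodule J := by
  simpa only [hJ.inv_inv hp] using hJ.conj_mem_so (hJ.inv_mem hp) hA

theorem conj_inv_mem_filt (hp : p ∈ parab J wt) (hA : A ∈ filt J wt k) :
    p * A * p⁻¹ ∈ filt J wt k := by
  simpa only [hJ.inv_inv hp] using hJ.conj_mem_filt (hJ.inv_mem hp) hA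

theorem conj_conj_inv (hp : p ∈ parab J wt) (A : Matrix n n ℝ) : p⁻¹ * (p * A * p⁻¹) * p = A := by
  calc p⁻¹ * (p * A * p⁻¹) * p = (p⁻¹ * p) * A * (p⁻¹ * p) := by noncomm_ring
    _ = A := by rw [hJ.inv_mul hp]; simp

theorem conj_inv_conj (hp : p ∈ parab J wt) (A : Matrix n n ℝ) : p * (p⁻¹ * A * p) * p⁻¹ = A := by
  simpa only [hJ.inv_inv hp] using hJ.conj_conj_inv (hJ.inv_mem hp) A

/-- The homogeneous components of an element of `so(J)` are in `so(J)`. -/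
theorem component_mem_so (hA : A ∈ skewAdjointMatricesSubmodule J) (d : ℤ) :
    component wt d A ∈ skewAdjointMatricesSubmodule J := by
  rw [mem_so] at *
  ext i j
  have h := congrFun (congrFun hA i) j
  simp only [Matrix.mul_apply, Matrix.transpose_apply, Matrix.neg_apply,
    component, Matrix.of_apply] at h ⊢
  have h1 : ∀ r, (if wt r - wt i = d then A r i else 0) * J r j =
      (if c - wt j - wt i = d then (1 : ℝ) else 0) * (A r i * J r j) := by
    intro r
    by_cases h0 : J r j = 0
    · simp [h0]
    · rw [← hJ.supp _ _ h0, add_sub_cancel_right]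
      split_ifs <;> simp
  have h2 : ∀ r, J i r * (if wt r - wt j = d then A r j else 0) =
      (if c - wt j - wt i = d then (1 : ℝ) else 0) * (J i r * A r j) := by
    intro r
    by_cases h0 : J i r = 0
    · simp [h0]
    · rw [← hJ.supp _ _ h0, show wt i + wt r - wt j - wt i = wt r - wt j by ring]
      split_ifs <;> simp
  simp only [h1, h2, ← Finset.mul_sum, h, mul_neg]

end IsGradedForm

end Filtration

/-! ### Entrywise derivatives of matrix-valued functions -/

section Deriv

variable {E : Type} [NormedAddCommGroup E] [NormedSpace ℝ E]
variable {m n : Type} [Fintype n] [DecidableEq n]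

/-- The entrywise directional derivative of a matrix-valued function. -/
def mderiv (g : E → Matrix n n ℝ) (x v : E) : Matrix n n ℝ :=
  Matrix.of fun i j => fderiv ℝ (fun y => g y i j) x v

/-- Entrywise differentiability. -/
def MDiffAt (g : E → Matrix n n ℝ) (x : E) : Prop :=
  ∀ i j, DifferentiableAt ℝ (fun y => g y i j) x

/-- Entrywise smoothness. -/
def MSmoothOn (g : E → Matrix n n ℝ) (U : Set E) : Prop :=
  ∀ i j, ContDiffOn ℝ ∞ (fun y => g y i j) U

variable {g h : E → Matrix n n ℝ} {x v w : E} {U : Set E}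

theorem MSmoothOn.mdiffAt (hg : MSmoothOn g U) (hU : IsOpen U) (hx : x ∈ U) : MDiffAt g x :=
  fun i j => ((hg i j).contDiffAt (hU.mem_nhds hx)).differentiableAt (by simp)

theorem MSmoothOn.add (hg : MSmoothOn g U) (hh : MSmoothOn h U) :
    MSmoothOn (fun y => g y + h y) U := fun i j => (hg i j).add (hh i j)

theorem MSmoothOn.sub (hg : MSmoothOn g U) (hh : MSmoothOn h U) :
    MSmoothOn (fun y => g y - h y) U := fun i j => (hg i j).sub (hh i j)

theorem MSmoothOn.const_smul (hg : MSmoothOn g U) (c : ℝ) :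
    MSmoothOn (fun y => c • g y) U := fun i j => contDiffOn_const.mul (hg i j)

theorem MSmoothOn.transpose (hg : MSmoothOn g U) : MSmoothOn (fun y => (g y)ᵀ) U :=
  fun i j => hg j i

theorem MSmoothOn.const (A : Matrix n n ℝ) : MSmoothOn (fun _ : E => A) U :=
  fun _ _ => contDiffOn_const

theorem MSmoothOn.mul (hg : MSmoothOn g U) (hh : MSmoothOn h U) :
    MSmoothOn (fun y => g y * h y) U := by
  intro i j
  simp only [Matrix.mul_apply]
  exact ContDiffOn.sum fun r _ => (hg i r).mul (hh r j)

theorem MSmoothOn.mderiv (hg : MSmoothOn g U) (hU : IsOpen U) (v : E) :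
    MSmoothOn (fun y => mderiv g y v) U := by
  intro i j
  exact ((hg i j).fderiv_of_isOpen hU (by simp)).clm_apply contDiffOn_const

theorem mderiv_add (hg : MDiffAt g x) (hh : MDiffAt h x) :
    mderiv (fun y => g y + h y) x v = mderiv g x v + mderiv h x v := by
  ext i j
  simp only [mderiv, Matrix.of_apply, Matrix.add_apply]
  rw [fderiv_fun_add (hg i j) (hh i j)]
  rfl

theorem mderiv_sub (hg : MDiffAt g x) (hh : MDiffAt h x) :
    mderiv (fun y => g y - h y) x v = mderiv g x v - mderiv h x v := by
  ext i j
  simp only [mderiv, Matrix.of_apply, Matrix.sub_apply]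
  rw [fderiv_fun_sub (hg i j) (hh i j)]
  rfl

theorem mderiv_const (A : Matrix n n ℝ) : mderiv (fun _ : E => A) x v = 0 := by
  ext i j
  simp [mderiv]

theorem mderiv_mul (hg : MDiffAt g x) (hh : MDiffAt h x) :
    mderiv (fun y => g y * h y) x v = mderiv g x v * h x + g x * mderiv h x v := by
  ext i j
  simp only [mderiv, Matrix.of_apply, Matrix.mul_apply, Matrix.add_apply]
  rw [fderiv_fun_sum fun r _ => (hg i r).fun_mul (hh r j)]
  simp only [_root_.sum_apply, ← Finset.sum_add_distrib]
  refine Finset.sum_congr rfl fun r _ => ?_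
  rw [fderiv_fun_mul (hg i r) (hh r j)]
  simp
  ring

theorem MDiffAt.mul (hg : MDiffAt g x) (hh : MDiffAt h x) : MDiffAt (fun y => g y * h y) x := by
  intro i j
  simp only [Matrix.mul_apply]
  exact DifferentiableAt.fun_sum fun r _ => (hg i r).mul (hh r j)

theorem mderiv_transpose : mderiv (fun y => (g y)ᵀ) x v = (mderiv g x v)ᵀ := rfl

theorem mderiv_congr (hU : IsOpen U) (hx : x ∈ U) (hgh : ∀ y ∈ U, g y = h y) :
    mderiv g x v = mderiv h x v := by
  ext i j
  simp only [mderiv, Matrix.of_apply]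
  rw [Filter.EventuallyEq.fderiv_eq]
  filter_upwards [hU.mem_nhds hx] with y hy
  rw [hgh y hy]

theorem MSmoothOn.congr (hg : MSmoothOn g U) (hgh : ∀ y ∈ U, h y = g y) : MSmoothOn h U :=
  fun i j => (hg i j).congr fun y hy => by rw [hgh y hy]

/-- Derivatives of functions with values in a linear space of matrices take values in it. -/
theorem mderiv_mem {S : Submodule ℝ (Matrix n n ℝ)} (hU : IsOpen U) (hx : x ∈ U)
    (hg : MDiffAt g x) (hgS : ∀ y ∈ U, g y ∈ S) : mderiv g x v ∈ S := by
  -- Linear functionals that vanish on `S` commute with the derivative.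
  by_contra hcon
  obtain ⟨f, hf, hfS⟩ := Submodule.exists_le_ker_of_notMem hcon
  apply hf
  have key : ∀ A : Matrix n n ℝ, f A = ∑ i, ∑ j, A i j * f (Matrix.single i j 1) := by
    intro A
    conv_lhs => rw [Matrix.matrix_eq_sum_single A]
    simp only [map_sum]
    refine Finset.sum_congr rfl fun i _ => Finset.sum_congr rfl fun j _ => ?_
    rw [← smul_eq_mul, ← map_smul, Matrix.smul_single, smul_eq_mul, mul_one]
  have h1 : HasFDerivAt (fun y => f (g y))
      (∑ i, ∑ j, f (Matrix.single i j 1) • fderiv ℝ (fun y => g y i j) x) x := by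
    simp only [key (g _)]
    exact HasFDerivAt.fun_sum fun i _ => HasFDerivAt.fun_sum fun j _ =>
      (hg i j).hasFDerivAt.mul_const _
  have h2 : HasFDerivAt (fun y => f (g y)) (0 : E →L[ℝ] ℝ) x := by
    refine (hasFDerivAt_const (0 : ℝ) x).congr_of_eventuallyEq ?_
    filter_upwards [hU.mem_nhds hx] with y hy
    exact hfS (hgS y hy)
  have h3 := congrArg (fun L : E →L[ℝ] ℝ => L v) (h1.unique h2)
  rw [key]
  simpa [mderiv, mul_comm] using h3

/-- Symmetry of second derivatives. -/
theorem mderiv_mderiv_comm (hg : MSmoothOn g U) (hU : IsOpen U) (hx : x ∈ U) :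
    mderiv (fun y => mderiv g y v) x w = mderiv (fun y => mderiv g y w) x v := by
  ext i j
  have two_le : (2 : WithTop ℕ∞) ≤ ∞ := WithTop.coe_le_coe.2 (le_top : (2 : ℕ∞) ≤ ⊤)
  have h0 : ContDiffAt ℝ ∞ (fun y => g y i j) x := (hg i j).contDiffAt (hU.mem_nhds hx)
  have h1 : DifferentiableAt ℝ (fderiv ℝ (fun y => g y i j)) x :=
    (h0.fderiv_right (m := 1) (one_add_one_eq_two.trans_le two_le)).differentiableAt (by simp)
  have h2 : IsSymmSndFDerivAt ℝ (fun y => g y i j) x := h0.isSymmSndFDerivAt (by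
    rwa [minSmoothness_of_isRCLikeNormedField])
  simp only [mderiv, Matrix.of_apply]
  rw [fderiv_clm_apply h1 (differentiableAt_const v),
    fderiv_clm_apply h1 (differentiableAt_const w)]
  simpa using h2 w v

end Deriv

/-! ### Curvature and its equivariance -/

section Curvature

variable {E : Type} [NormedAddCommGroup E] [NormedSpace ℝ E]
variable {n : Type} [Fintype n] [DecidableEq n]
variable {J : Matrix n n ℝ} {wt : n → ℤ} {c : ℤ} {U : Set E} {θ : E → E →ₗ[ℝ] Matrix n n ℝ}
variable {x : E}

theorem curvatureForm_def (θ : E → E →ₗ[ℝ] Matrix n n ℝ) (x v w : E) :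
    curvatureForm θ x v w =
      mderiv (fun y => θ y w) x v - mderiv (fun y => θ y v) x w + ⁅θ x v, θ x w⁆ := rfl

theorem mderiv_add_right (g : E → Matrix n n ℝ) (x v w : E) :
    mderiv g x (v + w) = mderiv g x v + mderiv g x w := by
  ext i j
  simp [mderiv]

theorem mderiv_smul_right (g : E → Matrix n n ℝ) (x : E) (r : ℝ) (v : E) :
    mderiv g x (r • v) = r • mderiv g x v := by
  ext i j
  simp [mderiv]

theorem mderiv_const_smul {g : E → Matrix n n ℝ} (r : ℝ) (hg : MDiffAt g x) (v : E) :
    mderiv (fun y => r • g y) x v = r • mderiv g x v := by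
  ext i j
  simp only [mderiv, Matrix.of_apply, Matrix.smul_apply, smul_eq_mul]
  rw [fderiv_const_mul (hg i j)]
  rfl

theorem curvatureForm_swap (θ : E → E →ₗ[ℝ] Matrix n n ℝ) (x v w : E) :
    curvatureForm θ x w v = -curvatureForm θ x v w := by
  rw [curvatureForm_def, curvatureForm_def, lie_skew_mat (θ x v)]
  abel

namespace IsCartanGauge

variable (hθ : IsCartanGauge J wt U θ) (hx : x ∈ U)
include hθ

theorem mSmoothOn (v : E) : MSmoothOn (fun y => θ y v) U := hθ.smooth v

include hx

theorem mdiffAt (v : E) : MDiffAt (fun y => θ y v) x := (hθ.mSmoothOn v).mdiffAt hθ.isOpen hx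

theorem curvatureForm_mem_so (v w : E) :
    curvatureForm θ x v w ∈ skewAdjointMatricesSubmodule J := by
  rw [curvatureForm_def]
  have h : ∀ v w : E, mderiv (fun y => θ y w) x v ∈ skewAdjointMatricesSubmodule J := fun v w =>
    mderiv_mem hθ.isOpen hx (hθ.mdiffAt hx w) fun y hy => hθ.mem y hy w
  exact add_mem (sub_mem (h _ _) (h _ _)) (lie_mem_so (hθ.mem x hx v) (hθ.mem x hx w))

theorem curvatureForm_add_right (u v w : E) :
    curvatureForm θ x u (v + w) = curvatureForm θ x u v + curvatureForm θ x u w := by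
  simp only [curvatureForm_def, map_add, lie_add_mat, mderiv_add_right,
    mderiv_add (hθ.mdiffAt hx v) (hθ.mdiffAt hx w)]
  abel

theorem curvatureForm_smul_right (r : ℝ) (u v : E) :
    curvatureForm θ x u (r • v) = r • curvatureForm θ x u v := by
  simp only [curvatureForm_def, map_smul, lie_smul_mat, mderiv_smul_right,
    mderiv_const_smul r (hθ.mdiffAt hx v), smul_add, smul_sub]

/-- The curvature form at a point as a bilinear map. -/
def curvatureLin : E →ₗ[ℝ] E →ₗ[ℝ] Matrix n n ℝ :=
  LinearMap.mk₂ ℝ (curvatureForm θ x)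
    (fun u v w => by
      rw [← neg_inj, ← curvatureForm_swap, neg_add, ← curvatureForm_swap, ← curvatureForm_swap,
        hθ.curvatureForm_add_right hx])
    (fun r u w => by
      rw [← neg_inj, ← curvatureForm_swap, ← smul_neg, ← curvatureForm_swap,
        hθ.curvatureForm_smul_right hx])
    (hθ.curvatureForm_add_right hx) (fun r u v => hθ.curvatureForm_smul_right hx r u v)

theorem curvatureLin_apply (v w : E) : hθ.curvatureLin hx v w = curvatureForm θ x v w := rfl

theorem eq_of_sub_mem {v w : E} (h : θ x v - θ x w ∈ filt J wt 0) : v = w := by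
  obtain ⟨u, -, hu⟩ := hθ.iso x hx (θ x v) (hθ.mem x hx v)
  rw [hu v (by simp), hu w h]

theorem eq_zero_of_mem {v : E} (h : θ x v ∈ filt J wt 0) : v = 0 :=
  hθ.eq_of_sub_mem hx (by simpa using h)

variable (hJ : IsGradedForm J wt c) {p A B : Matrix n n ℝ} (hp : p ∈ parab J wt)
include hJ hp

/-- `omegaInv` is defined by choice; the isomorphism `T_x U ≅ 𝔤/𝔭` determines its value. -/
theorem omegaInv_eq {v : E} (h : A - p⁻¹ * θ x v * p ∈ filt J wt 0) :
    omegaInv J wt θ x p A = v := by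
  have h1 := Classical.epsilon_spec (p := fun v => ∃ ξ ∈ filt J wt 0, cartanForm θ x p v ξ = A)
    ⟨v, _, h, by simp [cartanForm]⟩
  obtain ⟨ξ, hξ, h1⟩ := h1
  refine hθ.eq_of_sub_mem hx ?_
  change p⁻¹ * θ x (omegaInv J wt θ x p A) * p + ξ = A at h1
  have h2 := hJ.conj_inv_mem_filt hp (sub_mem h hξ)
  rw [← h1, show p⁻¹ * θ x (omegaInv J wt θ x p A) * p + ξ - p⁻¹ * θ x v * p - ξ =
    p⁻¹ * (θ x (omegaInv J wt θ x p A) - θ x v) * p by noncomm_ring, hJ.conj_inv_conj hp] at h2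
  exact h2

theorem omegaInv_spec (hA : A ∈ skewAdjointMatricesSubmodule J) :
    A - p⁻¹ * θ x (omegaInv J wt θ x p A) * p ∈ filt J wt 0 := by
  obtain ⟨v, hv, -⟩ := hθ.iso x hx _ (hJ.conj_inv_mem_so hp hA)
  have h1 := hJ.conj_mem_filt hp hv
  rw [show p⁻¹ * (p * A * p⁻¹ - θ x v) * p = p⁻¹ * (p * A * p⁻¹) * p - p⁻¹ * θ x v * p by
    noncomm_ring, hJ.conj_conj_inv hp] at h1
  rwa [hθ.omegaInv_eq hx hJ hp h1]

theorem kappa_eq {v w : E} (hA : A - p⁻¹ * θ x v * p ∈ filt J wt 0)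
    (hB : B - p⁻¹ * θ x w * p ∈ filt J wt 0) :
    kappa J wt θ x p A B = p⁻¹ * curvatureForm θ x v w * p := by
  rw [kappa, hθ.omegaInv_eq hx hJ hp hA, hθ.omegaInv_eq hx hJ hp hB]

omit hp in
theorem kappa_one {v w : E} (hA : A - θ x v ∈ filt J wt 0) (hB : B - θ x w ∈ filt J wt 0) :
    kappa J wt θ x 1 A B = curvatureForm θ x v w := by
  have h := hθ.kappa_eq hx hJ (p := 1) one_mem_parab (A := A) (B := B) (v := v) (w := w)
    (by simpa using hA) (by simpa using hB)
  simpa using h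

end IsCartanGauge

end Curvature

/-! ### The codifferential -/

section Codiff

variable {n : Type} [Fintype n] [DecidableEq n]

/-- The trilinear map `(Z, W, X) ↦ ∂*(Z ∧ W ⊗ X)`. -/
def codiffTri : Matrix n n ℝ →ₗ[ℝ] Matrix n n ℝ →ₗ[ℝ] Matrix n n ℝ →ₗ[ℝ]
    Matrix n n ℝ ⊗[ℝ] Matrix n n ℝ :=
  LinearMap.mk₂ ℝ
    (fun Z W =>
      { toFun := fun X => Z ⊗ₜ[ℝ] ⁅W, X⁆ - W ⊗ₜ[ℝ] ⁅Z, X⁆ - ⁅Z, W⁆ ⊗ₜ[ℝ] X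
        map_add' := fun X Y => by
          simp only [lie_add_mat, TensorProduct.tmul_add]; abel
        map_smul' := fun r X => by
          simp only [lie_smul_mat, TensorProduct.tmul_smul, smul_sub, RingHom.id_apply] })
    (fun Z Z' W => by
      ext X : 1
      simp only [LinearMap.coe_mk, AddHom.coe_mk, LinearMap.add_apply, add_lie_mat,
        TensorProduct.tmul_add, TensorProduct.add_tmul]
      abel)
    (fun r Z W => by
      ext X : 1
      simp only [LinearMap.coe_mk, AddHom.coe_mk, LinearMap.smul_apply, smul_lie_mat,
        TensorProduct.tmul_smul, ← TensorProduct.smul_tmul', smul_sub])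
    (fun Z W W' => by
      ext X : 1
      simp only [LinearMap.coe_mk, AddHom.coe_mk, LinearMap.add_apply, add_lie_mat, lie_add_mat,
        TensorProduct.tmul_add, TensorProduct.add_tmul]
      abel)
    (fun r Z W => by
      ext X : 1
      simp only [LinearMap.coe_mk, AddHom.coe_mk, LinearMap.smul_apply, smul_lie_mat, lie_smul_mat,
        TensorProduct.tmul_smul, ← TensorProduct.smul_tmul', smul_sub])

theorem codiffTri_apply (Z W X : Matrix n n ℝ) :
    codiffTri Z W X = Z ⊗ₜ[ℝ] ⁅W, X⁆ - W ⊗ₜ[ℝ] ⁅Z, X⁆ - ⁅Z, W⁆ ⊗ₜ[ℝ] X := rfl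

theorem codiffTri_swap (Z W X : Matrix n n ℝ) : codiffTri W Z X = -codiffTri Z W X := by
  rw [codiffTri_apply, codiffTri_apply, lie_skew_mat Z W, TensorProduct.neg_tmul]
  abel

variable {ι : Type} [Fintype ι]

theorem codiff_eq (e Z : ι → Matrix n n ℝ) (κ : Matrix n n ℝ → Matrix n n ℝ → Matrix n n ℝ) :
    codiff e Z κ = (2⁻¹ : ℝ) • ∑ a, ∑ b, codiffTri (Z a) (Z b) (κ (e a) (e b)) := rfl

/-- The sum defining `∂*` does not depend on the choice of dual frames. -/
theorem sum_codiffTri_change (Z Z' : ι → Matrix n n ℝ) (r : ι → ι → ℝ)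
    (hZ : ∀ d, Z d = ∑ a, r d a • Z' a) (K : ι → ι → Matrix n n ℝ) :
    ∑ a, ∑ b, codiffTri (Z' a) (Z' b) (∑ d, ∑ f, (r d a * r f b) • K d f) =
      ∑ d, ∑ f, codiffTri (Z d) (Z f) (K d f) := by
  have h1 : ∀ d f, codiffTri (Z d) (Z f) (K d f) =
      ∑ a, ∑ b, (r d a * r f b) • codiffTri (Z' a) (Z' b) (K d f) := by
    intro d f
    simp only [hZ d, hZ f, map_sum, map_smul, LinearMap.sum_apply, LinearMap.smul_apply,
      Finset.smul_sum, mul_smul]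
    rw [Finset.sum_comm]
    refine Finset.sum_congr rfl fun a _ => Finset.sum_congr rfl fun b _ => ?_
    rw [smul_comm]
  simp only [h1, map_sum, map_smul]
  calc _ = ∑ a, ∑ d, ∑ f, ∑ b, (r d a * r f b) • codiffTri (Z' a) (Z' b) (K d f) := by
        refine Finset.sum_congr rfl fun a _ => ?_
        rw [Finset.sum_comm]
        exact Finset.sum_congr rfl fun d _ => Finset.sum_comm
    _ = _ := by
        rw [Finset.sum_comm]
        exact Finset.sum_congr rfl fun d _ => Finset.sum_comm

/-- If the curvature is decomposable, with commuting entries, then `∂*` vanishes. -/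
theorem codiff_eq_zero_of_decomposable (e Z : ι → Matrix n n ℝ)
    (κ : Matrix n n ℝ → Matrix n n ℝ → Matrix n n ℝ) (s t : ι → ℝ) (L N W : Matrix n n ℝ)
    (hκ : ∀ a b, κ (e a) (e b) = (s a * t b - t a * s b) • W) (hL : ∑ a, s a • Z a = L)
    (hN : ∑ a, t a • Z a = N) (hLN : ⁅L, N⁆ = 0) (hLW : ⁅L, W⁆ = 0) (hNW : ⁅N, W⁆ = 0) :
    codiff e Z κ = 0 := by
  have h1 : ∀ (s t : ι → ℝ), ∑ a, ∑ b, (s a * t b) • codiffTri (Z a) (Z b) W =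
      codiffTri (∑ a, s a • Z a) (∑ a, t a • Z a) W := by
    intro s t
    simp only [map_sum, map_smul, LinearMap.sum_apply, LinearMap.smul_apply, Finset.smul_sum,
      mul_smul]
    rw [Finset.sum_comm]
    refine Finset.sum_congr rfl fun a _ => Finset.sum_congr rfl fun b _ => ?_
    rw [smul_comm]
  have h2 : codiffTri L N W = 0 := by simp [codiffTri_apply, hLN, hLW, hNW]
  simp only [codiff_eq, hκ, map_smul, sub_smul, map_sub, Finset.sum_sub_distrib]
  rw [h1 s t, h1 t s, hL, hN, codiffTri_swap L N W, h2, neg_zero, sub_zero, smul_zero]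

/-- Bases of `𝔤/𝔭` and `𝔭₊` which are dual with respect to the invariant form `-½ tr(AB)`. -/
structure IsDualFrame (J : Matrix n n ℝ) (wt : n → ℤ) (e Z : ι → Matrix n n ℝ) : Prop where
  e_mem : ∀ a, e a ∈ skewAdjointMatricesSubmodule J
  Z_mem : ∀ a, Z a ∈ filt J wt 1
  expand : ∀ A ∈ skewAdjointMatricesSubmodule J,
    A - ∑ a, (-2⁻¹ * (A * Z a).trace) • e a ∈ filt J wt 0
  coexpand : ∀ W ∈ filt J wt 1, W = ∑ a, (-2⁻¹ * (e a * W).trace) • Z a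

variable {E : Type} [NormedAddCommGroup E] [NormedSpace ℝ E]
variable {J : Matrix n n ℝ} {wt : n → ℤ} {c : ℤ} {U : Set E} {θ : E → E →ₗ[ℝ] Matrix n n ℝ}
variable {x : E} {e Z : ι → Matrix n n ℝ} {p : Matrix n n ℝ}

/-- Conjugation by `p⁻¹`. -/
def conjLin (p : Matrix n n ℝ) : Matrix n n ℝ →ₗ[ℝ] Matrix n n ℝ :=
  LinearMap.mulLeftRight ℝ (p⁻¹, p)

theorem conjLin_apply (p A : Matrix n n ℝ) : conjLin p A = p⁻¹ * A * p := by
  simp [conjLin, LinearMap.mulLeftRight_apply]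

theorem map_conj_codiffTri (hJ : IsGradedForm J wt c) (hp : p ∈ parab J wt)
    (Z W X : Matrix n n ℝ) :
    TensorProduct.map (conjLin p) (conjLin p) (codiffTri Z W X) =
      codiffTri (conjLin p Z) (conjLin p W) (conjLin p X) := by
  have h : ∀ A B, conjLin p ⁅A, B⁆ = ⁅conjLin p A, conjLin p B⁆ := by
    intro A B
    have hm : ∀ A B : Matrix n n ℝ, p⁻¹ * (A * B) * p = (p⁻¹ * A * p) * (p⁻¹ * B * p) := by
      intro A B
      calc p⁻¹ * (A * B) * p = p⁻¹ * A * 1 * B * p := by noncomm_ring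
        _ = (p⁻¹ * A * p) * (p⁻¹ * B * p) := by rw [← hJ.mul_inv hp]; noncomm_ring
    simp only [conjLin_apply, Ring.lie_def, mul_sub, sub_mul, hm]
  simp only [codiffTri_apply, map_sub, TensorProduct.map_tmul, h]

/-- Equivariance of `∂* κ`: it vanishes on a fibre if it vanishes at one point of it. -/
theorem IsCartanGauge.codiff_kappa_eq_zero (hθ : IsCartanGauge J wt U θ) (hx : x ∈ U)
    (hJ : IsGradedForm J wt c) (he : IsDualFrame J wt e Z) (hp : p ∈ parab J wt)
    (h1 : codiff e Z (kappa J wt θ x 1) = 0) : codiff e Z (kappa J wt θ x p) = 0 := by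
  set v : ι → E := fun a => omegaInv J wt θ x 1 (e a) with hv
  have hv' : ∀ a, e a - θ x (v a) ∈ filt J wt 0 := by
    intro a
    simpa using hθ.omegaInv_spec hx hJ one_mem_parab (he.e_mem a)
  set r : ι → ι → ℝ := fun d a => -2⁻¹ * (p * e a * p⁻¹ * Z d).trace with hr
  have hu : ∀ a, e a - p⁻¹ * θ x (∑ d, r d a • v d) * p ∈ filt J wt 0 := by
    intro a
    have h2 : p * e a * p⁻¹ - θ x (∑ d, r d a • v d) ∈ filt J wt 0 := by
      have h3 := add_mem (he.expand _ (hJ.conj_inv_mem_so hp (he.e_mem a)))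
        (sum_mem fun d (_ : d ∈ Finset.univ) => (filt J wt 0).smul_mem (r d a) (hv' d))
      simp only [smul_sub, Finset.sum_sub_distrib] at h3
      simpa [map_sum, hr] using h3
    have h4 := hJ.conj_mem_filt hp h2
    rwa [mul_sub, sub_mul, hJ.conj_conj_inv hp] at h4
  have hκ : ∀ a b, kappa J wt θ x p (e a) (e b) =
      conjLin p (∑ d, ∑ f, (r d a * r f b) • kappa J wt θ x 1 (e d) (e f)) := by
    intro a b
    rw [hθ.kappa_eq hx hJ hp (hu a) (hu b), conjLin_apply]
    congr 2
    simp only [hθ.kappa_one hx hJ (hv' _) (hv' _), ← hθ.curvatureLin_apply hx, map_sum, map_smul,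
      LinearMap.sum_apply, LinearMap.smul_apply, Finset.smul_sum, mul_smul]
    rw [Finset.sum_comm]
    refine Finset.sum_congr rfl fun a _ => Finset.sum_congr rfl fun b _ => ?_
    rw [smul_comm]
  have hZ : ∀ d, Z d = ∑ a, r d a • (p * Z a * p⁻¹) := by
    intro d
    have h2 := he.coexpand _ (hJ.conj_mem_filt hp (he.Z_mem d))
    calc Z d = p * (p⁻¹ * Z d * p) * p⁻¹ := (hJ.conj_inv_conj hp _).symm
      _ = ∑ a, r d a • (p * Z a * p⁻¹) := by
        rw [h2, Matrix.mul_sum, Matrix.sum_mul]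
        refine Finset.sum_congr rfl fun a _ => ?_
        rw [Matrix.mul_smul, Matrix.smul_mul, hr]
        congr 2
        rw [← Matrix.mul_assoc, Matrix.trace_mul_comm, ← Matrix.mul_assoc, ← Matrix.mul_assoc]
  have h5 : ∀ a, Z a = conjLin p (p * Z a * p⁻¹) := fun a => by
    rw [conjLin_apply, hJ.conj_conj_inv hp]
  have h6 : codiff e Z (kappa J wt θ x p) =
      TensorProduct.map (conjLin p) (conjLin p) (codiff e Z (kappa J wt θ x 1)) := by
    rw [codiff_eq, codiff_eq, ← sum_codiffTri_change Z (fun a => p * Z a * p⁻¹) r hZ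
      (fun d f => kappa J wt θ x 1 (e d) (e f)), map_smul, map_sum]
    congr 1
    refine Finset.sum_congr rfl fun a _ => ?_
    rw [map_sum]
    refine Finset.sum_congr rfl fun b _ => ?_
    rw [map_conj_codiffTri hJ hp, ← h5, ← h5, hκ]
  rw [h6, h1, map_zero]

end Codiff

/-! ### Gauge transformations -/

section Gauge

variable {E : Type} [NormedAddCommGroup E] [NormedSpace ℝ E]
variable {n : Type} [Fintype n] [DecidableEq n]
variable {J : Matrix n n ℝ} {wt : n → ℤ} {c : ℤ} {U : Set E}
variable {θ θ₁ θ₂ θ₃ : E → E →ₗ[ℝ] Matrix n n ℝ} {x : E} {p A B : Matrix n n ℝ}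

/-- At the point `x`, the forms `θ₁` and `θ₂` have the properties of pull-backs of one Cartan
connection along two sections that differ by an element of the parabolic subgroup: their values
modulo `𝔭` and their curvatures are conjugate. -/
def GaugeRel (J : Matrix n n ℝ) (wt : n → ℤ) (θ₁ θ₂ : E → E →ₗ[ℝ] Matrix n n ℝ) (x : E) : Prop :=
  ∃ g ∈ parab J wt, (∀ v, θ₂ x v - g⁻¹ * θ₁ x v * g ∈ filt J wt 0) ∧
    ∀ v w, curvatureForm θ₂ x v w = g⁻¹ * curvatureForm θ₁ x v w * g

theorem GaugeRel.trans (hJ : IsGradedForm J wt c) (h₁ : GaugeRel J wt θ₁ θ₂ x)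
    (h₂ : GaugeRel J wt θ₂ θ₃ x) : GaugeRel J wt θ₁ θ₃ x := by
  obtain ⟨g, hg, h1, h2⟩ := h₁
  obtain ⟨g', hg', h1', h2'⟩ := h₂
  refine ⟨g * g', mul_mem_parab hg hg', fun v => ?_, fun v w => ?_⟩
  · have h3 := add_mem (h1' v) (hJ.conj_mem_filt hg' (h1 v))
    convert h3 using 1
    rw [Matrix.mul_inv_rev]
    noncomm_ring
  · rw [h2', h2, Matrix.mul_inv_rev]
    noncomm_ring

theorem GaugeRel.symm (hJ : IsGradedForm J wt c) (h : GaugeRel J wt θ₁ θ₂ x) :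
    GaugeRel J wt θ₂ θ₁ x := by
  obtain ⟨g, hg, h1, h2⟩ := h
  refine ⟨g⁻¹, hJ.inv_mem hg, fun v => ?_, fun v w => ?_⟩
  · have h3 := neg_mem (hJ.conj_inv_mem_filt hg (h1 v))
    rw [mul_sub, sub_mul, hJ.conj_inv_conj hg, neg_sub] at h3
    rwa [hJ.inv_inv hg]
  · rw [hJ.inv_inv hg, h2, hJ.conj_inv_conj hg]

/-- Changing the section amounts to moving along the fibres. -/
theorem exists_kappa_eq_of_gaugeRel (hJ : IsGradedForm J wt c) (h : GaugeRel J wt θ₁ θ₂ x) :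
    ∃ g ∈ parab J wt, ∀ p ∈ parab J wt, ∀ A B,
      kappa J wt θ₂ x p A B = kappa J wt θ₁ x (g * p) A B := by
  obtain ⟨g, hg, h1, h2⟩ := h
  refine ⟨g, hg, fun p hp A B => ?_⟩
  have key : ∀ A, omegaInv J wt θ₂ x p A = omegaInv J wt θ₁ x (g * p) A := by
    intro A
    unfold omegaInv
    congr 1
    funext v
    have h3 : p⁻¹ * θ₂ x v * p - (g * p)⁻¹ * θ₁ x v * (g * p) ∈ filt J wt 0 := by
      have h4 := hJ.conj_mem_filt hp (h1 v)
      rw [mul_sub, sub_mul] at h4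
      convert h4 using 2
      rw [Matrix.mul_inv_rev]
      noncomm_ring
    refine propext ⟨?_, ?_⟩
    · rintro ⟨ξ, hξ, rfl⟩
      exact ⟨_, add_mem h3 hξ, by simp only [cartanForm]; abel⟩
    · rintro ⟨ξ, hξ, rfl⟩
      exact ⟨_, sub_mem hξ h3, by simp only [cartanForm]; abel⟩
  simp only [kappa, key, h2]
  rw [Matrix.mul_inv_rev]
  noncomm_ring

/-- The pull-back of the Cartan connection of `θ` along the section `g`. -/
def gaugeTrans (θ : E → E →ₗ[ℝ] Matrix n n ℝ) (g : E → Matrix n n ℝ) :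
    E → E →ₗ[ℝ] Matrix n n ℝ := fun x =>
  { toFun := fun v => (g x)⁻¹ * θ x v * g x + (g x)⁻¹ * mderiv g x v
    map_add' := fun v w => by
      rw [map_add, mderiv_add_right]; noncomm_ring
    map_smul' := fun r v => by
      simp only [map_smul, mderiv_smul_right, Matrix.mul_smul, Matrix.smul_mul, smul_add,
        RingHom.id_apply] }

theorem gaugeTrans_apply (θ : E → E →ₗ[ℝ] Matrix n n ℝ) (g : E → Matrix n n ℝ) (x v : E) :
    gaugeTrans θ g x v = (g x)⁻¹ * θ x v * g x + (g x)⁻¹ * mderiv g x v := rfl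

variable {g : E → Matrix n n ℝ}

theorem MSmoothOn.inv (hJ : IsGradedForm J wt c) (hg : MSmoothOn g U)
    (hgP : ∀ y ∈ U, g y ∈ parab J wt) : MSmoothOn (fun y => (g y)⁻¹) U :=
  (((MSmoothOn.const J).mul hg.transpose).mul (MSmoothOn.const J)).congr fun y hy =>
    hJ.inv_eq (hgP y hy).1

theorem mderiv_inv (hJ : IsGradedForm J wt c) (hU : IsOpen U) (hx : x ∈ U) (hg : MSmoothOn g U)
    (hgP : ∀ y ∈ U, g y ∈ parab J wt) (v : E) :
    mderiv (fun y => (g y)⁻¹) x v = -((g x)⁻¹ * mderiv g x v * (g x)⁻¹) := by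
  have h1 : mderiv (fun y => (g y)⁻¹ * g y) x v = 0 := by
    rw [mderiv_congr hU hx (h := fun _ => 1) fun y hy => hJ.inv_mul (hgP y hy), mderiv_const]
  rw [mderiv_mul ((hg.inv hJ hgP).mdiffAt hU hx) (hg.mdiffAt hU hx)] at h1
  have h2 : mderiv (fun y => (g y)⁻¹) x v * g x * (g x)⁻¹ =
      -((g x)⁻¹ * mderiv g x v) * (g x)⁻¹ := by
    rw [eq_neg_of_add_eq_zero_left h1]
  rw [Matrix.mul_assoc, hJ.mul_inv (hgP x hx), Matrix.mul_one] at h2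
  rw [h2, Matrix.neg_mul]

/-- The pull-back of the Maurer-Cartan form of the parabolic subgroup is `𝔭`-valued. -/
theorem maurerCartan_mem (hJ : IsGradedForm J wt c) (hU : IsOpen U) (hx : x ∈ U)
    (hg : MSmoothOn g U) (hgP : ∀ y ∈ U, g y ∈ parab J wt) (v : E) :
    (g x)⁻¹ * mderiv g x v ∈ filt J wt 0 := by
  have hgx := hg.mdiffAt hU hx
  refine ⟨?_, ?_⟩
  · have h1 : mderiv (fun y => (g y)ᵀ * J * g y) x v = 0 := by
      rw [mderiv_congr hU hx (h := fun _ => J) fun y hy => (hgP y hy).1, mderiv_const]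
    have hgt : MDiffAt (fun y => (g y)ᵀ) x := fun i j => hgx j i
    have hJc : MDiffAt (fun _ : E => J) x := (MSmoothOn.const (U := U) J).mdiffAt hU hx
    rw [mderiv_mul (hgt.mul hJc) hgx, mderiv_mul hgt hJc, mderiv_const, Matrix.mul_zero, add_zero,
      mderiv_transpose] at h1
    rw [mem_so]
    have hJg : J * (g x)⁻¹ = (g x)ᵀ * J := by
      rw [hJ.inv_eq (hgP x hx).1, Matrix.mul_assoc, hJ.mul_left_cancel]
    have hJg' : ((g x)⁻¹)ᵀ * J = J * g x := by
      rw [hJ.inv_eq (hgP x hx).1]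
      simp only [Matrix.transpose_mul, Matrix.transpose_transpose, hJ.symm, Matrix.mul_assoc,
        hJ.sq, Matrix.mul_one]
    rw [Matrix.transpose_mul, Matrix.mul_assoc, hJg', ← Matrix.mul_assoc, ← Matrix.mul_assoc, hJg]
    exact eq_neg_of_add_eq_zero_left h1
  · have h1 : mderiv g x v ∈ lowFil wt 0 := mderiv_mem hU hx hgx fun y hy => (hgP y hy).2
    exact add_zero (0 : ℤ) ▸ mul_mem_lowFil (hJ.inv_mem (hgP x hx)).2 h1

theorem IsCartanGauge.gaugeTrans (hθ : IsCartanGauge J wt U θ) (hJ : IsGradedForm J wt c)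
    (hg : MSmoothOn g U) (hgP : ∀ y ∈ U, g y ∈ parab J wt) :
    IsCartanGauge J wt U (gaugeTrans θ g) := by
  have hmc := fun x hx v => maurerCartan_mem hJ hθ.isOpen (x := x) hx hg hgP v
  refine ⟨hθ.isOpen, ?_, ?_, ?_⟩
  · intro v
    change MSmoothOn _ U
    have hinv := hg.inv hJ hgP
    exact ((hinv.mul (hθ.mSmoothOn v)).mul hg).add (hinv.mul (hg.mderiv hθ.isOpen v))
  · intro x hx v
    exact add_mem (hJ.conj_mem_so (hgP x hx) (hθ.mem x hx v)) (hmc x hx v).1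
  · intro x hx A hA
    obtain ⟨v, hv, huniq⟩ := hθ.iso x hx _ (hJ.conj_inv_mem_so (hgP x hx) hA)
    have hiff : ∀ w, A - FreeDistribution.gaugeTrans θ g x w ∈ filt J wt 0 ↔
        g x * A * (g x)⁻¹ - θ x w ∈ filt J wt 0 := by
      intro w
      constructor
      · intro h
        have h1 := hJ.conj_inv_mem_filt (hgP x hx) (add_mem h (hmc x hx w))
        rw [gaugeTrans_apply, sub_add_eq_sub_sub, sub_add_cancel, mul_sub, sub_mul,
          hJ.conj_inv_conj (hgP x hx)] at h1
        exact h1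
      · intro h
        have h1 := sub_mem (hJ.conj_mem_filt (hgP x hx) h) (hmc x hx w)
        rw [mul_sub, sub_mul, hJ.conj_conj_inv (hgP x hx)] at h1
        rwa [gaugeTrans_apply, sub_add_eq_sub_sub]
    exact ⟨v, (hiff v).2 hv, fun w hw => huniq w ((hiff w).1 hw)⟩

theorem IsCartanGauge.curvatureForm_gaugeTrans (hθ : IsCartanGauge J wt U θ) (hx : x ∈ U)
    (hJ : IsGradedForm J wt c) (hg : MSmoothOn g U) (hgP : ∀ y ∈ U, g y ∈ parab J wt) (v w : E) :
    curvatureForm (FreeDistribution.gaugeTrans θ g) x v w =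
      (g x)⁻¹ * curvatureForm θ x v w * g x := by
  have hU := hθ.isOpen
  have hgx := hg.mdiffAt hU hx
  have hinv := hg.inv hJ hgP
  have hinvx := hinv.mdiffAt hU hx
  have hd : ∀ v w, mderiv (fun y => FreeDistribution.gaugeTrans θ g y w) x v =
      -((g x)⁻¹ * mderiv g x v * (g x)⁻¹) * θ x w * g x +
      (g x)⁻¹ * mderiv (fun y => θ y w) x v * g x + (g x)⁻¹ * θ x w * mderiv g x v +
      (-((g x)⁻¹ * mderiv g x v * (g x)⁻¹) * mderiv g x w +
        (g x)⁻¹ * mderiv (fun y => mderiv g y w) x v) := by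
    intro v w
    have h1 := ((hinv.mul (hθ.mSmoothOn w)).mul hg).mdiffAt hU hx
    have h2 := (hinv.mul (hg.mderiv hU w)).mdiffAt hU hx
    simp only [gaugeTrans_apply]
    rw [mderiv_add h1 h2, mderiv_mul (hinvx.mul (hθ.mdiffAt hx w)) hgx,
      mderiv_mul hinvx (hθ.mdiffAt hx w), mderiv_mul hinvx ((hg.mderiv hU w).mdiffAt hU hx),
      mderiv_inv hJ hU hx hg hgP]
    noncomm_ring
  have hgg : ∀ X, g x * ((g x)⁻¹ * X) = X := fun X => by
    rw [← Matrix.mul_assoc, hJ.mul_inv (hgP x hx), Matrix.one_mul]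
  rw [curvatureForm_def, curvatureForm_def, hd v w, hd w v, gaugeTrans_apply, gaugeTrans_apply,
    mderiv_mderiv_comm hg hU hx (v := v) (w := w)]
  simp only [Ring.lie_def, mul_add, add_mul, mul_sub, sub_mul, neg_mul, Matrix.mul_assoc, hgg]
  abel

theorem IsCartanGauge.gaugeRel_gaugeTrans (hθ : IsCartanGauge J wt U θ) (hx : x ∈ U)
    (hJ : IsGradedForm J wt c) (hg : MSmoothOn g U) (hgP : ∀ y ∈ U, g y ∈ parab J wt) :
    GaugeRel J wt θ (FreeDistribution.gaugeTrans θ g) x :=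
  ⟨g x, hgP x hx, fun v => by
    rw [gaugeTrans_apply, add_sub_cancel_left]
    exact maurerCartan_mem hJ hθ.isOpen hx hg hgP v,
    hθ.curvatureForm_gaugeTrans hx hJ hg hgP⟩

end Gauge

/-! ### Regularity and normality at a point -/

section Pointwise

variable {E : Type} [NormedAddCommGroup E] [NormedSpace ℝ E]
variable {n : Type} [Fintype n] [DecidableEq n]
variable {J : Matrix n n ℝ} {wt : n → ℤ} {c : ℤ} {U : Set E}
variable {θ θ₁ θ₂ : E → E →ₗ[ℝ] Matrix n n ℝ} {x : E} {p A B : Matrix n n ℝ}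
variable {ι : Type} [Fintype ι] {e Z : ι → Matrix n n ℝ}

/-- The curvature form of `θ` at `x` has only components of positive homogeneity. -/
def RegularAt (J : Matrix n n ℝ) (wt : n → ℤ) (θ : E → E →ₗ[ℝ] Matrix n n ℝ) (x : E) : Prop :=
  ∀ i j : ℤ, i ≤ 0 → j ≤ 0 → ∀ v w, θ x v ∈ filt J wt i → θ x w ∈ filt J wt j →
    curvatureForm θ x v w ∈ filt J wt (i + j + 1)

/-- Normality at the point `(x, 1)` of the bundle. -/
def NormalAt (J : Matrix n n ℝ) (wt : n → ℤ) (e Z : ι → Matrix n n ℝ)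
    (θ : E → E →ₗ[ℝ] Matrix n n ℝ) (x : E) : Prop :=
  codiff e Z (kappa J wt θ x 1) = 0

theorem IsCartanGauge.isRegular (hθ : IsCartanGauge J wt U θ) (hJ : IsGradedForm J wt c)
    (h : ∀ x ∈ U, RegularAt J wt θ x) : IsRegular J wt U θ := by
  intro x hx p hp i j A hA B hB
  replace hp := parabolic_subset_parab hp
  have hk : ∀ {i : ℤ} {A : Matrix n n ℝ}, A ∈ filt J wt i →
      A - p⁻¹ * θ x (omegaInv J wt θ x p A) * p ∈ filt J wt 0 := fun hA =>
    hθ.omegaInv_spec hx hJ hp hA.1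
  have hk' : ∀ {i : ℤ} {A : Matrix n n ℝ}, A ∈ filt J wt i → i ≤ 0 →
      θ x (omegaInv J wt θ x p A) ∈ filt J wt i := by
    intro i A hA hi
    have h1 := hJ.conj_inv_mem_filt hp (sub_mem hA (filt_mono hi (hk hA)))
    rwa [sub_sub_cancel, hJ.conj_inv_conj hp] at h1
  have hz : ∀ {i : ℤ} {A : Matrix n n ℝ}, A ∈ filt J wt i → ¬ i ≤ 0 →
      omegaInv J wt θ x p A = 0 := by
    intro i A hA hi
    exact hθ.omegaInv_eq hx hJ hp (by simpa using filt_mono (by omega) hA)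
  rw [hθ.kappa_eq hx hJ hp (hk hA) (hk hB)]
  refine hJ.conj_mem_filt hp ?_
  by_cases hi : i ≤ 0
  · by_cases hj : j ≤ 0
    · exact h x hx i j hi hj _ _ (hk' hA hi) (hk' hB hj)
    · rw [hz hB hj, ← hθ.curvatureLin_apply hx, map_zero]
      exact zero_mem _
  · rw [hz hA hi, ← hθ.curvatureLin_apply hx, map_zero, LinearMap.zero_apply]
    exact zero_mem _

theorem IsCartanGauge.regularAt (hθ : IsCartanGauge J wt U θ) (hJ : IsGradedForm J wt c)
    (h : IsRegular J wt U θ) (hx : x ∈ U) : RegularAt J wt θ x := by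
  intro i j _ _ v w hv hw
  have h1 := h x hx 1 one_mem_parabolic i j _ hv _ hw
  rwa [hθ.kappa_one hx hJ (v := v) (w := w) (by simp) (by simp)] at h1

theorem IsCartanGauge.isNormal (hθ : IsCartanGauge J wt U θ) (hJ : IsGradedForm J wt c)
    (he : IsDualFrame J wt e Z) (h : ∀ x ∈ U, NormalAt J wt e Z θ x) : IsNormal J wt e Z U θ :=
  fun x hx _ hp => hθ.codiff_kappa_eq_zero hx hJ he (parabolic_subset_parab hp) (h x hx)

/-- Regularity does not depend on the section. -/
theorem GaugeRel.regularAt (h : GaugeRel J wt θ₁ θ₂ x) (hJ : IsGradedForm J wt c)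
    (h₁ : RegularAt J wt θ₁ x) : RegularAt J wt θ₂ x := by
  obtain ⟨g, hg, h1, h2⟩ := h
  intro i j hi hj v w hv hw
  rw [h2]
  have key : ∀ i ≤ 0, ∀ v, θ₂ x v ∈ filt J wt i → θ₁ x v ∈ filt J wt i := by
    intro i hi v hv
    have h3 := hJ.conj_inv_mem_filt hg (sub_mem hv (filt_mono hi (h1 v)))
    rwa [sub_sub_cancel, hJ.conj_inv_conj hg] at h3
  exact hJ.conj_mem_filt hg (h₁ i j hi hj v w (key i hi v hv) (key j hj w hw))

/-- Normality does not depend on the section. -/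
theorem GaugeRel.normalAt (h : GaugeRel J wt θ₁ θ₂ x) (hθ : IsCartanGauge J wt U θ₁) (hx : x ∈ U)
    (hJ : IsGradedForm J wt c) (he : IsDualFrame J wt e Z) (h₁ : NormalAt J wt e Z θ₁ x) :
    NormalAt J wt e Z θ₂ x := by
  obtain ⟨g, hg, hk⟩ := exists_kappa_eq_of_gaugeRel hJ h
  have h2 : kappa J wt θ₂ x 1 = kappa J wt θ₁ x g := by
    funext A B
    rw [hk 1 one_mem_parab, Matrix.mul_one]
  rw [NormalAt, h2]
  exact hθ.codiff_kappa_eq_zero hx hJ he hg h₁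

end Pointwise

/-! ### The two graded forms and their dual frames -/

section Involution

variable {n : Type} [Fintype n] [DecidableEq n]
variable {J : Matrix n n ℝ} {wt : n → ℤ} {c : ℤ} {σ : n → n}

theorem isGradedForm_of_involution (hσ : ∀ i, σ (σ i) = i)
    (hJ : ∀ i j, J i j = if σ i = j then 1 else 0) (hw : ∀ i, wt i + wt (σ i) = c) :
    IsGradedForm J wt c := by
  refine ⟨?_, ?_, ?_⟩
  · ext i j
    rw [Matrix.transpose_apply, hJ, hJ]
    refine if_congr ⟨?_, ?_⟩ rfl rfl <;> rintro rfl <;> exact hσ _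
  · ext i j
    have h : ∀ r, σ r = j ↔ r = σ j := fun r =>
      ⟨fun h => by rw [← h, hσ], fun h => by rw [h, hσ]⟩
    have h' : σ i = σ j ↔ i = j := ⟨fun h => by rw [← hσ i, h, hσ], congrArg σ⟩
    simp [Matrix.mul_apply, hJ, h, h', Matrix.one_apply]
  · intro i j h
    rw [hJ] at h
    obtain rfl : σ i = j := by
      by_contra h'
      simp [h'] at h
    exact hw i

theorem mem_so_of_involution (hσ : ∀ i, σ (σ i) = i)
    (hJ : ∀ i j, J i j = if σ i = j then 1 else 0) {A : Matrix n n ℝ} :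
    A ∈ skewAdjointMatricesSubmodule J ↔ ∀ i j, A (σ i) j = -A (σ j) i := by
  have h : ∀ r j, σ r = j ↔ r = σ j := fun r j =>
    ⟨fun h => by rw [← h, hσ], fun h => by rw [h, hσ]⟩
  rw [mem_so, ← Matrix.ext_iff]
  refine forall_congr' fun i => forall_congr' fun j => ?_
  have h1 : (Aᵀ * J) i j = A (σ j) i := by simp [Matrix.mul_apply, hJ, h]
  have h2 : (J * A) i j = A (σ i) j := by simp [Matrix.mul_apply, hJ]
  rw [Matrix.neg_apply, h1, h2, eq_comm, neg_eq_iff_eq_neg]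

end Involution

theorem skewUnit_transpose {m : ℕ} (q : Pair m) : (skewUnit q)ᵀ = -skewUnit q := by
  simp [skewUnit]

theorem skewUnit_apply_swap {m : ℕ} (q : Pair m) (i j : Fin m) :
    skewUnit q i j = -skewUnit q j i := by
  have h := congrFun (congrFun (skewUnit_transpose q) j) i
  simpa using h

/-- The matrices `skewUnit q` span the skew-symmetric ones. -/
theorem sum_smul_skewUnit {m : ℕ} (S : Matrix (Fin m) (Fin m) ℝ) (hS : ∀ i j, S i j = -S j i) :
    ∑ q : Pair m, S q.1.1 q.1.2 • skewUnit q = S := by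
  have key : ∀ i j, i < j → (∑ q : Pair m, S q.1.1 q.1.2 • skewUnit q) i j = S i j := by
    intro i j hij
    rw [Matrix.sum_apply, Finset.sum_eq_single (⟨(i, j), hij⟩ : Pair m)]
    · simp [skewUnit, hij.ne]
    · rintro ⟨⟨a, b⟩, hab⟩ - hne
      have h1 : ¬ (a = i ∧ b = j) := by
        rintro ⟨rfl, rfl⟩
        exact hne rfl
      have h2 : ¬ (b = i ∧ a = j) := by
        rintro ⟨rfl, rfl⟩
        exact absurd hij (not_lt.2 (le_of_lt hab))
      simp [skewUnit, h1, h2]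
    · simp
  ext i j
  rcases lt_trichotomy i j with h | rfl | h
  · exact key i j h
  · have h1 : S i i = 0 := by linarith [hS i i]
    rw [h1, Matrix.sum_apply]
    refine Finset.sum_eq_zero fun q _ => ?_
    have h2 := skewUnit_apply_swap q i i
    rw [Matrix.smul_apply, show skewUnit q i i = 0 by linarith, smul_zero]
  · rw [hS i j, ← key j i h, Matrix.sum_apply, Matrix.sum_apply, ← Finset.sum_neg_distrib]
    refine Finset.sum_congr rfl fun q _ => ?_
    rw [Matrix.smul_apply, Matrix.smul_apply, skewUnit_apply_swap q i j, smul_neg]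

theorem sum_sum_skewUnit_mul {m : ℕ} (q : Pair m) (S : Matrix (Fin m) (Fin m) ℝ) :
    ∑ i, ∑ j, S i j * skewUnit q j i = S q.1.2 q.1.1 - S q.1.1 q.1.2 := by
  have h : ∀ a b : Fin m, ∑ i, ∑ j, S i j * Matrix.single a b (1 : ℝ) j i = S b a := by
    intro a b
    rw [Finset.sum_eq_single b]
    · rw [Finset.sum_eq_single a]
      · simp
      · intro j _ hj
        simp [hj.symm]
      · simp
    · intro i _ hi
      simp [hi.symm]
    · simp
  simp only [skewUnit, Matrix.sub_apply, mul_sub, Finset.sum_sub_distrib, h]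

section FormB

variable {l : ℕ}

/-- The involution of the basis of `ℝ^{l,l+1}` given by the form `JB`. -/
def flipB : BIdx l → BIdx l
  | .inl i => .inr (.inr i)
  | .inr (.inl u) => .inr (.inl u)
  | .inr (.inr i) => .inl i

theorem flipB_flipB (i : BIdx l) : flipB (flipB i) = i := by
  rcases i with i | i | i <;> rfl

theorem JB_apply (i j : BIdx l) : JB l i j = if flipB i = j then 1 else 0 := by
  rcases i with i | i | i <;> rcases j with j | j | j <;> simp [JB, flipB]

theorem isGradedForm_JB : IsGradedForm (JB l) (wtB l) 0 :=
  isGradedForm_of_involution flipB_flipB JB_apply fun i => by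
    rcases i with i | i | i <;> simp [flipB, wtB]

theorem mem_so_JB {A : Matrix (BIdx l) (BIdx l) ℝ} :
    A ∈ skewAdjointMatricesSubmodule (JB l) ↔ ∀ i j, A (flipB i) j = -A (flipB j) i :=
  mem_so_of_involution flipB_flipB JB_apply

theorem negB_mem_so (X : Fin l → ℝ) {Y : Matrix (Fin l) (Fin l) ℝ} (hY : ∀ i j, Y i j = -Y j i) :
    negB X Y ∈ skewAdjointMatricesSubmodule (JB l) := by
  rw [mem_so_JB]
  rintro (i | i | i) (j | j | j) <;> simp [flipB, negB]
  exact hY i j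

theorem posB_mem_filt (X : Fin l → ℝ) {Y : Matrix (Fin l) (Fin l) ℝ} (hY : ∀ i j, Y i j = -Y j i) :
    posB X Y ∈ filt (JB l) (wtB l) 1 := by
  refine ⟨?_, ?_⟩
  · rw [mem_so_JB]
    rintro (i | i | i) (j | j | j) <;> simp [flipB, posB]
    exact hY i j
  · rintro (i | i | i) (j | j | j) <;> simp [wtB, posB]

theorem sum_smul_eB (r : Fin l ⊕ Pair l → ℝ) :
    ∑ a, r a • eB l a = negB (fun i => r (.inl i)) (∑ q, r (.inr q) • skewUnit q) := by
  ext (i | i | i) (j | j | j) <;>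
    simp [Matrix.sum_apply, eB, negB, Pi.single_apply]

theorem eB_mem_so (a : Fin l ⊕ Pair l) : eB l a ∈ skewAdjointMatricesSubmodule (JB l) := by
  rcases a with i | q
  · exact negB_mem_so _ (by simp)
  · exact negB_mem_so _ (skewUnit_apply_swap q)

theorem zB_mem_filt (a : Fin l ⊕ Pair l) : zB l a ∈ filt (JB l) (wtB l) 1 := by
  rcases a with i | q
  · exact posB_mem_filt _ (by simp)
  · exact posB_mem_filt _ (skewUnit_apply_swap q)

theorem zB_eq (a : Fin l ⊕ Pair l) : zB l a = -(eB l a)ᵀ := by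
  rcases a with a | q
  · ext (i | i | i) (j | j | j) <;> simp [zB, eB, posB, negB]
  · ext (i | i | i) (j | j | j) <;> simp [zB, eB, posB, negB]
    exact skewUnit_apply_swap q _ _

theorem trace_mul_zB_inl {A : Matrix (BIdx l) (BIdx l) ℝ}
    (hA : A ∈ skewAdjointMatricesSubmodule (JB l)) (i : Fin l) :
    -2⁻¹ * (A * zB l (.inl i)).trace = A (.inl i) (.inr (.inl ())) := by
  have h1 := mem_so_JB.1 hA (.inr (.inl ())) (.inr (.inr i))
  simp only [flipB] at h1
  simp [Matrix.trace, Matrix.mul_apply, zB, posB, Pi.single_apply, h1]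
  ring

theorem trace_mul_zB_inr {A : Matrix (BIdx l) (BIdx l) ℝ}
    (hA : A ∈ skewAdjointMatricesSubmodule (JB l)) (q : Pair l) :
    -2⁻¹ * (A * zB l (.inr q)).trace = A (.inl q.1.1) (.inr (.inr q.1.2)) := by
  have h1 := mem_so_JB.1 hA (.inr (.inr q.1.2)) (.inr (.inr q.1.1))
  simp only [flipB] at h1
  have h2 := sum_sum_skewUnit_mul q (Matrix.of fun i j => A (.inl i) (.inr (.inr j)))
  simp only [Matrix.of_apply] at h2
  simp [Matrix.trace, Matrix.mul_apply, zB, posB, h2, h1]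
  ring

/-- The coordinates of `A` modulo `𝔭`. -/
theorem sum_trace_smul_eB {A : Matrix (BIdx l) (BIdx l) ℝ}
    (hA : A ∈ skewAdjointMatricesSubmodule (JB l)) :
    ∑ a, (-2⁻¹ * (A * zB l a).trace) • eB l a = negB (fun i => A (.inl i) (.inr (.inl ())))
      (Matrix.of fun i j => A (.inl i) (.inr (.inr j))) := by
  rw [sum_smul_eB]
  congr 1
  · funext i
    exact trace_mul_zB_inl hA i
  · simp only [trace_mul_zB_inr hA]
    exact sum_smul_skewUnit (Matrix.of fun i j => A (.inl i) (.inr (.inr j)))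
      fun i j => mem_so_JB.1 hA (.inr (.inr i)) (.inr (.inr j))

theorem isDualFrame_eB : IsDualFrame (JB l) (wtB l) (eB l) (zB l) := by
  refine ⟨eB_mem_so, zB_mem_filt, ?_, ?_⟩
  · intro A hA
    refine ⟨sub_mem hA (sum_mem fun a _ => Submodule.smul_mem _ _ (eB_mem_so a)), ?_⟩
    rw [sum_trace_smul_eB hA]
    rintro (i | i | i) (j | j | j) <;> simp [wtB, negB]
    rw [← sub_eq_zero.2 (mem_so_JB.1 hA (.inr (.inl i)) (.inr (.inr j)))]
    simp [flipB]
  · intro W hW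
    have hso := mem_so_JB.1 hW.1
    have hT : Wᵀ ∈ skewAdjointMatricesSubmodule (JB l) := by
      rw [mem_so_JB]
      intro i j
      have h := hso (flipB j) (flipB i)
      rw [flipB_flipB, flipB_flipB] at h
      simpa using h
    have h1 := congrArg Matrix.transpose (sum_trace_smul_eB hT)
    have h2 : ∑ a, (-2⁻¹ * (eB l a * W).trace) • zB l a =
        (∑ a, (-2⁻¹ * (Wᵀ * zB l a).trace) • eB l a)ᵀ := by
      rw [Matrix.transpose_sum]
      refine Finset.sum_congr rfl fun a _ => ?_
      rw [zB_eq, Matrix.transpose_smul, Matrix.mul_neg, Matrix.trace_neg, ← Matrix.transpose_mul,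
        Matrix.trace_transpose]
      simp
    rw [h2, h1]
    have hlow := hW.2
    ext (i | i | i) (j | j | j) <;> simp only [Matrix.transpose_apply, negB, Matrix.of_apply]
    any_goals first | rfl | exact hlow _ _ (by simp [wtB])
    exact hso (.inl i) (.inr (.inl j))

end FormB

section FormD

variable {l : ℕ}

theorem swap_swap_D (i : DIdx l) : Sum.swap (Sum.swap i) = i := Sum.swap_swap i

theorem JD_apply (i j : DIdx l) : JD l i j = if Sum.swap i = j then 1 else 0 := by
  rcases i with i | i <;> rcases j with j | j <;> simp [JD, Matrix.one_apply]

theorem isGradedForm_JD : IsGradedForm (JD l) (wtD l) 1 :=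
  isGradedForm_of_involution swap_swap_D JD_apply fun i => by
    rcases i with i | i <;> simp [wtD]

theorem mem_so_JD {A : Matrix (DIdx l) (DIdx l) ℝ} :
    A ∈ skewAdjointMatricesSubmodule (JD l) ↔ ∀ i j, A (Sum.swap i) j = -A (Sum.swap j) i :=
  mem_so_of_involution swap_swap_D JD_apply

theorem fromBlocks_mem_so {Y : Matrix (Fin (l + 1)) (Fin (l + 1)) ℝ} (hY : ∀ i j, Y i j = -Y j i) :
    Matrix.fromBlocks 0 Y 0 0 ∈ skewAdjointMatricesSubmodule (JD l) := by
  rw [mem_so_JD]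
  rintro (i | i) (j | j) <;> simp
  exact hY i j

theorem zD_mem_filt (q : Pair (l + 1)) : zD l q ∈ filt (JD l) (wtD l) 1 := by
  refine ⟨?_, ?_⟩
  · rw [mem_so_JD]
    rintro (i | i) (j | j) <;> simp [zD]
    exact skewUnit_apply_swap q i j
  · rintro (i | i) (j | j) <;> simp [zD, wtD]

theorem trace_mul_zD {A : Matrix (DIdx l) (DIdx l) ℝ}
    (hA : A ∈ skewAdjointMatricesSubmodule (JD l)) (q : Pair (l + 1)) :
    -2⁻¹ * (A * zD l q).trace = A (.inl q.1.1) (.inr q.1.2) := by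
  have h1 := mem_so_JD.1 hA (.inr q.1.2) (.inr q.1.1)
  simp only [Sum.swap_inr] at h1
  have h2 := sum_sum_skewUnit_mul q (Matrix.of fun i j => A (.inl i) (.inr j))
  simp only [Matrix.of_apply] at h2
  simp [Matrix.trace, Matrix.mul_apply, zD, h2, h1]
  ring

theorem sum_trace_smul_eD {A : Matrix (DIdx l) (DIdx l) ℝ}
    (hA : A ∈ skewAdjointMatricesSubmodule (JD l)) :
    ∑ q, (-2⁻¹ * (A * zD l q).trace) • eD l q =
      Matrix.fromBlocks 0 (Matrix.of fun i j => A (.inl i) (.inr j)) 0 0 := by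
  have h := sum_smul_skewUnit (Matrix.of fun i j => A (.inl i) (.inr j))
      fun i j => mem_so_JD.1 hA (.inr i) (.inr j)
  simp only [trace_mul_zD hA]
  conv_rhs => rw [← h]
  ext (i | i) (j | j) <;> simp [Matrix.sum_apply, eD]

theorem zD_eq (q : Pair (l + 1)) : zD l q = -(eD l q)ᵀ := by
  simp [zD, eD, Matrix.fromBlocks_transpose, skewUnit_transpose, Matrix.fromBlocks_neg]

theorem isDualFrame_eD : IsDualFrame (JD l) (wtD l) (eD l) (zD l) := by
  have he : ∀ q, eD l q ∈ skewAdjointMatricesSubmodule (JD l) := fun q =>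
    fromBlocks_mem_so (skewUnit_apply_swap q)
  refine ⟨he, zD_mem_filt, ?_, ?_⟩
  · intro A hA
    refine ⟨sub_mem hA (sum_mem fun a _ => Submodule.smul_mem _ _ (he a)), ?_⟩
    rw [sum_trace_smul_eD hA]
    rintro (i | i) (j | j) <;> simp [wtD]
  · intro W hW
    have hso := mem_so_JD.1 hW.1
    have hT : Wᵀ ∈ skewAdjointMatricesSubmodule (JD l) := by
      rw [mem_so_JD]
      intro i j
      have h := hso (Sum.swap j) (Sum.swap i)
      rw [swap_swap_D, swap_swap_D] at h
      simpa using h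
    have h1 := congrArg Matrix.transpose (sum_trace_smul_eD hT)
    have h2 : ∑ a, (-2⁻¹ * (eD l a * W).trace) • zD l a =
        (∑ a, (-2⁻¹ * (Wᵀ * zD l a).trace) • eD l a)ᵀ := by
      rw [Matrix.transpose_sum]
      refine Finset.sum_congr rfl fun a _ => ?_
      rw [zD_eq, Matrix.transpose_smul, Matrix.mul_neg, Matrix.trace_neg, ← Matrix.transpose_mul,
        Matrix.trace_transpose]
      simp
    rw [h2, h1]
    have hlow := hW.2
    ext (i | i) (j | j) <;> simp only [Matrix.transpose_apply, Matrix.fromBlocks_apply₁₁,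
      Matrix.fromBlocks_apply₁₂, Matrix.fromBlocks_apply₂₁, Matrix.fromBlocks_apply₂₂,
      Matrix.of_apply]
    any_goals first | rfl | exact hlow _ _ (by simp [wtD])

end FormD

/-! ### Cohomology of `𝔤₋` with values in `𝔤` in positive homogeneity -/

section Cohomology

/-- The Lie algebra differential `∂F(e_a, e_b) = [e_a, F_b] - [e_b, F_a] - F([e_a, e_b])` of the
linear map `F : 𝔤₋ → 𝔤` with `F(e_a) = F_a`. -/
def lieDiff {ι n : Type} [Fintype ι] [Fintype n] (e Z F : ι → Matrix n n ℝ)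
    (a b : ι) : Matrix n n ℝ :=
  ⁅e a, F b⁆ - ⁅e b, F a⁆ - ∑ c, (-2⁻¹ * (⁅e a, e b⁆ * Z c).trace) • F c

variable {l : ℕ} {M : Matrix (BIdx l) (BIdx l) ℝ}

/-- The degrees of the basis elements of `𝔤₋`. -/
def degB : Fin l ⊕ Pair l → ℤ
  | .inl _ => -1
  | .inr _ => -2

theorem eB_mul_inl (i p : Fin l) (s : BIdx l) :
    (eB l (.inl i) * M) (.inl p) s = if p = i then M (.inr (.inl ())) s else 0 := by
  simp [Matrix.mul_apply, eB, negB, Pi.single_apply]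

theorem eB_mul_mid (i : Fin l) (u : Unit) (s : BIdx l) :
    (eB l (.inl i) * M) (.inr (.inl u)) s = -M (.inr (.inr i)) s := by
  simp [Matrix.mul_apply, eB, negB, Pi.single_apply]

theorem eB_mul_inr (i p : Fin l) (s : BIdx l) :
    (eB l (.inl i) * M) (.inr (.inr p)) s = 0 := by
  simp [Matrix.mul_apply, eB, negB]

theorem mul_eB_inl (i p : Fin l) (r : BIdx l) :
    (M * eB l (.inl i)) r (.inl p) = 0 := by
  simp [Matrix.mul_apply, eB, negB]

theorem mul_eB_mid (i : Fin l) (u : Unit) (r : BIdx l) :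
    (M * eB l (.inl i)) r (.inr (.inl u)) = M r (.inl i) := by
  simp [Matrix.mul_apply, eB, negB, Pi.single_apply]

theorem mul_eB_inr (i p : Fin l) (r : BIdx l) :
    (M * eB l (.inl i)) r (.inr (.inr p)) = if p = i then -M r (.inr (.inl ())) else 0 := by
  simp [Matrix.mul_apply, eB, negB, Pi.single_apply]
  split_ifs <;> simp

theorem trace_eB_mul_zB (a b : Fin l ⊕ Pair l) :
    -2⁻¹ * (eB l a * zB l b).trace = if a = b then 1 else 0 := by
  rcases b with i | q
  · rw [trace_mul_zB_inl (eB_mem_so a)]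
    rcases a with j | r
    · simp [eB, negB, Pi.single_apply, eq_comm]
    · simp [eB, negB]
  · rw [trace_mul_zB_inr (eB_mem_so a)]
    rcases a with j | r
    · simp [eB, negB]
    · obtain ⟨⟨a, b⟩, hab⟩ := q
      obtain ⟨⟨a', b'⟩, hab'⟩ := r
      have h : ¬ (b' = a ∧ a' = b) := by
        rintro ⟨rfl, rfl⟩
        exact absurd hab (not_lt.2 (le_of_lt hab'))
      simp [eB, negB, skewUnit, Matrix.single_apply, h]

theorem lie_eB_inl_inl {i j : Fin l} (h : i < j) :
    ⁅eB l (.inl i), eB l (.inl j)⁆ = -eB l (.inr ⟨(i, j), h⟩) := by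
  rw [Ring.lie_def]
  ext (p | p | p) (q | q | q) <;>
    simp only [Matrix.sub_apply, eB_mul_inl, eB_mul_mid, eB_mul_inr, Matrix.neg_apply] <;>
    simp [eB, negB, skewUnit, Matrix.single_apply, Pi.single_apply]
  grind

theorem eB_inr_mul_eB (q : Pair l) (a : Fin l ⊕ Pair l) (i j : BIdx l)
    (h : ∀ p, eB l a (.inr (.inr p)) j = 0) : (eB l (.inr q) * eB l a) i j = 0 := by
  rw [Matrix.mul_apply]
  refine Finset.sum_eq_zero fun r _ => ?_
  rcases r with r | r | r
  · rcases i with i | i | i <;> simp [eB, negB]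
  · rcases i with i | i | i <;> simp [eB, negB]
  · rw [h, mul_zero]

theorem lie_eB_inr (q : Pair l) (a : Fin l ⊕ Pair l) : ⁅eB l a, eB l (.inr q)⁆ = 0 := by
  have h1 : eB l (.inr q) * eB l a = 0 := by
    ext i j
    rcases a with a | a <;>
      exact eB_inr_mul_eB q _ i j fun p => by rcases j with j | j | j <;> simp [eB, negB]
  have h2 : eB l a * eB l (.inr q) = 0 := by
    ext i j
    rw [Matrix.mul_apply, Matrix.zero_apply]
    refine Finset.sum_eq_zero fun r _ => ?_
    rcases a with a | a <;> rcases r with r | r | r <;> rcases i with i | i | i <;>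
      rcases j with j | j | j <;> simp [eB, negB]
  rw [Ring.lie_def, h1, h2, sub_zero]

theorem lie_jacobi (A B C : Matrix (BIdx l) (BIdx l) ℝ) :
    ⁅⁅A, B⁆, C⁆ = ⁅A, ⁅B, C⁆⁆ - ⁅B, ⁅A, C⁆⁆ := by
  simp only [Ring.lie_def]
  noncomm_ring

variable {F : Fin l ⊕ Pair l → Matrix (BIdx l) (BIdx l) ℝ}

theorem lieDiff_inl_inl {i j : Fin l} (h : i < j) :
    lieDiff (eB l) (zB l) F (.inl i) (.inl j) =
      ⁅eB l (.inl i), F (.inl j)⁆ - ⁅eB l (.inl j), F (.inl i)⁆ + F (.inr ⟨(i, j), h⟩) := by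
  rw [lieDiff, lie_eB_inl_inl h]
  simp only [Matrix.neg_mul, Matrix.trace_neg, mul_neg, trace_eB_mul_zB]
  simp

theorem lieDiff_inr (a : Fin l ⊕ Pair l) (q : Pair l) :
    lieDiff (eB l) (zB l) F a (.inr q) =
      ⁅eB l a, F (.inr q)⁆ - ⁅eB l (.inr q), F a⁆ := by
  rw [lieDiff, lie_eB_inr]
  simp

variable (hd : ∀ a b, lieDiff (eB l) (zB l) F a b = 0)
include hd

theorem cocycle_inr {i j : Fin l} (h : i < j) :
    F (.inr ⟨(i, j), h⟩) = ⁅eB l (.inl j), F (.inl i)⁆ - ⁅eB l (.inl i), F (.inl j)⁆ := by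
  have h1 := hd (.inl i) (.inl j)
  rw [lieDiff_inl_inl h] at h1
  rw [← sub_eq_zero, ← h1]
  abel

/-- The cocycle condition in terms of the restriction to `𝔤₋₁`, which generates `𝔤₋`. -/
theorem cocycle_identity (i j k : Fin l) :
    ⁅eB l (.inl k), ⁅eB l (.inl i), F (.inl j)⁆⁆ - ⁅eB l (.inl k), ⁅eB l (.inl j), F (.inl i)⁆⁆ =
      ⁅eB l (.inl i), ⁅eB l (.inl j), F (.inl k)⁆⁆ -
        ⁅eB l (.inl j), ⁅eB l (.inl i), F (.inl k)⁆⁆ := by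
  have key : ∀ i j, i < j →
      ⁅eB l (.inl k), ⁅eB l (.inl i), F (.inl j)⁆⁆ - ⁅eB l (.inl k), ⁅eB l (.inl j), F (.inl i)⁆⁆ =
      ⁅eB l (.inl i), ⁅eB l (.inl j), F (.inl k)⁆⁆ -
        ⁅eB l (.inl j), ⁅eB l (.inl i), F (.inl k)⁆⁆ := by
    intro i j h
    have h1 := hd (.inl k) (.inr ⟨(i, j), h⟩)
    rw [lieDiff_inr, cocycle_inr hd h, ← neg_neg (eB l (.inr ⟨(i, j), h⟩)),
      ← lie_eB_inl_inl h] at h1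
    rw [← lie_jacobi]
    simp only [Ring.lie_def] at h1 ⊢
    rw [← sub_eq_zero, ← neg_eq_zero, ← h1]
    noncomm_ring
  rcases lt_trichotomy i j with h | rfl | h
  · exact key i j h
  · simp
  · rw [← neg_inj, neg_sub, neg_sub, key j i h]

/-- A cocycle which is a coboundary on `𝔤₋₁` is a coboundary. -/
theorem eq_lie_of_cocycle {Z : Matrix (BIdx l) (BIdx l) ℝ}
    (hZ : ∀ i, F (.inl i) = ⁅eB l (.inl i), Z⁆) (a : Fin l ⊕ Pair l) : F a = ⁅eB l a, Z⁆ := by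
  rcases a with i | ⟨⟨i, j⟩, h⟩
  · exact hZ i
  · rw [cocycle_inr hd h, hZ, hZ, ← neg_neg (eB l (.inr ⟨(i, j), h⟩)), ← lie_eB_inl_inl h]
    simp only [Ring.lie_def]
    noncomm_ring

omit hd

/-- The element `Z` of `𝔤_k` with `F = [·, Z]`, for a cocycle `F` of homogeneity `k`. Its entries
are read off from those of `F` on `𝔤₋₁`; it is zero for `k ≥ 3`, as then `𝔤_k = 0`. -/
def primitive (k : ℤ) (F : Fin l ⊕ Pair l → Matrix (BIdx l) (BIdx l) ℝ) :
    Matrix (BIdx l) (BIdx l) ℝ :=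
  if k = 1 then posB (fun j => -F (.inl j) (.inl j) (.inl j)) 0
  else if k = 2 then posB 0 (Matrix.of fun i j => F (.inl i) (.inr (.inr j)) (.inr (.inl ())))
  else 0

/-- In a set of at least four elements there is one different from three given ones. -/
theorem exists_ne_three (hl : 4 ≤ l) (i j k : Fin l) : ∃ m, m ≠ i ∧ m ≠ j ∧ m ≠ k := by
  by_contra! h
  have h1 : (Finset.univ : Finset (Fin l)) ⊆ {i, j, k} := by
    intro m _
    simp only [Finset.mem_insert, Finset.mem_singleton]
    by_contra! h2
    exact h2.2.2 (h m h2.1 h2.2.1)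
  have h2 := Finset.card_le_card h1
  rw [Finset.card_univ, Fintype.card_fin] at h2
  exact absurd (h2.trans Finset.card_le_three) (by omega)

variable (hl : 4 ≤ l) (hso : ∀ a, F a ∈ skewAdjointMatricesSubmodule (JB l))
include hd hl hso

/-- On `𝔤₋₁`, a cocycle of homogeneity one has values in `𝔤₀ = 𝔤𝔩(l)`. The cocycle condition for
`E_k` and `E_{[ij]}` gives linear relations between the entries of these values, which leave only
those of coboundaries if there are at least four indices. -/
theorem cocycle_degree_one
    (hdeg : ∀ a i j, wtB l i - wtB l j ≠ degB a + 1 → F a i j = 0) :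
    primitive 1 F ∈ filt (JB l) (wtB l) 1 ∧ ∀ i, F (.inl i) = ⁅eB l (.inl i), primitive 1 F⁆ := by
  have hso' := fun a => mem_so_JB.1 (hso a)
  have hmid : ∀ i u v, F (.inl i) (.inr (.inl u)) (.inr (.inl v)) = 0 := by
    intro i u v
    have h := hso' (.inl i) (.inr (.inl u)) (.inr (.inl v))
    simp only [flipB] at h
    linarith
  have hinr : ∀ i p q, F (.inl i) (.inr (.inr p)) (.inr (.inr q)) =
      -F (.inl i) (.inl q) (.inl p) := fun i p q => hso' (.inl i) (.inl p) (.inr (.inr q))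
  have hI : ∀ i j k p q : Fin l,
      ((if p = k then F (.inl j) (.inl q) (.inl i) else 0) -
        (if q = k then F (.inl j) (.inl p) (.inl i) else 0)) -
      ((if p = k then F (.inl i) (.inl q) (.inl j) else 0) -
        (if q = k then F (.inl i) (.inl p) (.inl j) else 0)) =
      ((if p = i then F (.inl k) (.inl q) (.inl j) else 0) -
        (if q = i then F (.inl k) (.inl p) (.inl j) else 0)) -
      ((if p = j then F (.inl k) (.inl q) (.inl i) else 0) -
        (if q = j then F (.inl k) (.inl p) (.inl i) else 0)) := by
    intro i j k p q
    have h := congrFun (congrFun (cocycle_identity hd i j k) (.inl p)) (.inr (.inr q))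
    simp only [Ring.lie_def, Matrix.sub_apply, eB_mul_inl, eB_mul_mid, mul_eB_mid,
      mul_eB_inr, hmid, hinr, ite_self, neg_neg, sub_zero, neg_zero, zero_sub] at h
    convert h using 2
  -- The four relations are the identity for special positions of the indices.
  have h1 : ∀ j p, p ≠ j → F (.inl j) (.inl p) (.inl j) = 0 := by
    intro j p hp
    obtain ⟨i, hi, hi', -⟩ := exists_ne_three hl p j j
    have h := hI i j j p i
    simp [hp, hi', hi.symm] at h
    exact h
  have h2' : ∀ i j p, p ≠ i → p ≠ j → i ≠ j →
      F (.inl i) (.inl p) (.inl j) = 2 * F (.inl j) (.inl p) (.inl i) := by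
    intro i j p hi hj hij
    have h := hI i j j p j
    simp [hi, hj, hij.symm] at h
    linarith
  have h2 : ∀ i j p, p ≠ i → p ≠ j → i ≠ j → F (.inl i) (.inl p) (.inl j) = 0 := by
    intro i j p hi hj hij
    linarith [h2' i j p hi hj hij, h2' j i p hj hi hij.symm]
  have h3' : ∀ i j k, i ≠ j → i ≠ k → j ≠ k →
      F (.inl k) (.inl i) (.inl i) = -F (.inl k) (.inl j) (.inl j) := by
    intro i j k hij hik hjk
    have h := hI i j k j i
    simp [hij, hik, hjk, hij.symm] at h
    linarith
  have h3 : ∀ i k, i ≠ k → F (.inl k) (.inl i) (.inl i) = 0 := by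
    intro i k hik
    obtain ⟨j, hji, hjk, -⟩ := exists_ne_three hl i k k
    obtain ⟨m, hmi, hmk, hmj⟩ := exists_ne_three hl i k j
    linarith [h3' i j k hji.symm hik hjk, h3' i m k hmi.symm hik hmk, h3' j m k hmj.symm hjk hmk]
  have h4 : ∀ i j, i ≠ j → F (.inl i) (.inl i) (.inl j) = F (.inl j) (.inl j) (.inl j) := by
    intro i j hij
    have h := hI i j j i j
    simp [hij, hij.symm] at h
    linarith [h3 i j hij]
  have hA : ∀ k p q, F (.inl k) (.inl p) (.inl q) =
      if p = k then F (.inl q) (.inl q) (.inl q) else 0 := by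
    intro k p q
    split_ifs with hp
    · subst hp
      by_cases hq : p = q
      · rw [hq]
      · exact h4 p q hq
    · by_cases hq : q = k
      · rw [hq]; exact h1 k p hp
      · by_cases hpq : p = q
        · rw [hpq]; exact h3 q k hq
        · exact h2 k q p hp hpq (Ne.symm hq)
  rw [primitive, if_pos rfl]
  refine ⟨posB_mem_filt _ (by simp), fun i => ?_⟩
  ext (p | p | p) (q | q | q) <;>
    simp only [Ring.lie_def, Matrix.sub_apply, eB_mul_inl, eB_mul_mid, mul_eB_mid,
      mul_eB_inr, eB_mul_inr, mul_eB_inl, posB, hmid, hinr] <;>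
    first
    | (simp; done)
    | (rw [hA]; simp)
    | (rw [hdeg _ _ _ (by simp [wtB, degB])]; simp)

theorem cocycle_degree_two
    (hdeg : ∀ a i j, wtB l i - wtB l j ≠ degB a + 2 → F a i j = 0) :
    primitive 2 F ∈ filt (JB l) (wtB l) 2 ∧ ∀ i, F (.inl i) = ⁅eB l (.inl i), primitive 2 F⁆ := by
  have hso' := fun a => mem_so_JB.1 (hso a)
  have hmid : ∀ i u q, F (.inl i) (.inr (.inl u)) (.inl q) =
      -F (.inl i) (.inr (.inr q)) (.inr (.inl ())) :=
    fun i u q => hso' (.inl i) (.inr (.inl ())) (.inl q)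
  have hskew : ∀ j k, F (.inl j) (.inr (.inr k)) (.inr (.inl ())) =
      -F (.inl k) (.inr (.inr j)) (.inr (.inl ())) := by
    intro j k
    obtain ⟨i, hi, hi', -⟩ := exists_ne_three hl j k k
    have h := congrFun (congrFun (cocycle_identity hd i j k) (.inl i)) (.inr (.inl ()))
    simp [Ring.lie_def, eB_mul_inl, eB_mul_mid, mul_eB_mid, mul_eB_inl, hmid, hi, hi'] at h
    exact h
  rw [primitive, if_neg (by norm_num), if_pos rfl]
  refine ⟨⟨(posB_mem_filt 0 hskew).1, ?_⟩, fun i => ?_⟩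
  · rintro (p | p | p) (q | q | q) <;> simp [wtB, posB]
  ext (p | p | p) (q | q | q) <;>
    simp only [Ring.lie_def, Matrix.sub_apply, eB_mul_inl, eB_mul_mid, mul_eB_mid,
      mul_eB_inr, eB_mul_inr, mul_eB_inl, posB, hmid, Matrix.of_apply] <;>
    first
    | (simp; done)
    | (rw [hskew]; simp)
    | (rw [hdeg _ _ _ (by simp [wtB, degB])]; simp)

theorem cocycle_degree_three
    (hdeg : ∀ a i j, wtB l i - wtB l j ≠ degB a + 3 → F a i j = 0) (i : Fin l) :
    F (.inl i) = 0 := by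
  have hT : ∀ j k q, F (.inl k) (.inr (.inr j)) (.inl q) = 0 := by
    intro j k q
    obtain ⟨i, hi, hi', -⟩ := exists_ne_three hl j k k
    have h := congrFun (congrFun (cocycle_identity hd i j k) (.inl i)) (.inl q)
    simp [Ring.lie_def, eB_mul_inl, eB_mul_mid, mul_eB_inl, hi, hi'] at h
    exact h
  ext (p | p | p) (q | q | q) <;>
    first
    | exact hT _ _ _
    | exact hdeg _ _ _ (by simp [wtB, degB])

/-- The vanishing of the first cohomology of `𝔤₋` with values in `𝔤` in positive homogeneity. -/
theorem cocycle_eq_lie {k : ℤ} (hk : 1 ≤ k)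
    (hdeg : ∀ a i j, wtB l i - wtB l j ≠ degB a + k → F a i j = 0) :
    primitive k F ∈ filt (JB l) (wtB l) k ∧ ∀ a, F a = ⁅eB l a, primitive k F⁆ := by
  have key : primitive k F ∈ filt (JB l) (wtB l) k ∧
      ∀ i, F (.inl i) = ⁅eB l (.inl i), primitive k F⁆ := by
    by_cases h1 : k = 1
    · subst h1; exact cocycle_degree_one hd hl hso hdeg
    by_cases h2 : k = 2
    · subst h2; exact cocycle_degree_two hd hl hso hdeg
    rw [primitive, if_neg h1, if_neg h2]
    refine ⟨zero_mem _, fun i => ?_⟩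
    rw [Ring.lie_def, Matrix.mul_zero, Matrix.zero_mul, sub_zero]
    by_cases h3 : k = 3
    · subst h3; exact cocycle_degree_three hd hl hso hdeg i
    · ext (p | p | p) (q | q | q) <;>
        exact hdeg _ _ _ (by simp only [wtB, degB]; omega)
  exact ⟨key.1, eq_lie_of_cocycle hd key.2⟩

end Cohomology

/-! ### The explicit Cartan connections -/

section ModelForm

variable {l : ℕ} (hl : 4 ≤ l) (ε : ℝ)

/-- The vector fields `X_i`, with `ε y_{[12]} ∂/∂y_{[34]}` added to `X_1`; they specialize to the
frames of `D` and `D'` for `ε = 0` and `ε = 1`. -/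
def vecE (i : Fin l) (x : M l) : M l :=
  vecX i x + if i.val = 0 then (ε * x (.inr (q12 hl))) • vecY (q34 hl) else 0

/-- The distribution spanned by the vector fields `vecE`. -/
def distE (x : M l) : Submodule ℝ (M l) := Submodule.span ℝ (Set.range fun i => vecE hl ε i x)

theorem vecE_zero : vecE hl 0 = vecX := by
  funext i x
  simp [vecE]

theorem vecE_one : vecE hl 1 = vecX' hl := by
  funext i x
  simp [vecE, vecX']

theorem distE_zero : distE hl 0 = flatD l := by
  funext x
  simp only [distE, flatD, vecE_zero]

theorem distE_one : distE hl 1 = distD' hl := by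
  funext x
  simp only [distE, distD', vecE_one]

/-- The frame of the tangent bundle given by the vector fields `vecE` and `-∂/∂y_{[jk]}`. -/
def frameE (a : Coord l) (x : M l) : M l :=
  match a with
  | .inl i => vecE hl ε i x
  | .inr q => -vecY q

/-- The index `1`, which is `0` in `Fin l`. -/
def i1 : Fin l := ⟨0, by omega⟩

/-- The part of the coframe that depends linearly on the base point. -/
def coframeLin (q : Pair l) (v : M l) : M l →L[ℝ] ℝ :=
  (-v (.inl q.1.1)) • ContinuousLinearMap.proj (.inl q.1.2) +
    (if q = q34 hl then ε * v (.inl (i1 hl)) else 0) • ContinuousLinearMap.proj (.inr (q12 hl))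

/-- The coframe dual to `frameE`. -/
def coframe (a : Coord l) (x v : M l) : ℝ :=
  match a with
  | .inl i => v (.inl i)
  | .inr q => -v (.inr q) + coframeLin hl ε q v x

theorem coframe_inr (q : Pair l) (x v : M l) : coframe hl ε (.inr q) x v =
    -v (.inr q) - v (.inl q.1.1) * x (.inl q.1.2) +
      if q = q34 hl then ε * v (.inl (i1 hl)) * x (.inr (q12 hl)) else 0 := by
  simp only [coframe, coframeLin, _root_.add_apply, _root_.smul_apply,
    ContinuousLinearMap.proj_apply, smul_eq_mul]
  split_ifs <;> ring

theorem coframe_add (a : Coord l) (x v w : M l) :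
    coframe hl ε a x (v + w) = coframe hl ε a x v + coframe hl ε a x w := by
  rcases a with i | q
  · rfl
  · simp only [coframe_inr, Pi.add_apply]
    split_ifs <;> ring

theorem coframe_smul (a : Coord l) (x : M l) (r : ℝ) (v : M l) :
    coframe hl ε a x (r • v) = r * coframe hl ε a x v := by
  rcases a with i | q
  · rfl
  · simp only [coframe_inr, Pi.smul_apply, smul_eq_mul]
    split_ifs <;> ring

/-- The `𝔤₋`-valued one-form which maps the frame `frameE` to the standard basis of `𝔤₋`. -/
def formE (x : M l) : M l →ₗ[ℝ] Matrix (BIdx l) (BIdx l) ℝ where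
  toFun v := ∑ a, coframe hl ε a x v • eB l a
  map_add' v w := by simp only [coframe_add, add_smul, Finset.sum_add_distrib]
  map_smul' r v := by simp only [coframe_smul, mul_smul, Finset.smul_sum, RingHom.id_apply]

theorem formE_apply (x v : M l) : formE hl ε x v = ∑ a, coframe hl ε a x v • eB l a := rfl

theorem vecE_inl (i p : Fin l) (x : M l) : vecE hl ε i x (.inl p) = if p = i then 1 else 0 := by
  have h : ∀ q : Pair l, (if q.1.1 = i then x (.inl q.1.2) • vecY q else 0) (.inl p) = 0 := by
    intro q
    split_ifs <;> simp [vecY]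
  have h' : (if i.val = 0 then (ε * x (.inr (q12 hl))) • vecY (q34 hl) else 0) (.inl p) = 0 := by
    split_ifs <;> simp [vecY]
  simp only [vecE, vecX, Pi.add_apply, Pi.sub_apply, Finset.sum_apply, h, h']
  simp [Pi.single_apply]

theorem vecE_inr (i : Fin l) (q : Pair l) (x : M l) :
    vecE hl ε i x (.inr q) = -(if q.1.1 = i then x (.inl q.1.2) else 0) +
      if i = i1 hl ∧ q = q34 hl then ε * x (.inr (q12 hl)) else 0 := by
  have h : ∀ r : Pair l, (if r.1.1 = i then x (.inl r.1.2) • vecY r else 0) (.inr q) =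
      if q = r then (if q.1.1 = i then x (.inl q.1.2) else 0) else 0 := by
    intro r
    by_cases h1 : q = r
    · subst h1
      rw [if_pos rfl]
      split_ifs <;> simp [vecY]
    · split_ifs <;> simp [vecY, h1]
  have h' : (if i.val = 0 then (ε * x (.inr (q12 hl))) • vecY (q34 hl) else 0) (.inr q) =
      if i = i1 hl ∧ q = q34 hl then ε * x (.inr (q12 hl)) else 0 := by
    have h2 : i = i1 hl ↔ i.val = 0 := by simp [i1, Fin.ext_iff]
    by_cases h3 : i.val = 0 <;> simp [h2, h3, vecY, Pi.single_apply]
  simp only [vecE, vecX, Pi.add_apply, Pi.sub_apply, Finset.sum_apply, h, h']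
  simp

theorem coframe_frameE (a b : Coord l) (x : M l) :
    coframe hl ε a x (frameE hl ε b x) = if a = b then 1 else 0 := by
  rcases a with i | q
  · rcases b with j | r
    · simp [coframe, frameE, vecE_inl]
    · simp [coframe, frameE, vecY]
  · rcases b with j | r
    · simp only [coframe_inr, frameE, vecE_inl, vecE_inr]
      by_cases h1 : q = q34 hl <;> by_cases h2 : j = i1 hl <;> by_cases h3 : q.1.1 = j <;>
        simp [h1, h2, h3, eq_comm]
    · simp [coframe_inr, frameE, vecY, Pi.single_apply]

theorem formE_frameE (a : Coord l) (x : M l) : formE hl ε x (frameE hl ε a x) = eB l a := by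
  simp [formE_apply, coframe_frameE]

theorem coframe_eq_trace (a : Coord l) (x v : M l) :
    coframe hl ε a x v = -2⁻¹ * (formE hl ε x v * zB l a).trace := by
  simp only [formE_apply, Finset.sum_mul, Matrix.trace_sum, Matrix.smul_mul, Matrix.trace_smul,
    smul_eq_mul, Finset.mul_sum]
  rw [Finset.sum_eq_single a]
  · linear_combination (-coframe hl ε a x v) * (trace_eB_mul_zB a a |>.trans (if_pos rfl))
  · intro b _ hb
    linear_combination coframe hl ε b x v * (trace_eB_mul_zB b a |>.trans (if_neg hb))
  · simp

theorem eq_zero_of_coframe {x v : M l} (h : ∀ a, coframe hl ε a x v = 0) : v = 0 := by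
  have h1 : ∀ i, v (.inl i) = 0 := fun i => h (.inl i)
  funext a
  rcases a with i | q
  · exact h1 i
  · have h2 := h (.inr q)
    simpa [coframe_inr, h1] using h2

/-- The coordinates of a vector in the frame `frameE`. -/
theorem sum_coframe_smul_frameE (x v : M l) :
    ∑ a, coframe hl ε a x v • frameE hl ε a x = v := by
  rw [← sub_eq_zero]
  refine eq_zero_of_coframe hl ε (x := x) fun b => ?_
  rw [coframe_eq_trace, map_sub, map_sum, sub_mul, Matrix.trace_sub, mul_sub, ← coframe_eq_trace]
  simp only [map_smul, formE_frameE, Finset.sum_mul, Matrix.smul_mul, Matrix.trace_sum,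
    Matrix.trace_smul, Finset.mul_sum, smul_eq_mul, mul_left_comm (-2⁻¹ : ℝ), trace_eB_mul_zB]
  simp

theorem formE_mem_so (x v : M l) : formE hl ε x v ∈ skewAdjointMatricesSubmodule (JB l) :=
  sum_mem fun a _ => Submodule.smul_mem _ _ (eB_mem_so a)

theorem formE_eq_negB (x v : M l) : formE hl ε x v =
    negB (fun i => v (.inl i)) (∑ q, coframe hl ε (.inr q) x v • skewUnit q) := by
  rw [formE_apply, sum_smul_eB]
  rfl

theorem coframe_inr_eq_zero_of_mem {x v : M l} (h : formE hl ε x v ∈ filt (JB l) (wtB l) (-1))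
    (q : Pair l) : coframe hl ε (.inr q) x v = 0 := by
  rw [coframe_eq_trace, trace_mul_zB_inr h.1]
  exact h.2 _ _ (by simp [wtB])

theorem contDiff_coframe (a : Coord l) (v : M l) :
    ContDiff ℝ ∞ fun x => coframe hl ε a x v := by
  rcases a with i | q
  · exact contDiff_const
  · exact contDiff_const.add (coframeLin hl ε q v).contDiff

theorem isCartanGauge_formE : IsCartanGauge (JB l) (wtB l) Set.univ (formE hl ε) := by
  refine ⟨isOpen_univ, ?_, fun x _ v => formE_mem_so hl ε x v, ?_⟩
  · intro v i j
    simp only [formE_apply, Matrix.sum_apply, Matrix.smul_apply, smul_eq_mul]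
    exact (ContDiff.sum fun a _ => (contDiff_coframe hl ε a v).mul contDiff_const).contDiffOn
  · intro x _ A hA
    refine ⟨∑ a, (-2⁻¹ * (A * zB l a).trace) • frameE hl ε a x, ?_, ?_⟩
    · simpa only [map_sum, map_smul, formE_frameE] using isDualFrame_eB.expand A hA
    · intro w hw
      rw [← sum_coframe_smul_frameE hl ε x w]
      refine Finset.sum_congr rfl fun a _ => ?_
      congr 1
      have h1 := trace_eq_zero_of_mem_lowFil (mul_mem_lowFil hw.2 (zB_mem_filt a).2) (by norm_num)
      rw [sub_mul, Matrix.trace_sub] at h1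
      rw [coframe_eq_trace]
      linarith

theorem mderiv_formE (x v w : M l) : mderiv (fun y => formE hl ε y w) x v =
    negB 0 (∑ q, coframeLin hl ε q w v • skewUnit q) := by
  have h : ∀ a, HasFDerivAt (fun y => coframe hl ε a y w)
      (match a with | .inl _ => 0 | .inr q => coframeLin hl ε q w : M l →L[ℝ] ℝ) x := by
    intro a
    rcases a with i | q
    · exact hasFDerivAt_const _ _
    · exact (coframeLin hl ε q w).hasFDerivAt.const_add _
  have h1 : mderiv (fun y => formE hl ε y w) x v =
      ∑ a, fderiv ℝ (fun y => coframe hl ε a y w) x v • eB l a := by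
    ext i j
    simp only [mderiv, Matrix.of_apply, formE_apply, Matrix.sum_apply, Matrix.smul_apply,
      smul_eq_mul]
    rw [(HasFDerivAt.fun_sum fun a _ => (h a).mul_const (eB l a i j)).fderiv]
    simp only [_root_.sum_apply, _root_.smul_apply, smul_eq_mul]
    exact Finset.sum_congr rfl fun a _ => by rw [(h a).fderiv, mul_comm]
  rw [h1, sum_smul_eB]
  simp only [fun a => (h a).fderiv]
  rfl

theorem lie_negB (X X' : Fin l → ℝ) (Y Y' : Matrix (Fin l) (Fin l) ℝ) :
    ⁅negB X Y, negB X' Y'⁆ = negB 0 (Matrix.of fun i j => X' i * X j - X i * X' j) := by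
  rw [Ring.lie_def]
  ext (i | i | i) (j | j | j) <;> simp [Matrix.mul_apply, negB]
  ring

theorem negB_zero_add (Y Y' : Matrix (Fin l) (Fin l) ℝ) :
    negB 0 Y + negB 0 Y' = negB 0 (Y + Y') := by
  ext (i | i | i) (j | j | j) <;> simp [negB]

theorem negB_zero_smul (r : ℝ) (Y : Matrix (Fin l) (Fin l) ℝ) :
    negB 0 (r • Y) = r • negB 0 Y := by
  ext (i | i | i) (j | j | j) <;> simp [negB]

theorem negB_zero_sub (Y Y' : Matrix (Fin l) (Fin l) ℝ) :
    negB 0 Y - negB 0 Y' = negB 0 (Y - Y') := by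
  ext (i | i | i) (j | j | j) <;> simp [negB]

theorem q12_ne_q34 : q12 hl ≠ q34 hl := by
  simp [q12, q34]

/-- The curvature of `formE` is `ε E^1 ∧ E^{[12]} ⊗ E_{[34]}`. -/
theorem curvatureForm_formE (x v w : M l) : curvatureForm (formE hl ε) x v w =
    (ε * (coframe hl ε (.inl (i1 hl)) x v * coframe hl ε (.inr (q12 hl)) x w -
      coframe hl ε (.inr (q12 hl)) x v * coframe hl ε (.inl (i1 hl)) x w)) •
        eB l (.inr (q34 hl)) := by
  rw [curvatureForm_def, mderiv_formE, mderiv_formE, formE_eq_negB, formE_eq_negB, lie_negB,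
    ← sum_smul_skewUnit (Matrix.of fun i j : Fin l => w (.inl i) * v (.inl j) -
      v (.inl i) * w (.inl j)) (fun i j => by simp only [Matrix.of_apply]; ring), negB_zero_sub,
      negB_zero_add, ← Finset.sum_sub_distrib, ← Finset.sum_add_distrib, eB, ← negB_zero_smul]
  congr 1
  have h : ∀ q, coframeLin hl ε q w v • skewUnit q - coframeLin hl ε q v w • skewUnit q +
      (Matrix.of fun i j : Fin l => w (.inl i) * v (.inl j) - v (.inl i) * w (.inl j))
        q.1.1 q.1.2 • skewUnit q = if q = q34 hl then
      (ε * (coframe hl ε (.inl (i1 hl)) x v * coframe hl ε (.inr (q12 hl)) x w -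
      coframe hl ε (.inr (q12 hl)) x v * coframe hl ε (.inl (i1 hl)) x w)) • skewUnit q else 0 := by
    intro q
    rw [← sub_smul, ← add_smul, ← ite_zero_smul]
    congr 1
    have hne := q12_ne_q34 hl
    have hi : (q12 hl).1.1 = i1 hl := rfl
    simp only [coframeLin, _root_.add_apply, hne, hi,
      _root_.smul_apply, ContinuousLinearMap.proj_apply, smul_eq_mul, if_false,
      Matrix.of_apply, coframe]
    split_ifs <;> ring
  simp only [h]
  simp

theorem mem_distE_iff (x v : M l) :
    v ∈ distE hl ε x ↔ formE hl ε x v ∈ filt (JB l) (wtB l) (-1) := by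
  constructor
  · intro hv
    have h1 : distE hl ε x ≤ (filt (JB l) (wtB l) (-1)).comap (formE hl ε x) := by
      refine Submodule.span_le.2 ?_
      rintro _ ⟨i, rfl⟩
      change formE hl ε x (frameE hl ε (.inl i) x) ∈ filt (JB l) (wtB l) (-1)
      rw [formE_frameE]
      refine ⟨eB_mem_so _, ?_⟩
      rintro (p | p | p) (q | q | q) <;> simp [wtB, eB, negB]
    exact h1 hv
  · intro hv
    rw [← sum_coframe_smul_frameE hl ε x v]
    refine sum_mem fun a _ => ?_
    rcases a with i | q
    · exact Submodule.smul_mem _ _ (Submodule.subset_span ⟨i, rfl⟩)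
    · rw [coframe_inr_eq_zero_of_mem hl ε hv, zero_smul]
      exact zero_mem _

theorem mem_filt_neg_two {A : Matrix (BIdx l) (BIdx l) ℝ}
    (hA : A ∈ skewAdjointMatricesSubmodule (JB l)) {k : ℤ} (hk : k ≤ -2) :
    A ∈ filt (JB l) (wtB l) k := by
  refine ⟨hA, ?_⟩
  rintro (p | p | p) (q | q | q) h <;> simp only [wtB] at h <;> omega

/-- For the grading of `so(l, l+1)` only the values of the curvature on the distribution matter
for regularity. -/
theorem IsCartanGauge.regularAt_of_filt {U : Set (M l)}
    {θ : M l → M l →ₗ[ℝ] Matrix (BIdx l) (BIdx l) ℝ} (hθ : IsCartanGauge (JB l) (wtB l) U θ)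
    {x : M l} (hx : x ∈ U) (h : ∀ v w, θ x v ∈ filt (JB l) (wtB l) (-1) →
      θ x w ∈ filt (JB l) (wtB l) (-1) → curvatureForm θ x v w ∈ filt (JB l) (wtB l) (-1)) :
    RegularAt (JB l) (wtB l) θ x := by
  intro i j hi hj v w hv hw
  rcases hi.eq_or_lt with rfl | hi
  · rw [hθ.eq_zero_of_mem hx hv, ← hθ.curvatureLin_apply hx, map_zero]
    exact zero_mem _
  rcases hj.eq_or_lt with rfl | hj
  · rw [hθ.eq_zero_of_mem hx hw, ← hθ.curvatureLin_apply hx, map_zero]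
    exact zero_mem _
  by_cases hij : i = -1 ∧ j = -1
  · obtain ⟨rfl, rfl⟩ := hij
    exact h v w hv hw
  · exact mem_filt_neg_two (hθ.curvatureForm_mem_so hx v w) (by omega)

theorem curvatureForm_formE_eq_zero {x v w : M l}
    (hv : formE hl ε x v ∈ filt (JB l) (wtB l) (-1))
    (hw : formE hl ε x w ∈ filt (JB l) (wtB l) (-1)) : curvatureForm (formE hl ε) x v w = 0 := by
  rw [curvatureForm_formE, coframe_inr_eq_zero_of_mem hl ε hv, coframe_inr_eq_zero_of_mem hl ε hw]
  simp

theorem regularAt_formE (x : M l) : RegularAt (JB l) (wtB l) (formE hl ε) x :=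
  (isCartanGauge_formE hl ε).regularAt_of_filt (Set.mem_univ x) fun v w hv hw => by
    rw [curvatureForm_formE_eq_zero hl ε hv hw]
    exact zero_mem _

theorem kappa_formE (x : M l) (a b : Coord l) :
    kappa (JB l) (wtB l) (formE hl ε) x 1 (eB l a) (eB l b) =
      curvatureForm (formE hl ε) x (frameE hl ε a x) (frameE hl ε b x) :=
  (isCartanGauge_formE hl ε).kappa_one (Set.mem_univ x) isGradedForm_JB
    (by simp [formE_frameE]) (by simp [formE_frameE])

theorem skewUnit_mul_skewUnit {m : ℕ} {q r : Pair m} (h1 : q.1.1 ≠ r.1.1) (h2 : q.1.1 ≠ r.1.2)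
    (h3 : q.1.2 ≠ r.1.1) (h4 : q.1.2 ≠ r.1.2) : skewUnit q * skewUnit r = 0 := by
  simp [skewUnit, sub_mul, mul_sub, h1, h2, h3, h4]

theorem normalAt_formE (x : M l) : NormalAt (JB l) (wtB l) (eB l) (zB l) (formE hl ε) x := by
  refine codiff_eq_zero_of_decomposable (eB l) (zB l) _
    (fun a => if (.inl (i1 hl)) = a then ε else 0) (fun a => if (.inr (q12 hl)) = a then 1 else 0)
    (ε • zB l (.inl (i1 hl))) (zB l (.inr (q12 hl))) (eB l (.inr (q34 hl))) ?_ (by simp) (by simp)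
    ?_ ?_ ?_
  · intro a b
    rw [kappa_formE, curvatureForm_formE]
    simp only [coframe_frameE]
    congr 1
    split_ifs <;> ring
  · rw [smul_lie_mat, Ring.lie_def, smul_eq_zero]
    right
    ext (i | i | i) (j | j | j) <;> simp [Matrix.mul_apply, zB, posB]
  · rw [smul_lie_mat, Ring.lie_def, smul_eq_zero]
    right
    ext (i | i | i) (j | j | j) <;>
      simp [Matrix.mul_apply, zB, posB, eB, negB, skewUnit, q34, i1, Matrix.single_apply,
        Pi.single_apply]
  · have h1 := fun i j => congrFun (congrFun (skewUnit_mul_skewUnit (q := q12 hl) (r := q34 hl)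
      (by simp [q12, q34]) (by simp [q12, q34]) (by simp [q12, q34]) (by simp [q12, q34])) i) j
    have h2 := fun i j => congrFun (congrFun (skewUnit_mul_skewUnit (q := q34 hl) (r := q12 hl)
      (by simp [q12, q34]) (by simp [q12, q34]) (by simp [q12, q34]) (by simp [q12, q34])) i) j
    simp only [Matrix.mul_apply, Matrix.zero_apply] at h1 h2
    rw [Ring.lie_def]
    ext (i | i | i) (j | j | j) <;> simp [Matrix.mul_apply, zB, posB, eB, negB, h1, h2]

theorem isNormalFor_formE : IsNormalFor l (distE hl ε) Set.univ (formE hl ε) :=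
  ⟨isCartanGauge_formE hl ε, fun x _ v => mem_distE_iff hl ε x v,
    (isCartanGauge_formE hl ε).isRegular isGradedForm_JB fun x _ => regularAt_formE hl ε x,
    (isCartanGauge_formE hl ε).isNormal isGradedForm_JB isDualFrame_eB fun x _ =>
      normalAt_formE hl ε x⟩

end ModelForm

/-! ### Homogeneous matrices and the Hodge pairing -/

section Hodge

variable {n : Type} [Fintype n] [DecidableEq n] {wt : n → ℤ} {A B : Matrix n n ℝ} {d d' : ℤ}

/-- `A` is homogeneous of degree `d` with respect to the weights. -/
def IsHom (wt : n → ℤ) (d : ℤ) (A : Matrix n n ℝ) : Prop := ∀ i j, wt i - wt j ≠ d → A i j = 0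

theorem IsHom.mem_lowFil (hA : IsHom wt d A) : A ∈ lowFil wt d :=
  fun i j h => hA i j h.ne

theorem IsHom.mul (hA : IsHom wt d A) (hB : IsHom wt d' B) : IsHom wt (d + d') (A * B) := by
  intro i j h
  rw [Matrix.mul_apply]
  refine Finset.sum_eq_zero fun r _ => ?_
  by_cases h1 : wt i - wt r = d
  · rw [hB r j (by omega), mul_zero]
  · rw [hA i r h1, zero_mul]

theorem IsHom.sub (hA : IsHom wt d A) (hB : IsHom wt d B) : IsHom wt d (A - B) := fun i j h => by
  rw [Matrix.sub_apply, hA i j h, hB i j h, sub_zero]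

theorem IsHom.lie (hA : IsHom wt d A) (hB : IsHom wt d' B) : IsHom wt (d + d') ⁅A, B⁆ := by
  rw [Ring.lie_def]
  exact (hA.mul hB).sub (add_comm d' d ▸ hB.mul hA)

theorem IsHom.trace_eq_zero (hA : IsHom wt d A) (hd : d ≠ 0) : A.trace = 0 :=
  Finset.sum_eq_zero fun i _ => hA i i (by omega)

theorem IsHom.trace_transpose_mul_eq_zero (hA : IsHom wt d A) (hB : B ∈ lowFil wt (d + 1)) :
    (Aᵀ * B).trace = 0 := by
  simp only [Matrix.trace, Matrix.diag_apply, Matrix.mul_apply, Matrix.transpose_apply]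
  refine Finset.sum_eq_zero fun j _ => Finset.sum_eq_zero fun i _ => ?_
  by_cases h : wt i - wt j = d
  · rw [hB i j (by omega), mul_zero]
  · rw [hA i j h, zero_mul]

theorem trace_transpose_mul_self (A : Matrix n n ℝ) :
    (Aᵀ * A).trace = ∑ j, ∑ i, A i j ^ 2 := by
  simp only [Matrix.trace, Matrix.diag_apply, Matrix.mul_apply, Matrix.transpose_apply, sq]

theorem trace_transpose_mul_self_nonneg (A : Matrix n n ℝ) : 0 ≤ (Aᵀ * A).trace := by
  rw [trace_transpose_mul_self]
  positivity

theorem eq_zero_of_trace_transpose_mul_self (h : (Aᵀ * A).trace = 0) : A = 0 := by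
  rw [trace_transpose_mul_self, Finset.sum_eq_zero_iff_of_nonneg fun j _ => by positivity] at h
  ext i j
  have h1 := h j (Finset.mem_univ _)
  rw [Finset.sum_eq_zero_iff_of_nonneg fun j _ => by positivity] at h1
  simpa using h1 i (Finset.mem_univ _)

theorem isHom_component (d : ℤ) (A : Matrix n n ℝ) : IsHom wt d (component wt d A) := by
  intro i j h
  simp [component, h]

variable {l : ℕ}

theorem isHom_eB (a : Coord l) : IsHom (wtB l) (degB a) (eB l a) := by
  rcases a with a | a <;> rintro (i | i | i) (j | j | j) <;> simp [wtB, degB, eB, negB]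

theorem isHom_zB (a : Coord l) : IsHom (wtB l) (-degB a) (zB l a) := by
  rcases a with a | a <;> rintro (i | i | i) (j | j | j) <;> simp [wtB, degB, zB, posB]

theorem eB_mem_filt (a : Coord l) : eB l a ∈ filt (JB l) (wtB l) (degB a) :=
  ⟨eB_mem_so a, (isHom_eB a).mem_lowFil⟩

theorem structureConstant_eq_zero {a b c : Coord l} (h : degB c ≠ degB a + degB b) :
    -2⁻¹ * (⁅eB l a, eB l b⁆ * zB l c).trace = 0 := by
  rw [(((isHom_eB a).lie (isHom_eB b)).mul (isHom_zB c)).trace_eq_zero (by omega), mul_zero]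

theorem lieDiff_mem_lowFil {F : Coord l → Matrix (BIdx l) (BIdx l) ℝ} {k : ℤ}
    (hF : ∀ a, F a ∈ lowFil (wtB l) (degB a + k)) (a b : Coord l) :
    lieDiff (eB l) (zB l) F a b ∈ lowFil (wtB l) (degB a + degB b + k) := by
  refine sub_mem (sub_mem ?_ ?_) (sum_mem fun c _ => ?_)
  · exact lowFil_mono (by omega) (lie_mem_lowFil (isHom_eB a).mem_lowFil (hF b))
  · exact lowFil_mono (by omega) (lie_mem_lowFil (isHom_eB b).mem_lowFil (hF a))
  · by_cases h : degB c = degB a + degB b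
    · rw [← h]
      exact Submodule.smul_mem _ _ (hF c)
    · rw [structureConstant_eq_zero h, zero_smul]
      exact zero_mem _

theorem isHom_lieDiff {F : Coord l → Matrix (BIdx l) (BIdx l) ℝ} {k : ℤ}
    (hF : ∀ a, IsHom (wtB l) (degB a + k) (F a)) (a b : Coord l) :
    IsHom (wtB l) (degB a + degB b + k) (lieDiff (eB l) (zB l) F a b) := by
  refine IsHom.sub (IsHom.sub ?_ ?_) ?_
  · exact add_assoc (degB a) _ _ ▸ (isHom_eB a).lie (hF b)
  · have h := (isHom_eB b).lie (hF a)
    rwa [← add_assoc, add_comm (degB b)] at h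
  · intro i j hij
    rw [Matrix.sum_apply]
    refine Finset.sum_eq_zero fun c _ => ?_
    by_cases h : degB c = degB a + degB b
    · rw [Matrix.smul_apply, hF c i j (by omega), smul_zero]
    · rw [structureConstant_eq_zero h, zero_smul, Matrix.zero_apply]

theorem lieDiff_sub (F G : Coord l → Matrix (BIdx l) (BIdx l) ℝ) (a b : Coord l) :
    lieDiff (eB l) (zB l) (fun c => F c - G c) a b =
      lieDiff (eB l) (zB l) F a b - lieDiff (eB l) (zB l) G a b := by
  simp only [lieDiff, Ring.lie_def, smul_sub, Finset.sum_sub_distrib]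
  noncomm_ring

/-- The linear functional on `𝔭₊ ⊗ 𝔤` given by pairing with `G : 𝔤₋ → 𝔤`. -/
def pairing (G : Coord l → Matrix (BIdx l) (BIdx l) ℝ) :
    Matrix (BIdx l) (BIdx l) ℝ ⊗[ℝ] Matrix (BIdx l) (BIdx l) ℝ →ₗ[ℝ] ℝ :=
  ∑ c, TensorProduct.lift ((LinearMap.mul ℝ ℝ).compl₁₂
    ((-2⁻¹ : ℝ) • (Matrix.traceLinearMap (BIdx l) ℝ ℝ ∘ₗ LinearMap.mulLeft ℝ (eB l c)))
    (Matrix.traceLinearMap (BIdx l) ℝ ℝ ∘ₗ LinearMap.mulLeft ℝ (G c)ᵀ))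

theorem pairing_tmul (G : Coord l → Matrix (BIdx l) (BIdx l) ℝ) (Z W : Matrix (BIdx l) (BIdx l) ℝ) :
    pairing G (Z ⊗ₜ W) = ∑ c, (-2⁻¹ * (eB l c * Z).trace) * ((G c)ᵀ * W).trace := by
  rw [pairing, LinearMap.sum_apply]
  refine Finset.sum_congr rfl fun c _ => ?_
  simp

theorem trace_transpose_mul_lie {n : Type} [Fintype n] (A B C : Matrix n n ℝ) :
    (Aᵀ * ⁅Bᵀ, C⁆).trace = (⁅B, A⁆ᵀ * C).trace := by
  simp only [Ring.lie_def, Matrix.transpose_sub, Matrix.transpose_mul, mul_sub, sub_mul,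
    Matrix.trace_sub]
  rw [← Matrix.mul_assoc, ← Matrix.mul_assoc, Matrix.trace_mul_comm (Aᵀ * C), ← Matrix.mul_assoc]

/-- The codifferential is adjoint to the Lie algebra differential `∂`, with respect to the inner
product `tr(AᵗB)`: here it matters that `Z_a = -e_aᵗ`. -/
theorem pairing_codiffTri (G : Coord l → Matrix (BIdx l) (BIdx l) ℝ) (a b : Coord l)
    (K : Matrix (BIdx l) (BIdx l) ℝ) :
    pairing G (codiffTri (zB l a) (zB l b) K) =
      ((lieDiff (eB l) (zB l) G a b)ᵀ * K).trace := by
  have h1 : ∀ a W, pairing G (zB l a ⊗ₜ W) = ((G a)ᵀ * W).trace := by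
    intro a W
    simp only [pairing_tmul, trace_eB_mul_zB, ite_mul, one_mul, zero_mul]
    rw [Finset.sum_ite_eq' Finset.univ a, if_pos (Finset.mem_univ a)]
  have h2 : ∀ a b, ((G a)ᵀ * ⁅zB l b, K⁆).trace = -(⁅eB l b, G a⁆ᵀ * K).trace := by
    intro a b
    rw [← trace_transpose_mul_lie, zB_eq, ← Matrix.trace_neg, ← Matrix.mul_neg]
    congr 2
    simp only [Ring.lie_def]
    noncomm_ring
  have h3 : ∀ c, (eB l c * ⁅zB l a, zB l b⁆).trace = (⁅eB l a, eB l b⁆ * zB l c).trace := by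
    intro c
    rw [zB_eq, zB_eq, zB_eq, ← Matrix.trace_transpose]
    simp only [Ring.lie_def, Matrix.transpose_mul, Matrix.transpose_sub, Matrix.transpose_neg,
      Matrix.transpose_transpose]
    congr 1
    noncomm_ring
  rw [codiffTri_apply, map_sub, map_sub, h1, h1, h2, h2, pairing_tmul, lieDiff]
  simp only [h3, Matrix.transpose_sub, Matrix.transpose_sum, Matrix.transpose_smul, sub_mul,
    Matrix.trace_sub, Finset.sum_mul, Matrix.trace_sum, Matrix.smul_mul, Matrix.trace_smul,
    smul_eq_mul]
  ring

theorem sum_trace_lieDiff_eq_zero (G : Coord l → Matrix (BIdx l) (BIdx l) ℝ)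
    {κ : Matrix (BIdx l) (BIdx l) ℝ → Matrix (BIdx l) (BIdx l) ℝ → Matrix (BIdx l) (BIdx l) ℝ}
    (hκ : codiff (eB l) (zB l) κ = 0) :
    ∑ a, ∑ b, ((lieDiff (eB l) (zB l) G a b)ᵀ * κ (eB l a) (eB l b)).trace = 0 := by
  have h := congrArg (pairing G) hκ
  rw [codiff_eq, map_smul, map_zero, smul_eq_zero] at h
  simpa [map_sum, pairing_codiffTri] using h

/-- If the curvatures `κ` and `κ'` are both normal and differ by `∂F` up to terms of higher
homogeneity, then the lowest homogeneous component `G` of `F` is a cocycle. -/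
theorem lieDiff_component_eq_zero {F : Coord l → Matrix (BIdx l) (BIdx l) ℝ} {k : ℤ}
    (hF : ∀ a, F a ∈ lowFil (wtB l) (degB a + k))
    {κ κ' : Matrix (BIdx l) (BIdx l) ℝ → Matrix (BIdx l) (BIdx l) ℝ → Matrix (BIdx l) (BIdx l) ℝ}
    (hκ : codiff (eB l) (zB l) κ = 0) (hκ' : codiff (eB l) (zB l) κ' = 0)
    (h : ∀ a b, κ (eB l a) (eB l b) - κ' (eB l a) (eB l b) - lieDiff (eB l) (zB l) F a b ∈
      lowFil (wtB l) (degB a + degB b + k + 1)) (a b : Coord l) :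
    lieDiff (eB l) (zB l) (fun c => component (wtB l) (degB c + k) (F c)) a b = 0 := by
  set G : Coord l → Matrix (BIdx l) (BIdx l) ℝ := fun c => component (wtB l) (degB c + k) (F c)
    with hG
  have hhom := isHom_lieDiff (F := G) (k := k) fun c => isHom_component _ _
  have h1 : ∀ a b, ((lieDiff (eB l) (zB l) G a b)ᵀ * lieDiff (eB l) (zB l) G a b).trace =
      ((lieDiff (eB l) (zB l) G a b)ᵀ * κ (eB l a) (eB l b)).trace -
        ((lieDiff (eB l) (zB l) G a b)ᵀ * κ' (eB l a) (eB l b)).trace := by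
    intro a b
    have h2 : lieDiff (eB l) (zB l) (fun c => F c - G c) a b ∈
        lowFil (wtB l) (degB a + degB b + (k + 1)) :=
      lieDiff_mem_lowFil (fun c => by
        rw [← add_assoc]
        exact sub_component_mem_lowFil (hF c)) a b
    rw [← add_assoc, lieDiff_sub] at h2
    have h3 := (hhom a b).trace_transpose_mul_eq_zero (add_mem (h a b) h2)
    rw [← Matrix.trace_sub, ← Matrix.mul_sub, ← sub_eq_zero, ← Matrix.trace_sub, ← Matrix.mul_sub,
      ← neg_eq_zero, ← Matrix.trace_neg, ← Matrix.mul_neg, ← h3]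
    congr 2
    abel
  have h4 : ∑ a, ∑ b, ((lieDiff (eB l) (zB l) G a b)ᵀ * lieDiff (eB l) (zB l) G a b).trace = 0 := by
    simp only [h1, Finset.sum_sub_distrib]
    rw [sum_trace_lieDiff_eq_zero G hκ, sum_trace_lieDiff_eq_zero G hκ', sub_zero]
  rw [Finset.sum_eq_zero_iff_of_nonneg fun a _ => Finset.sum_nonneg fun b _ =>
    trace_transpose_mul_self_nonneg _] at h4
  have h5 := h4 a (Finset.mem_univ _)
  rw [Finset.sum_eq_zero_iff_of_nonneg fun b _ => trace_transpose_mul_self_nonneg _] at h5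
  exact eq_zero_of_trace_transpose_mul_self (h5 b (Finset.mem_univ _))

end Hodge

/-! ### Curvature in terms of a frame -/

section Frame

variable {l : ℕ} {n : Type} [Fintype n] [DecidableEq n] {θ : M l → M l →ₗ[ℝ] Matrix n n ℝ}

theorem apply_eq_sum_single (θ : M l → M l →ₗ[ℝ] Matrix n n ℝ) (x v : M l) :
    θ x v = ∑ c, v c • θ x (Pi.single c 1) := by
  conv_lhs => rw [show v = ∑ c, v c • Pi.single c (1 : ℝ) by
    ext a; simp [Pi.single_apply]]
  simp only [map_sum, map_smul]

theorem MSmoothOn.apply_field {U : Set (M l)} (hθ : ∀ v, MSmoothOn (fun y => θ y v) U)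
    {V : M l → M l} (hV : ContDiffOn ℝ ∞ V U) : MSmoothOn (fun y => θ y (V y)) U := by
  intro i j
  simp only [fun y => apply_eq_sum_single θ y (V y), Matrix.sum_apply, Matrix.smul_apply,
    smul_eq_mul]
  exact ContDiffOn.sum fun c _ => ((contDiffOn_pi.1 hV) c).mul (hθ _ i j)

/-- The chain and product rules for `θ(φ(y))(W(y))`. -/
theorem mderiv_comp_field {φ W : M l → M l} {x : M l} (hθ : ∀ v, MDiffAt (fun y => θ y v) (φ x))
    (hφ : DifferentiableAt ℝ φ x) (hW : DifferentiableAt ℝ W x) (v : M l) :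
    mderiv (fun y => θ (φ y) (W y)) x v =
      mderiv (fun y => θ y (W x)) (φ x) (fderiv ℝ φ x v) + θ (φ x) (fderiv ℝ W x v) := by
  ext i j
  have h1 : ∀ c, HasFDerivAt (fun y => θ (φ y) (Pi.single c 1) i j)
      ((fderiv ℝ (fun y => θ y (Pi.single c 1) i j) (φ x)).comp (fderiv ℝ φ x)) x := fun c =>
    HasFDerivAt.comp x (hθ _ i j).hasFDerivAt hφ.hasFDerivAt
  have h2 : ∀ c, HasFDerivAt (fun y => W y c)
      ((ContinuousLinearMap.proj c).comp (fderiv ℝ W x)) x := fun c =>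
    hasFDerivAt_pi'.1 hW.hasFDerivAt c
  simp only [mderiv, Matrix.of_apply, Matrix.add_apply]
  simp only [fun y => apply_eq_sum_single θ (φ y) (W y), fun y => apply_eq_sum_single θ y (W x),
    apply_eq_sum_single θ (φ x) (fderiv ℝ W x v), Matrix.sum_apply, Matrix.smul_apply, smul_eq_mul]
  rw [(HasFDerivAt.fun_sum fun c _ => (h2 c).fun_mul (h1 c)).fderiv,
    (HasFDerivAt.fun_sum fun c _ => (hθ (Pi.single c 1) i j).hasFDerivAt.const_mul (W x c)).fderiv]
  simp only [_root_.sum_apply, _root_.add_apply, _root_.smul_apply, smul_eq_mul,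
    ContinuousLinearMap.comp_apply, ContinuousLinearMap.proj_apply, Finset.sum_add_distrib]
  congr 1
  exact Finset.sum_congr rfl fun c _ => mul_comm _ _

/-- The formula `Ω(V, W) = V θ(W) - W θ(V) - θ([V, W]) + [θ(V), θ(W)]`. -/
theorem curvatureForm_fields {V W : M l → M l} {x : M l} (hθ : ∀ v, MDiffAt (fun y => θ y v) x)
    (hV : DifferentiableAt ℝ V x) (hW : DifferentiableAt ℝ W x) :
    curvatureForm θ x (V x) (W x) = mderiv (fun y => θ y (W y)) x (V x) -
      mderiv (fun y => θ y (V y)) x (W x) - θ x (VectorField.lieBracket ℝ V W x) +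
        ⁅θ x (V x), θ x (W x)⁆ := by
  have h := fun (W : M l → M l) (hW : DifferentiableAt ℝ W x) (v : M l) =>
    mderiv_comp_field (φ := id) hθ differentiableAt_id hW v
  simp only [id_eq, fderiv_id, ContinuousLinearMap.id_apply] at h
  rw [h W hW, h V hV, curvatureForm_def, VectorField.lieBracket, map_sub]
  abel

end Frame

/-! ### Uniqueness of the normal Cartan connection up to gauge transformations -/

section Uniqueness

variable {l : ℕ} (hl : 4 ≤ l) (ε : ℝ)
variable {U : Set (M l)} {θ : M l → M l →ₗ[ℝ] Matrix (BIdx l) (BIdx l) ℝ}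

theorem contDiff_frameE (a : Coord l) : ContDiff ℝ ∞ (frameE hl ε a) := by
  rcases a with i | q
  · refine contDiff_pi.2 fun c => ?_
    rcases c with p | q
    · simp only [frameE, vecE_inl]
      exact contDiff_const
    · simp only [frameE, vecE_inr]
      refine ContDiff.add (ContDiff.neg ?_) ?_
      · split_ifs
        · exact contDiff_apply ℝ ℝ _
        · exact contDiff_const
      · split_ifs
        · exact contDiff_const.mul (contDiff_apply ℝ ℝ _)
        · exact contDiff_const
  · exact contDiff_const

/-- The deviation of `θ` from `formE`, evaluated on the frame. -/
def deviation (θ : M l → M l →ₗ[ℝ] Matrix (BIdx l) (BIdx l) ℝ) (x : M l) (a : Coord l) :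
    Matrix (BIdx l) (BIdx l) ℝ :=
  θ x (frameE hl ε a x) - eB l a

theorem apply_frameE (x : M l) (a : Coord l) :
    θ x (frameE hl ε a x) = eB l a + deviation hl ε θ x a := by
  rw [deviation, add_sub_cancel]

theorem mSmoothOn_deviation (hθ : IsCartanGauge (JB l) (wtB l) U θ) (a : Coord l) :
    MSmoothOn (fun y => deviation hl ε θ y a) U :=
  (MSmoothOn.apply_field hθ.mSmoothOn (contDiff_frameE hl ε a).contDiffOn).sub (MSmoothOn.const _)

/-- The coefficient of `E_{[34]}` in the curvature of `formE` on two frame fields. -/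
def curvCoeff (a b : Coord l) : ℝ :=
  ε * ((if .inl (i1 hl) = a then 1 else 0) * (if .inr (q12 hl) = b then 1 else 0) -
    (if .inr (q12 hl) = a then 1 else 0) * (if .inl (i1 hl) = b then 1 else 0))

theorem curvatureForm_formE_frameE (x : M l) (a b : Coord l) :
    curvatureForm (formE hl ε) x (frameE hl ε a x) (frameE hl ε b x) =
      curvCoeff hl ε a b • eB l (.inr (q34 hl)) := by
  simp only [curvatureForm_formE, coframe_frameE, curvCoeff]

theorem curvCoeff_eq_zero {a b : Coord l} (h : degB a + degB b ≠ -3) : curvCoeff hl ε a b = 0 := by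
  rcases a with a | a <;> rcases b with b | b <;> simp [curvCoeff, degB] at h ⊢

/-- Comparison of the curvatures of `θ` and `formE`: the difference is `∂F` plus terms of higher
homogeneity. -/
theorem curvatureForm_sub_eq (hθ : IsCartanGauge (JB l) (wtB l) U θ) {x : M l} (hx : x ∈ U)
    (a b : Coord l) :
    curvatureForm θ x (frameE hl ε a x) (frameE hl ε b x) -
      curvatureForm (formE hl ε) x (frameE hl ε a x) (frameE hl ε b x) -
      lieDiff (eB l) (zB l) (deviation hl ε θ x) a b =
    curvCoeff hl ε a b • deviation hl ε θ x (.inr (q34 hl)) +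
      mderiv (fun y => deviation hl ε θ y b) x (frameE hl ε a x) -
      mderiv (fun y => deviation hl ε θ y a) x (frameE hl ε b x) +
      ⁅deviation hl ε θ x a, deviation hl ε θ x b⁆ := by
  have hd : ∀ a, DifferentiableAt ℝ (frameE hl ε a) x := fun a =>
    (contDiff_frameE hl ε a).contDiffAt.differentiableAt (by simp)
  have hD : ∀ a v, mderiv (fun y => θ y (frameE hl ε a y)) x v =
      mderiv (fun y => deviation hl ε θ y a) x v := by
    intro a v
    have h1 := (MSmoothOn.apply_field hθ.mSmoothOn
      (contDiff_frameE hl ε a).contDiffOn).mdiffAt hθ.isOpen hx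
    have h2 := (MSmoothOn.const (U := U) (eB l a)).mdiffAt hθ.isOpen hx
    rw [show (fun y => deviation hl ε θ y a) = fun y => θ y (frameE hl ε a y) - eB l a from rfl,
      mderiv_sub h1 h2, mderiv_const, sub_zero]
  have h1 := curvatureForm_fields (fun v => hθ.mdiffAt hx v) (hd a) (hd b)
  have h2 := curvatureForm_fields
    (fun v => (isCartanGauge_formE hl ε).mdiffAt (Set.mem_univ x) v) (hd a) (hd b)
  simp only [formE_frameE, mderiv_const, sub_zero, zero_sub] at h2
  set br := VectorField.lieBracket ℝ (frameE hl ε a) (frameE hl ε b) x with hbr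
  have h3 : formE hl ε x br = ⁅eB l a, eB l b⁆ - curvCoeff hl ε a b • eB l (.inr (q34 hl)) := by
    rw [curvatureForm_formE_frameE] at h2
    rw [h2]
    abel
  have h4 : θ x br = formE hl ε x br + (∑ c, (-2⁻¹ * (⁅eB l a, eB l b⁆ * zB l c).trace) •
      deviation hl ε θ x c) - curvCoeff hl ε a b • deviation hl ε θ x (.inr (q34 hl)) := by
    have h5 : ∀ c, coframe hl ε c x br = -2⁻¹ * (⁅eB l a, eB l b⁆ * zB l c).trace -
        curvCoeff hl ε a b * if .inr (q34 hl) = c then 1 else 0 := by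
      intro c
      rw [coframe_eq_trace, h3, sub_mul, Matrix.trace_sub, Matrix.smul_mul, Matrix.trace_smul,
        smul_eq_mul, ← trace_eB_mul_zB]
      ring
    have h6 : curvCoeff hl ε a b • deviation hl ε θ x (.inr (q34 hl)) =
        ∑ c, (curvCoeff hl ε a b * if .inr (q34 hl) = c then 1 else 0) •
          deviation hl ε θ x c := by
      simp only [mul_ite, mul_one, mul_zero, ite_smul, zero_smul]
      rw [Finset.sum_ite_eq Finset.univ, if_pos (Finset.mem_univ _)]
    conv_lhs => rw [← sum_coframe_smul_frameE hl ε x br]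
    simp only [map_sum, map_smul, apply_frameE hl ε, smul_add, Finset.sum_add_distrib]
    rw [← formE_apply, add_sub_assoc, h6, ← Finset.sum_sub_distrib]
    simp only [← sub_smul, ← h5]
  rw [h1, h2, hD, hD, h4, apply_frameE hl ε, apply_frameE hl ε, lieDiff]
  simp only [add_lie_mat, lie_add_mat, lie_skew_mat (eB l b)]
  abel

/-- `θ` is the pull-back to `U` of a regular normal Cartan connection of type `(G, P)`. -/
structure IsNormalGauge (l : ℕ) (U : Set (M l))
    (θ : M l → M l →ₗ[ℝ] Matrix (BIdx l) (BIdx l) ℝ) : Prop where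
  gauge : IsCartanGauge (JB l) (wtB l) U θ
  regular : ∀ x ∈ U, RegularAt (JB l) (wtB l) θ x
  normal : ∀ x ∈ U, NormalAt (JB l) (wtB l) (eB l) (zB l) θ x

theorem IsNormalGauge.gaugeTrans (hθ : IsNormalGauge l U θ)
    {g : M l → Matrix (BIdx l) (BIdx l) ℝ} (hg : MSmoothOn g U)
    (hgP : ∀ y ∈ U, g y ∈ parab (JB l) (wtB l)) :
    IsNormalGauge l U (gaugeTrans θ g) ∧
      ∀ x ∈ U, GaugeRel (JB l) (wtB l) θ (FreeDistribution.gaugeTrans θ g) x := by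
  have hrel := fun x hx => hθ.gauge.gaugeRel_gaugeTrans (x := x) hx isGradedForm_JB hg hgP
  exact ⟨⟨hθ.gauge.gaugeTrans isGradedForm_JB hg hgP,
    fun x hx => (hrel x hx).regularAt isGradedForm_JB (hθ.regular x hx),
    fun x hx => (hrel x hx).normalAt hθ.gauge hx isGradedForm_JB isDualFrame_eB
      (hθ.normal x hx)⟩, hrel⟩

variable {k : ℤ}

theorem frameE_mem_filt {x : M l} (hk : 0 ≤ k)
    (hF : ∀ a, deviation hl ε θ x a ∈ filt (JB l) (wtB l) (degB a + k)) (a : Coord l) :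
    θ x (frameE hl ε a x) ∈ filt (JB l) (wtB l) (degB a) := by
  rw [apply_frameE hl ε]
  exact add_mem (eB_mem_filt a) (filt_mono (by omega) (hF a))

theorem degB_le (a : Coord l) : degB a ≤ -1 := by
  rcases a with a | a <;> simp [degB]

theorem le_degB (a : Coord l) : -2 ≤ degB a := by
  rcases a with a | a <;> simp [degB]

/-- If `θ` deviates from `formE` by terms `F` of homogeneity at least `k`, the curvature functions
differ by `∂F` up to terms of homogeneity greater than `k`. Both are evaluated on `𝔤₋`, where the
frame fields represent `ω⁻¹` of the basis for `formE`, but only to leading order for `θ`;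
regularity of `θ` controls the error. -/
theorem kappa_sub_mem (hθ : IsNormalGauge l U θ) {x : M l} (hx : x ∈ U) (hk : 1 ≤ k)
    (hF : ∀ y ∈ U, ∀ a, deviation hl ε θ y a ∈ filt (JB l) (wtB l) (degB a + k)) (a b : Coord l) :
    kappa (JB l) (wtB l) θ x 1 (eB l a) (eB l b) -
      kappa (JB l) (wtB l) (formE hl ε) x 1 (eB l a) (eB l b) -
      lieDiff (eB l) (zB l) (deviation hl ε θ x) a b ∈
        lowFil (wtB l) (degB a + degB b + k + 1) := by
  have hg := hθ.gauge
  -- `v a` represents `ω⁻¹(e_a)`; it differs from the frame field by a term of higher order.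
  set v : Coord l → M l := fun a => omegaInv (JB l) (wtB l) θ x 1 (eB l a) with hv
  have hv' : ∀ a, eB l a - θ x (v a) ∈ filt (JB l) (wtB l) 0 := by
    intro a
    simpa using hg.omegaInv_spec hx isGradedForm_JB one_mem_parab (eB_mem_so a)
  have hva : ∀ a, θ x (v a) ∈ filt (JB l) (wtB l) (degB a) := by
    intro a
    have h1 := sub_mem (eB_mem_filt a) (filt_mono (by have := degB_le a; omega) (hv' a))
    rwa [sub_sub_cancel] at h1
  have hdiff : ∀ a, θ x (frameE hl ε a x - v a) - deviation hl ε θ x a ∈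
      filt (JB l) (wtB l) 0 := by
    intro a
    convert hv' a using 1
    rw [map_sub, apply_frameE hl ε]
    abel
  have hreg : ∀ (a b : Coord l) (w : M l), θ x w ∈ filt (JB l) (wtB l) (degB b) →
      curvatureForm θ x (frameE hl ε a x - v a) w ∈ lowFil (wtB l) (degB a + degB b + k + 1) := by
    intro a b w hw
    by_cases hak : degB a + k ≤ 0
    · have h1 := add_mem (filt_mono hak (hdiff a)) (hF x hx a)
      rw [sub_add_cancel] at h1
      have h2 := hθ.regular x hx _ _ hak (by have := degB_le b; omega) _ _ h1 hw
      exact lowFil_mono (by omega) h2.2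
    · have h1 := add_mem (hdiff a) (filt_mono (by omega) (hF x hx a))
      rw [sub_add_cancel] at h1
      rw [hg.eq_zero_of_mem hx h1, ← hg.curvatureLin_apply hx, map_zero]
      exact zero_mem _
  have h1 := hreg a b (v b) (hva b)
  have h2 := hreg b a (frameE hl ε a x) (frameE_mem_filt hl ε (by omega) (hF x hx) a)
  rw [add_comm (degB b)] at h2
  rw [hg.kappa_one hx isGradedForm_JB (hv' a) (hv' b), kappa_formE]
  have h3 : curvatureForm θ x (v a) (v b) =
      curvatureForm θ x (frameE hl ε a x) (frameE hl ε b x) -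
      curvatureForm θ x (frameE hl ε a x - v a) (v b) +
      curvatureForm θ x (frameE hl ε b x - v b) (frameE hl ε a x) := by
    rw [← neg_neg (curvatureForm θ x (frameE hl ε b x - v b) _), ← curvatureForm_swap]
    simp only [← hg.curvatureLin_apply hx, map_sub, LinearMap.sub_apply]
    abel
  have hFx := hF x hx
  have h4 : curvatureForm θ x (frameE hl ε a x) (frameE hl ε b x) -
      curvatureForm (formE hl ε) x (frameE hl ε a x) (frameE hl ε b x) -
      lieDiff (eB l) (zB l) (deviation hl ε θ x) a b ∈
        lowFil (wtB l) (degB a + degB b + k + 1) := by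
    rw [curvatureForm_sub_eq hl ε hg hx]
    have hmd : ∀ a v, mderiv (fun y => deviation hl ε θ y a) x v ∈
        lowFil (wtB l) (degB a + k) := fun a v =>
      mderiv_mem hg.isOpen hx ((mSmoothOn_deviation hl ε hg a).mdiffAt hg.isOpen hx)
        fun y hy => (hF y hy a).2
    have ha := degB_le a
    have hb := degB_le b
    have h34 : degB (.inr (q34 hl) : Coord l) = -2 := rfl
    refine add_mem (sub_mem (add_mem ?_ ?_) ?_) ?_
    · by_cases hab : degB a + degB b = -3
      · exact Submodule.smul_mem _ _ (lowFil_mono (by rw [h34]; omega) (hFx _).2)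
      · rw [curvCoeff_eq_zero hl ε hab, zero_smul]
        exact zero_mem _
    · exact lowFil_mono (by omega) (hmd b _)
    · exact lowFil_mono (by omega) (hmd a _)
    · exact lowFil_mono (by omega) (lie_mem_lowFil (hFx a).2 (hFx b).2)
  rw [h3]
  convert add_mem (sub_mem h4 h1) h2 using 1
  abel

section Exponential

variable {Z : Matrix (BIdx l) (BIdx l) ℝ}

theorem eq_zero_of_mem_lowFil_three {A : Matrix (BIdx l) (BIdx l) ℝ} (hA : A ∈ lowFil (wtB l) 3) :
    A = 0 := by
  ext (i | i | i) (j | j | j) <;> exact hA _ _ (by simp [wtB])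

/-- The exponential of `-Z`, for `Z` in `𝔭₊`; there `Z³ = 0`. -/
def expNeg (Z : Matrix (BIdx l) (BIdx l) ℝ) : Matrix (BIdx l) (BIdx l) ℝ :=
  1 - Z + (2⁻¹ : ℝ) • (Z * Z)

theorem expNeg_facts (hZ : Z ∈ filt (JB l) (wtB l) 1) :
    Z * ((2⁻¹ : ℝ) • (Z * Z)) = 0 ∧ ((2⁻¹ : ℝ) • (Z * Z)) * Z = 0 ∧
      ((2⁻¹ : ℝ) • (Z * Z)) * ((2⁻¹ : ℝ) • (Z * Z)) = 0 ∧
      (2⁻¹ : ℝ) • (Z * Z) + (2⁻¹ : ℝ) • (Z * Z) = Z * Z := by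
  have h3 : Z * (Z * Z) = 0 :=
    eq_zero_of_mem_lowFil_three (mul_mem_lowFil hZ.2 (mul_mem_lowFil hZ.2 hZ.2))
  refine ⟨?_, ?_, ?_, ?_⟩
  · rw [Matrix.mul_smul, h3, smul_zero]
  · rw [Matrix.smul_mul, Matrix.mul_assoc, h3, smul_zero]
  · rw [Matrix.smul_mul, Matrix.mul_smul, Matrix.mul_assoc, h3, Matrix.mul_zero, smul_zero,
      smul_zero]
  · rw [← add_smul]
    norm_num

theorem expNeg_mem_parab (hZ : Z ∈ filt (JB l) (wtB l) 1) : expNeg Z ∈ parab (JB l) (wtB l) := by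
  obtain ⟨h1, h2, h3, h4⟩ := expNeg_facts hZ
  have hso := mem_so.1 hZ.1
  refine ⟨?_, ?_⟩
  · have h5 : (expNeg Z)ᵀ * JB l = JB l * (1 + Z + (2⁻¹ : ℝ) • (Z * Z)) := by
      have h6 : (Z * Z)ᵀ * JB l = JB l * (Z * Z) := by
        rw [Matrix.transpose_mul, Matrix.mul_assoc, hso, Matrix.mul_neg, ← Matrix.mul_assoc, hso]
        noncomm_ring
      simp only [expNeg, Matrix.transpose_add, Matrix.transpose_sub, Matrix.transpose_one,
        Matrix.transpose_smul, add_mul, sub_mul, hso, Matrix.smul_mul, h6, Matrix.mul_add,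
        Matrix.mul_smul, Matrix.one_mul, Matrix.mul_one, sub_neg_eq_add]
    rw [h5, expNeg, Matrix.mul_assoc]
    set R := (2⁻¹ : ℝ) • (Z * Z) with hR
    have h7 : (1 + Z + R) * (1 - Z + R) = 1 + (R + R - Z * Z) + (Z * R - R * Z) + R * R := by
      noncomm_ring
    rw [h7, h1, h2, h3, h4]
    simp
  · have hZ0 : Z ∈ lowFil (wtB l) 0 := lowFil_mono (by norm_num) hZ.2
    exact add_mem (sub_mem one_mem_lowFil hZ0) (Submodule.smul_mem _ _
      (lowFil_mono (by norm_num) (mul_mem_lowFil hZ.2 hZ.2)))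

theorem expNeg_inv (hZ : Z ∈ filt (JB l) (wtB l) 1) :
    (expNeg Z)⁻¹ = 1 + Z + (2⁻¹ : ℝ) • (Z * Z) := by
  obtain ⟨h1, h2, h3, h4⟩ := expNeg_facts hZ
  refine Matrix.inv_eq_left_inv ?_
  rw [expNeg]
  set R := (2⁻¹ : ℝ) • (Z * Z) with hR
  have h7 : (1 + Z + R) * (1 - Z + R) = 1 + (R + R - Z * Z) + (Z * R - R * Z) + R * R := by
    noncomm_ring
  rw [h7, h1, h2, h3, h4]
  simp

/-- `Ad(exp Z) X = X + [Z, X]` up to terms of second order in `Z`. -/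
theorem conj_expNeg (hk : 1 ≤ k) (hZ : Z ∈ filt (JB l) (wtB l) k) {d : ℤ}
    {X : Matrix (BIdx l) (BIdx l) ℝ} (hX : X ∈ lowFil (wtB l) d) :
    (expNeg Z)⁻¹ * X * expNeg Z - X - ⁅Z, X⁆ ∈ lowFil (wtB l) (d + 2 * k) := by
  rw [expNeg_inv (filt_mono hk hZ), expNeg]
  have hR : (2⁻¹ : ℝ) • (Z * Z) ∈ lowFil (wtB l) (2 * k) :=
    Submodule.smul_mem _ _ (lowFil_mono (by omega) (mul_mem_lowFil hZ.2 hZ.2))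
  set R := (2⁻¹ : ℝ) • (Z * Z)
  have h1 : (1 + Z + R) * X * (1 - Z + R) - X - ⁅Z, X⁆ =
      X * R + R * X - Z * X * Z + Z * X * R - R * X * Z + R * X * R := by
    rw [Ring.lie_def]
    noncomm_ring
  rw [h1]
  have hZX := mul_mem_lowFil hZ.2 hX
  have hRX := mul_mem_lowFil hR hX
  refine add_mem (sub_mem (add_mem (sub_mem (add_mem ?_ ?_) ?_) ?_) ?_) ?_
  · exact lowFil_mono (by omega) (mul_mem_lowFil hX hR)
  · exact lowFil_mono (by omega) hRX
  · exact lowFil_mono (by omega) (mul_mem_lowFil hZX hZ.2)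
  · exact lowFil_mono (by omega) (mul_mem_lowFil hZX hR)
  · exact lowFil_mono (by omega) (mul_mem_lowFil hRX hZ.2)
  · exact lowFil_mono (by omega) (mul_mem_lowFil hRX hR)

end Exponential

theorem MSmoothOn.primitive {F : M l → Coord l → Matrix (BIdx l) (BIdx l) ℝ}
    (hF : ∀ a, MSmoothOn (fun y => F y a) U) (k : ℤ) :
    MSmoothOn (fun y => primitive k (F y)) U := by
  intro i j
  unfold FreeDistribution.primitive
  split_ifs
  · rcases i with i | i | i <;> rcases j with j | j | j <;> simp only [posB]
    any_goals first | exact contDiffOn_const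
    · exact ((hF _ _ _).neg).neg
    · exact (hF _ _ _).neg
  · rcases i with i | i | i <;> rcases j with j | j | j <;> simp only [posB]
    any_goals first | exact contDiffOn_const
    · exact hF _ _ _
  · exact contDiffOn_const

/-- A gauge transformation by `exp(-Z)` increases the homogeneity of the deviation. -/
theorem exists_gauge_step (hθ : IsNormalGauge l U θ) (hk : 1 ≤ k)
    (hF : ∀ y ∈ U, ∀ a, deviation hl ε θ y a ∈ filt (JB l) (wtB l) (degB a + k)) :
    ∃ θ₂, IsNormalGauge l U θ₂ ∧ (∀ x ∈ U, GaugeRel (JB l) (wtB l) θ θ₂ x) ∧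
      ∀ y ∈ U, ∀ a, deviation hl ε θ₂ y a ∈ filt (JB l) (wtB l) (degB a + (k + 1)) := by
  set G : M l → Coord l → Matrix (BIdx l) (BIdx l) ℝ := fun y a =>
    component (wtB l) (degB a + k) (deviation hl ε θ y a) with hG
  have hprim : ∀ y ∈ U, primitive k (G y) ∈ filt (JB l) (wtB l) k ∧
      ∀ a, G y a = ⁅eB l a, primitive k (G y)⁆ := by
    intro y hy
    refine cocycle_eq_lie ?_ hl (fun a => ?_) hk (fun a => isHom_component _ _)
    · exact lieDiff_component_eq_zero (fun a => (hF y hy a).2) (hθ.normal y hy)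
        (normalAt_formE hl ε y) (kappa_sub_mem hl ε hθ hy hk hF)
    · exact isGradedForm_JB.component_mem_so (hF y hy a).1 _
  have hGs : ∀ a, MSmoothOn (fun y => G y a) U := by
    intro a i j
    simp only [hG, component, Matrix.of_apply]
    split_ifs
    · exact mSmoothOn_deviation hl ε hθ.gauge a i j
    · exact contDiffOn_const
  have hZs := MSmoothOn.primitive hGs k
  set Z : M l → Matrix (BIdx l) (BIdx l) ℝ := fun y => primitive k (G y)
  have hgs : MSmoothOn (fun y => expNeg (Z y)) U :=
    ((MSmoothOn.const 1).sub hZs).add ((hZs.mul hZs).const_smul _)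
  have hgP : ∀ y ∈ U, expNeg (Z y) ∈ parab (JB l) (wtB l) := fun y hy =>
    expNeg_mem_parab (filt_mono hk (hprim y hy).1)
  obtain ⟨h1, h2⟩ := hθ.gaugeTrans hgs hgP
  refine ⟨_, h1, h2, fun y hy a => ⟨sub_mem (h1.gauge.mem y hy _) (eB_mem_so a), ?_⟩⟩
  obtain ⟨hZ, hGZ⟩ := hprim y hy
  have hFa := (hF y hy a).2
  have hX := (frameE_mem_filt hl ε (by omega) (hF y hy) a).2
  have ha := degB_le a
  have h3 := lowFil_mono (m := degB a + (k + 1)) (by omega) (conj_expNeg hk hZ hX)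
  have h4 : (expNeg (Z y))⁻¹ * mderiv (fun y => expNeg (Z y)) y (frameE hl ε a y) ∈
      lowFil (wtB l) (degB a + (k + 1)) := by
    have h5 : mderiv (fun y => expNeg (Z y)) y (frameE hl ε a y) =
        mderiv (fun y => expNeg (Z y) - 1) y (frameE hl ε a y) := by
      rw [mderiv_sub (hgs.mdiffAt hθ.gauge.isOpen hy)
        ((MSmoothOn.const (U := U) 1).mdiffAt hθ.gauge.isOpen hy), mderiv_const, sub_zero]
    have h6 : mderiv (fun y => expNeg (Z y) - 1) y (frameE hl ε a y) ∈ lowFil (wtB l) k := by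
      refine mderiv_mem hθ.gauge.isOpen hy
        ((hgs.sub (MSmoothOn.const 1)).mdiffAt hθ.gauge.isOpen hy) fun z hz => ?_
      have hZz := (hprim z hz).1.2
      have h7 : expNeg (Z z) - 1 = -Z z + (2⁻¹ : ℝ) • (Z z * Z z) := by
        rw [expNeg]
        abel
      rw [h7]
      exact add_mem (neg_mem hZz) (Submodule.smul_mem _ _
        (lowFil_mono (by omega) (mul_mem_lowFil hZz hZz)))
    rw [h5]
    exact lowFil_mono (by omega) (mul_mem_lowFil (isGradedForm_JB.inv_mem (hgP y hy)).2 h6)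
  have h5 : ⁅Z y, deviation hl ε θ y a⁆ ∈ lowFil (wtB l) (degB a + (k + 1)) :=
    lowFil_mono (by omega) (lie_mem_lowFil hZ.2 hFa)
  have h6 : deviation hl ε θ y a - G y a ∈ lowFil (wtB l) (degB a + (k + 1)) :=
    add_assoc (degB a) k 1 ▸ sub_component_mem_lowFil hFa
  have h7 : deviation hl ε (gaugeTrans θ fun y => expNeg (Z y)) y a =
      ((expNeg (Z y))⁻¹ * θ y (frameE hl ε a y) * expNeg (Z y) - θ y (frameE hl ε a y) -
        ⁅Z y, θ y (frameE hl ε a y)⁆) + ⁅Z y, deviation hl ε θ y a⁆ +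
        (deviation hl ε θ y a - G y a) +
        (expNeg (Z y))⁻¹ * mderiv (fun y => expNeg (Z y)) y (frameE hl ε a y) := by
    rw [deviation, gaugeTrans_apply, hGZ, apply_frameE hl ε y a, lie_add_mat,
      lie_skew_mat (Z y) (eB l a)]
    abel
  rw [h7]
  exact add_mem (add_mem (add_mem h3 h5) h6) h4

end Uniqueness

section Levi

variable {l : ℕ} (hl : 4 ≤ l) (ε : ℝ)
variable {U : Set (M l)} {θ : M l → M l →ₗ[ℝ] Matrix (BIdx l) (BIdx l) ℝ}

/-- The block diagonal matrix with blocks `a`, `1` and `(aᵗ)⁻¹`, in the Levi subgroup `GL(l)`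
of `P`. -/
def levi (a : Matrix (Fin l) (Fin l) ℝ) : Matrix (BIdx l) (BIdx l) ℝ :=
  Matrix.fromBlocks a 0 0 (Matrix.fromBlocks 1 0 0 (a⁻¹)ᵀ)

theorem levi_mem_parab {a : Matrix (Fin l) (Fin l) ℝ} (ha : a.det ≠ 0) :
    levi a ∈ parab (JB l) (wtB l) := by
  have h1 : a⁻¹ * a = 1 := Matrix.nonsing_inv_mul a (isUnit_iff_ne_zero.2 ha)
  have h2 : ∀ i j, ∑ p, a⁻¹ i p * a p j = (1 : Matrix (Fin l) (Fin l) ℝ) i j := fun i j => by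
    rw [← Matrix.mul_apply, h1]
  refine ⟨?_, ?_⟩
  · have h3 : ∀ i j, (JB l * levi a) i j = levi a (flipB i) j := by
      intro i j
      simp [Matrix.mul_apply, JB_apply]
    rw [Matrix.mul_assoc]
    ext i j
    rw [Matrix.mul_apply]
    simp only [h3, Matrix.transpose_apply]
    rcases i with i | i | i <;> rcases j with j | j | j <;>
      simp [levi, flipB, JB]
    · have h4 := h2 j i
      rw [Matrix.one_apply] at h4
      simp only [eq_comm (a := i), ← h4, mul_comm]
    · have h4 := h2 i j
      rw [Matrix.one_apply] at h4
      exact h4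
  · rintro (i | i | i) (j | j | j) <;> simp [levi, wtB]

theorem mem_filt_zero_of_so {A : Matrix (BIdx l) (BIdx l) ℝ}
    (hA : A ∈ skewAdjointMatricesSubmodule (JB l))
    (h1 : ∀ p, A (.inl p) (.inr (.inl ())) = 0) (h2 : ∀ p q, A (.inl p) (.inr (.inr q)) = 0) :
    A ∈ filt (JB l) (wtB l) 0 := by
  refine ⟨hA, ?_⟩
  rintro (i | i | i) (j | j | j) <;> simp only [wtB] <;> intro h
  any_goals omega
  · exact h1 i
  · exact h2 i j
  · have h3 := mem_so_JB.1 hA (.inr (.inl i)) (.inr (.inr j))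
    simp only [flipB] at h3
    rw [h3, show i = () from rfl, h1, neg_zero]

/-- The `𝔤₋₁`-component of `θ` on the frame of the distribution. -/
def leviPart (θ : M l → M l →ₗ[ℝ] Matrix (BIdx l) (BIdx l) ℝ) (x : M l) :
    Matrix (Fin l) (Fin l) ℝ :=
  Matrix.of fun p i => θ x (frameE hl ε (.inl i) x) (.inl p) (.inr (.inl ()))

theorem det_leviPart_ne_zero (hθ : IsCartanGauge (JB l) (wtB l) U θ) {x : M l} (hx : x ∈ U)
    (had : ∀ v ∈ distE hl ε x, θ x v ∈ filt (JB l) (wtB l) (-1)) :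
    (leviPart hl ε θ x).det ≠ 0 := by
  intro hdet
  obtain ⟨r, hr, hr0⟩ := Matrix.exists_mulVec_eq_zero_iff.2 hdet
  set u : M l := ∑ i, r i • frameE hl ε (.inl i) x with hu
  have hud : u ∈ distE hl ε x :=
    sum_mem fun i _ => Submodule.smul_mem _ _ (Submodule.subset_span ⟨i, rfl⟩)
  have h1 : θ x u ∈ filt (JB l) (wtB l) 0 := by
    refine mem_filt_zero_of_so (hθ.mem x hx u) (fun p => ?_)
      fun p q => (had u hud).2 _ _ (by simp [wtB])
    have h2 := congrFun hr0 p
    simp only [Matrix.mulVec, dotProduct, leviPart, Matrix.of_apply, Pi.zero_apply] at h2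
    simp only [hu, map_sum, map_smul, Matrix.sum_apply, Matrix.smul_apply, smul_eq_mul]
    rw [← h2]
    exact Finset.sum_congr rfl fun i _ => mul_comm _ _
  have h3 := hθ.eq_zero_of_mem hx h1
  refine hr (funext fun p => ?_)
  have h4 := congrFun h3 (.inl p)
  simpa [hu, frameE, vecE_inl] using h4

theorem contDiffOn_det {m : Type} [Fintype m] [DecidableEq m] {A : M l → Matrix m m ℝ}
    (hA : MSmoothOn A U) : ContDiffOn ℝ ∞ (fun y => (A y).det) U := by
  simp only [Matrix.det_apply']
  exact ContDiffOn.sum fun s _ => contDiffOn_const.mul (contDiffOn_prod fun i _ => hA _ _)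

theorem mSmoothOn_matrix_inv {m : Type} [Fintype m] [DecidableEq m] {A : M l → Matrix m m ℝ}
    (hA : MSmoothOn A U) (h0 : ∀ y ∈ U, (A y).det ≠ 0) : MSmoothOn (fun y => (A y)⁻¹) U := by
  intro i j
  simp only [Matrix.inv_def, Ring.inverse_eq_inv', Matrix.smul_apply, smul_eq_mul,
    Matrix.adjugate_apply]
  refine ((contDiffOn_det hA).inv h0).mul (contDiffOn_det fun p q => ?_)
  simp only [Matrix.updateRow_apply]
  split_ifs
  · exact contDiffOn_const
  · exact hA p q

/-- For a regular connection adapted to the distribution, a gauge transformation with values in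
the Levi subgroup makes the deviation have positive homogeneity: on `𝔤₋₁` by the choice of the
transformation, and on `𝔤₋₂` by regularity, as `[𝔤₋₁, 𝔤₋₁] = 𝔤₋₂`. -/
theorem exists_gauge_levi (hθ : IsNormalGauge l U θ)
    (had : ∀ x ∈ U, ∀ v ∈ distE hl ε x, θ x v ∈ filt (JB l) (wtB l) (-1)) :
    ∃ θ₂, IsNormalGauge l U θ₂ ∧ (∀ x ∈ U, GaugeRel (JB l) (wtB l) θ θ₂ x) ∧
      ∀ y ∈ U, ∀ a, deviation hl ε θ₂ y a ∈ filt (JB l) (wtB l) (degB a + 1) := by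
  have hdet : ∀ y ∈ U, (leviPart hl ε θ y).det ≠ 0 := fun y hy =>
    det_leviPart_ne_zero hl ε hθ.gauge hy (had y hy)
  have has : MSmoothOn (leviPart hl ε θ) U := fun p i =>
    MSmoothOn.apply_field hθ.gauge.mSmoothOn (contDiff_frameE hl ε (.inl i)).contDiffOn _ _
  have hgs : MSmoothOn (fun y => levi (leviPart hl ε θ y)) U := by
    have hinv := mSmoothOn_matrix_inv has hdet
    rintro (i | i | i) (j | j | j) <;>
      simp only [levi, Matrix.fromBlocks_apply₁₁, Matrix.fromBlocks_apply₁₂,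
        Matrix.fromBlocks_apply₂₁, Matrix.fromBlocks_apply₂₂]
    any_goals first | exact contDiffOn_const
    · exact has i j
    · exact hinv j i
  have hgP : ∀ y ∈ U, levi (leviPart hl ε θ y) ∈ parab (JB l) (wtB l) := fun y hy =>
    levi_mem_parab (hdet y hy)
  obtain ⟨h1, h2⟩ := hθ.gaugeTrans hgs hgP
  have hinl : ∀ y ∈ U, ∀ i, deviation hl ε (gaugeTrans θ fun y => levi (leviPart hl ε θ y)) y
      (.inl i) ∈ filt (JB l) (wtB l) 0 := by
    intro y hy i
    set a := leviPart hl ε θ y with ha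
    set T := θ y (frameE hl ε (.inl i) y) with hT
    have hTd : T ∈ filt (JB l) (wtB l) (-1) :=
      had y hy _ (Submodule.subset_span ⟨i, rfl⟩)
    have hTa : ∀ p, T (.inl p) (.inr (.inl ())) = a p i := fun p => rfl
    have hTz : ∀ p q, T (.inl p) (.inr (.inr q)) = 0 := fun p q => hTd.2 _ _ (by simp [wtB])
    have hTq : ∀ q, T (.inr (.inl ())) (.inr (.inr q)) = -a q i := fun q =>
      mem_so_JB.1 hTd.1 (.inr (.inl ())) (.inr (.inr q))
    have hinv : ∀ q, ∑ p, a p i * a⁻¹ q p = if q = i then 1 else 0 := by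
      intro q
      have h4 : a⁻¹ * a = 1 := Matrix.nonsing_inv_mul a (isUnit_iff_ne_zero.2 (hdet y hy))
      have h5 := congrFun (congrFun h4 q) i
      rw [Matrix.mul_apply, Matrix.one_apply] at h5
      simpa only [mul_comm] using h5
    have h3 : T * levi a - levi a * eB l (.inl i) ∈ lowFil (wtB l) 0 := by
      rintro (p | p | p) (q | q | q) <;> simp only [wtB] <;> intro h
      any_goals omega
      · simp [Matrix.mul_apply, levi, eB, negB, hTa, Pi.single_apply]
      · simp [Matrix.mul_apply, levi, eB, negB, hTz]
      · simp [Matrix.mul_apply, levi, eB, negB, hTq, hinv, Pi.single_apply]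
    have h4 := mul_mem_lowFil (isGradedForm_JB.inv_mem (hgP y hy)).2 h3
    have h5 : (levi a)⁻¹ * mderiv (fun y => levi (leviPart hl ε θ y)) y (frameE hl ε (.inl i) y) ∈
        lowFil (wtB l) 0 :=
      (maurerCartan_mem isGradedForm_JB hθ.gauge.isOpen hy hgs hgP (frameE hl ε (.inl i) y)).2
    refine ⟨sub_mem (h1.gauge.mem y hy _) (eB_mem_so _), ?_⟩
    have h6 : deviation hl ε (gaugeTrans θ fun y => levi (leviPart hl ε θ y)) y (.inl i) =
        (levi a)⁻¹ * (T * levi a - levi a * eB l (.inl i)) + (levi a)⁻¹ *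
          mderiv (fun y => levi (leviPart hl ε θ y)) y (frameE hl ε (.inl i) y) := by
      rw [deviation, gaugeTrans_apply, mul_sub, ← Matrix.mul_assoc, ← Matrix.mul_assoc,
        isGradedForm_JB.inv_mul (hgP y hy), Matrix.one_mul]
      abel
    rw [h6]
    exact add_mem (by simpa only [add_zero] using h4) h5
  refine ⟨_, h1, h2, fun y hy a => ?_⟩
  set θ₂ := gaugeTrans θ fun y => levi (leviPart hl ε θ y)
  rcases a with i | ⟨⟨i, j⟩, hij⟩
  · exact hinl y hy i
  · refine ⟨sub_mem (h1.gauge.mem y hy _) (eB_mem_so _), ?_⟩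
    have hfr : ∀ i, θ₂ y (frameE hl ε (.inl i) y) ∈ filt (JB l) (wtB l) (-1) := by
      intro i
      rw [apply_frameE hl ε]
      exact add_mem (eB_mem_filt (.inl i)) (filt_mono (by norm_num) (hinl y hy i))
    have h3 := curvatureForm_sub_eq hl ε h1.gauge hy (.inl i) (.inl j)
    have h4 : curvatureForm θ₂ y (frameE hl ε (.inl i) y) (frameE hl ε (.inl j) y) ∈
        lowFil (wtB l) (-1) :=
      (h1.regular y hy (-1) (-1) (by norm_num) (by norm_num) _ _ (hfr i) (hfr j)).2
    rw [curvatureForm_formE_frameE, curvCoeff_eq_zero hl ε (by simp [degB]), zero_smul, zero_smul,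
      zero_add, sub_zero, lieDiff_inl_inl hij] at h3
    have hmd : ∀ i v, mderiv (fun y => deviation hl ε θ₂ y (.inl i)) y v ∈ lowFil (wtB l) 0 :=
      fun i v => mderiv_mem h1.gauge.isOpen hy
        ((mSmoothOn_deviation hl ε h1.gauge (.inl i)).mdiffAt h1.gauge.isOpen hy)
        fun z hz => (hinl z hz i).2
    have hlie : ∀ i j, ⁅eB l (.inl i), deviation hl ε θ₂ y (.inl j)⁆ ∈ lowFil (wtB l) (-1) :=
      fun i j => lie_mem_lowFil (isHom_eB (.inl i)).mem_lowFil (hinl y hy j).2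
    have h5 := lowFil_mono (m := -1) (by norm_num)
      (add_mem (sub_mem (hmd j (frameE hl ε (.inl i) y)) (hmd i (frameE hl ε (.inl j) y)))
        (lie_mem_lowFil (hinl y hy i).2 (hinl y hy j).2))
    rw [← h3] at h5
    have h6 := sub_mem (sub_mem h4 h5) (sub_mem (hlie i j) (hlie j i))
    rwa [sub_sub_cancel, add_sub_cancel_left] at h6

/-- A regular normal Cartan connection adapted to the distribution `distE` agrees with `formE` up
to a change of section. -/
theorem gaugeRel_formE (hθ : IsNormalGauge l U θ)
    (had : ∀ x ∈ U, ∀ v ∈ distE hl ε x, θ x v ∈ filt (JB l) (wtB l) (-1)) {x : M l} (hx : x ∈ U) :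
    GaugeRel (JB l) (wtB l) θ (formE hl ε) x := by
  have key : ∀ m : ℕ, ∃ θ₂, IsNormalGauge l U θ₂ ∧
      (∀ x ∈ U, GaugeRel (JB l) (wtB l) θ θ₂ x) ∧
      ∀ y ∈ U, ∀ a, deviation hl ε θ₂ y a ∈ filt (JB l) (wtB l) (degB a + (m + 1)) := by
    intro m
    induction m with
    | zero => simpa using exists_gauge_levi hl ε hθ had
    | succ m ih =>
      obtain ⟨θ₁, h1, h2, h3⟩ := ih
      obtain ⟨θ₂, h1', h2', h3'⟩ := exists_gauge_step hl ε h1 (by omega) h3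
      exact ⟨θ₂, h1', fun x hx => (h2 x hx).trans isGradedForm_JB (h2' x hx),
        fun y hy a => by exact_mod_cast h3' y hy a⟩
  -- For `m = 4` the deviation has degree at least three, where `𝔤` vanishes.
  obtain ⟨θ₂, h1, h2, h3⟩ := key 4
  have h4 : ∀ y ∈ U, ∀ v, θ₂ y v = formE hl ε y v := by
    intro y hy v
    have h5 : ∀ a, deviation hl ε θ₂ y a = 0 := fun a =>
      eq_zero_of_mem_lowFil_three
        (lowFil_mono (by have := le_degB a; push_cast; omega) (h3 y hy a).2)
    conv_lhs => rw [← sum_coframe_smul_frameE hl ε y v]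
    simp [apply_frameE hl ε, h5, formE_apply]
  have h5 : GaugeRel (JB l) (wtB l) θ₂ (formE hl ε) x := by
    refine ⟨1, one_mem_parab, fun v => by simp [h4 x hx], fun v w => ?_⟩
    have h6 : ∀ v w, mderiv (fun y => θ₂ y w) x v = mderiv (fun y => formE hl ε y w) x v :=
      fun v w => mderiv_congr h1.gauge.isOpen hx fun y hy => h4 y hy w
    simp only [curvatureForm_def, h6, h4 x hx]
    simp
  exact (h2 x hx).trans isGradedForm_JB h5

end Levi

/-! ### The distributions -/

section Distributions

variable {l : ℕ} (hl : 4 ≤ l) (ε : ℝ)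

theorem linearIndependent_vecE (x : M l) : LinearIndependent ℝ fun i => vecE hl ε i x := by
  rw [Fintype.linearIndependent_iff]
  intro r hr i
  have h := congrFun hr (.inl i)
  simpa [vecE_inl] using h

theorem isDistribution_distE : IsDistribution l (distE hl ε) := fun _ =>
  ⟨Set.univ, isOpen_univ, Set.mem_univ _, vecE hl ε,
    fun i => (contDiff_frameE hl ε (.inl i)).contDiffOn,
    fun y _ => ⟨linearIndependent_vecE hl ε y, rfl⟩⟩

/-- `[X_i, X_j] = ∂/∂y_{[ij]}`, since `formE` has no curvature on the distribution. -/
theorem lieBracket_vecE {i j : Fin l} (h : i < j) (x : M l) :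
    VectorField.lieBracket ℝ (vecE hl ε i) (vecE hl ε j) x = vecY ⟨(i, j), h⟩ := by
  have hd : ∀ a, DifferentiableAt ℝ (frameE hl ε a) x := fun a =>
    (contDiff_frameE hl ε a).contDiffAt.differentiableAt (by simp)
  have h1 := curvatureForm_fields
    (fun v => (isCartanGauge_formE hl ε).mdiffAt (Set.mem_univ x) v) (hd (.inl i)) (hd (.inl j))
  rw [curvatureForm_formE_frameE, curvCoeff_eq_zero hl ε (by simp [degB]), zero_smul] at h1
  simp only [formE_frameE, mderiv_const, sub_zero, zero_sub, lie_eB_inl_inl h] at h1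
  rw [← sub_eq_zero]
  have h2 : formE hl ε x (vecY ⟨(i, j), h⟩) = -eB l (.inr ⟨(i, j), h⟩) := by
    rw [← formE_frameE hl ε _ x, ← map_neg]
    simp [frameE]
  have h3 : formE hl ε x (VectorField.lieBracket ℝ (frameE hl ε (.inl i))
      (frameE hl ε (.inl j)) x) = -eB l (.inr ⟨(i, j), h⟩) := by
    refine eq_neg_of_add_eq_zero_left ?_
    rw [← neg_eq_zero, neg_add, ← h1]
  change VectorField.lieBracket ℝ (frameE hl ε (.inl i)) (frameE hl ε (.inl j)) x -
    vecY ⟨(i, j), h⟩ = 0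
  refine eq_zero_of_coframe hl ε (x := x) fun a => ?_
  rw [coframe_eq_trace, map_sub, h2, h3, sub_self, zero_mul, Matrix.trace_zero, mul_zero]

theorem isNondegenerate_distE : IsNondegenerate (distE hl ε) := by
  intro x
  rw [eq_top_iff]
  intro v _
  rw [← sum_coframe_smul_frameE hl ε x v]
  have hsec : ∀ i, IsSectionAt (distE hl ε) x (vecE hl ε i) := fun i =>
    ⟨(contDiff_frameE hl ε (.inl i)).contDiffAt,
      Filter.Eventually.of_forall fun y => Submodule.subset_span ⟨i, rfl⟩⟩
  refine sum_mem fun a _ => Submodule.smul_mem _ _ ?_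
  rcases a with i | ⟨⟨i, j⟩, hij⟩
  · exact Submodule.mem_sup_left (Submodule.subset_span ⟨i, rfl⟩)
  · exact Submodule.mem_sup_right (neg_mem (Submodule.subset_span
      ⟨_, _, hsec i, hsec j, (lieBracket_vecE hl ε hij x).symm⟩))

end Distributions

/-! ### The extension to almost spinorial Cartan connections -/

section Extension

variable {l : ℕ}

/-- The basis vector of `ℝ^{l,l+1}` which occurs in a row of `inclD`. -/
def idxD : DIdx l → BIdx l
  | .inl a => Fin.cases (.inr (.inl ())) .inl a
  | .inr a => Fin.cases (.inr (.inl ())) (fun j => .inr (.inr j)) a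

/-- The non-zero entry in a row of `inclD`. -/
def coefD : DIdx l → ℝ
  | .inl a => Fin.cases (√2)⁻¹ (fun _ => 1) a
  | .inr a => Fin.cases (√2)⁻¹ (fun _ => 1) a

theorem inclD_apply (i : DIdx l) (r : BIdx l) :
    inclD l i r = if r = idxD i then coefD i else 0 := by
  rcases i with i | i <;> rcases r with r | r | r <;>
    refine Fin.cases ?_ (fun j => ?_) i <;>
    simp [inclD, idxD, coefD, Fin.succ_ne_zero, (Fin.succ_ne_zero _).symm, eq_comm]

theorem alpha_apply (A : Matrix (BIdx l) (BIdx l) ℝ) (i j : DIdx l) :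
    alpha l A i j = coefD i * coefD j * A (idxD i) (idxD j) := by
  change (inclD l * A * (inclD l)ᵀ) i j = _
  simp [Matrix.mul_apply, inclD_apply]
  ring

theorem JD_mul_inclD : JD l * inclD l = inclD l * JB l := by
  ext i r
  have h : ∀ r : BIdx l, ∀ s, flipB s = r ↔ s = flipB r := fun r s =>
    ⟨fun h => by rw [← h, flipB_flipB], fun h => by rw [h, flipB_flipB]⟩
  have h1 : (JD l * inclD l) i r = inclD l (Sum.swap i) r := by
    simp [Matrix.mul_apply, JD_apply]
  have h2 : (inclD l * JB l) i r = inclD l i (flipB r) := by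
    simp [Matrix.mul_apply, JB_apply, h]
  rw [h1, h2]
  rcases i with i | i <;> rcases r with r | r | r <;> rfl

theorem transpose_inclD_mul_JD : (inclD l)ᵀ * JD l = JB l * (inclD l)ᵀ := by
  have h := congrArg Matrix.transpose (JD_mul_inclD (l := l))
  rwa [Matrix.transpose_mul, Matrix.transpose_mul, isGradedForm_JD.symm, isGradedForm_JB.symm] at h

theorem alpha_mem_so {A : Matrix (BIdx l) (BIdx l) ℝ}
    (hA : A ∈ skewAdjointMatricesSubmodule (JB l)) :
    alpha l A ∈ skewAdjointMatricesSubmodule (JD l) := by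
  rw [mem_so] at hA ⊢
  change (inclD l * A * (inclD l)ᵀ)ᵀ * JD l = -(JD l * (inclD l * A * (inclD l)ᵀ))
  calc (inclD l * A * (inclD l)ᵀ)ᵀ * JD l = inclD l * Aᵀ * ((inclD l)ᵀ * JD l) := by
        simp only [Matrix.transpose_mul, Matrix.transpose_transpose, Matrix.mul_assoc]
    _ = inclD l * (Aᵀ * JB l) * (inclD l)ᵀ := by
        rw [transpose_inclD_mul_JD]
        simp only [Matrix.mul_assoc]
    _ = -(inclD l * JB l * A * (inclD l)ᵀ) := by
        rw [hA, Matrix.mul_neg, Matrix.neg_mul]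
        simp only [Matrix.mul_assoc]
    _ = _ := by
        rw [← JD_mul_inclD]
        simp only [Matrix.mul_assoc]

theorem filt_JD_of_le {k : ℤ} (hk : k ≤ -1) {A : Matrix (DIdx l) (DIdx l) ℝ}
    (hA : A ∈ skewAdjointMatricesSubmodule (JD l)) : A ∈ filt (JD l) (wtD l) k := by
  refine ⟨hA, ?_⟩
  rintro (i | i) (j | j) <;> simp only [wtD] <;> intro h <;> omega

theorem mem_filt_zero_JD {A : Matrix (DIdx l) (DIdx l) ℝ}
    (hA : A ∈ skewAdjointMatricesSubmodule (JD l))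
    (h1 : ∀ i : Fin l, A (.inl i.succ) (.inr 0) = 0)
    (h2 : ∀ i j : Fin l, A (.inl i.succ) (.inr j.succ) = 0) : A ∈ filt (JD l) (wtD l) 0 := by
  have hso := mem_so_JD.1 hA
  refine ⟨hA, ?_⟩
  rintro (i | i) (j | j) <;> simp only [wtD] <;> intro h
  any_goals omega
  have h3 := hso (.inr i) (.inr j)
  simp only [Sum.swap_inr] at h3
  induction i using Fin.cases with
  | zero =>
    induction j using Fin.cases with
    | zero => linarith
    | succ j => rw [h3, h1, neg_zero]
  | succ i =>
    induction j using Fin.cases with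
    | zero => exact h1 i
    | succ j => exact h2 i j

/-- `α` induces an injection `𝔤/𝔭 → 𝔤̃/𝔭̃`. -/
theorem alpha_mem_filt_zero_iff {A : Matrix (BIdx l) (BIdx l) ℝ}
    (hA : A ∈ skewAdjointMatricesSubmodule (JB l)) :
    alpha l A ∈ filt (JD l) (wtD l) 0 ↔ A ∈ filt (JB l) (wtB l) 0 := by
  constructor
  · intro h
    refine mem_filt_zero_of_so hA (fun i => ?_) fun i j => ?_
    · have h1 := h.2 (.inl i.succ) (.inr 0) (by simp [wtD])
      simpa [alpha_apply, idxD, coefD] using h1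
    · have h1 := h.2 (.inl i.succ) (.inr j.succ) (by simp [wtD])
      simpa [alpha_apply, idxD, coefD] using h1
  · intro h
    refine mem_filt_zero_JD (alpha_mem_so hA) (fun i => ?_) fun i j => ?_
    · rw [alpha_apply, show idxD (.inl i.succ) = (.inl i : BIdx l) from rfl,
        h.2 (.inl i) _ (by simp [wtB, idxD]), mul_zero]
    · rw [alpha_apply, show idxD (.inl i.succ) = (.inl i : BIdx l) from rfl,
        h.2 (.inl i) _ (by simp [wtB, idxD]), mul_zero]

/-- `α` induces a surjection `𝔤/𝔭 → 𝔤̃/𝔭̃`. -/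
theorem exists_sub_alpha_mem {A : Matrix (DIdx l) (DIdx l) ℝ}
    (hA : A ∈ skewAdjointMatricesSubmodule (JD l)) :
    ∃ B ∈ skewAdjointMatricesSubmodule (JB l), A - alpha l B ∈ filt (JD l) (wtD l) 0 := by
  have hB : negB (fun i : Fin l => √2 * A (.inl i.succ) (.inr 0))
      (Matrix.of fun i j : Fin l => A (.inl i.succ) (.inr j.succ)) ∈
        skewAdjointMatricesSubmodule (JB l) :=
    negB_mem_so _ fun i j => mem_so_JD.1 hA (.inr i.succ) (.inr j.succ)
  refine ⟨_, hB, mem_filt_zero_JD (sub_mem hA (alpha_mem_so hB)) (fun i => ?_) fun i j => ?_⟩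
  · simp [alpha_apply, idxD, coefD, negB]
  · simp [alpha_apply, idxD, coefD, negB]

section Linear

variable {E : Type} [NormedAddCommGroup E] [NormedSpace ℝ E] {U : Set E} {x : E}
variable {m n : Type} [Fintype m] [DecidableEq m] [Fintype n] [DecidableEq n]

theorem linearMap_apply_eq_sum (L : Matrix n n ℝ →ₗ[ℝ] Matrix m m ℝ) (A : Matrix n n ℝ) (i j : m) :
    L A i j = ∑ r, ∑ s, A r s * L (Matrix.single r s 1) i j := by
  conv_lhs => rw [Matrix.matrix_eq_sum_single A]
  simp only [map_sum, Matrix.sum_apply]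
  refine Finset.sum_congr rfl fun r _ => Finset.sum_congr rfl fun s _ => ?_
  rw [show Matrix.single r s (A r s) = A r s • Matrix.single r s (1 : ℝ) by simp, map_smul,
    Matrix.smul_apply, smul_eq_mul]

theorem mderiv_map (L : Matrix n n ℝ →ₗ[ℝ] Matrix m m ℝ) {g : E → Matrix n n ℝ}
    (hg : MDiffAt g x) (v : E) : mderiv (fun y => L (g y)) x v = L (mderiv g x v) := by
  ext i j
  simp only [mderiv, Matrix.of_apply, fun y => linearMap_apply_eq_sum L (g y) i j]
  rw [linearMap_apply_eq_sum, (HasFDerivAt.fun_sum fun r _ => HasFDerivAt.fun_sum fun s _ =>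
    (hg r s).hasFDerivAt.mul_const (L (Matrix.single r s 1) i j)).fderiv]
  simp only [_root_.sum_apply, _root_.smul_apply, smul_eq_mul, Matrix.of_apply]
  exact Finset.sum_congr rfl fun r _ => Finset.sum_congr rfl fun s _ => mul_comm _ _

theorem MSmoothOn.map (L : Matrix n n ℝ →ₗ[ℝ] Matrix m m ℝ) {g : E → Matrix n n ℝ}
    (hg : MSmoothOn g U) : MSmoothOn (fun y => L (g y)) U := by
  intro i j
  simp only [fun y => linearMap_apply_eq_sum L (g y) i j]
  exact ContDiffOn.sum fun r _ => ContDiffOn.sum fun s _ => (hg r s).mul contDiffOn_const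

end Linear

variable {U : Set (M l)} {θ θ₁ θ₂ : M l → M l →ₗ[ℝ] Matrix (BIdx l) (BIdx l) ℝ} {x : M l}

theorem curvatureForm_extend (hθ : ∀ v, MDiffAt (fun y => θ y v) x) (v w : M l) :
    curvatureForm (extend l θ) x v w = alpha l (curvatureForm θ x v w) := by
  have h : ∀ v w, mderiv (fun y => extend l θ y w) x v = alpha l (mderiv (fun y => θ y w) x v) :=
    fun v w => mderiv_map (alpha l) (hθ w) v
  rw [curvatureForm_def, curvatureForm_def, h, h, map_add, map_sub, alpha_lie]
  rfl

theorem IsCartanGauge.extend (hθ : IsCartanGauge (JB l) (wtB l) U θ) :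
    IsCartanGauge (JD l) (wtD l) U (extend l θ) := by
  refine ⟨hθ.isOpen, fun v => (hθ.mSmoothOn v).map (alpha l),
    fun x hx v => alpha_mem_so (hθ.mem x hx v), fun x hx A hA => ?_⟩
  obtain ⟨B, hB, hAB⟩ := exists_sub_alpha_mem hA
  have hiff : ∀ w, A - FreeDistribution.extend l θ x w ∈ filt (JD l) (wtD l) 0 ↔
      B - θ x w ∈ filt (JB l) (wtB l) 0 := by
    intro w
    rw [← alpha_mem_filt_zero_iff (sub_mem hB (hθ.mem x hx w)), map_sub]
    exact ⟨fun h => by simpa [FreeDistribution.extend] using sub_mem h hAB,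
      fun h => by simpa [FreeDistribution.extend] using add_mem hAB h⟩
  obtain ⟨v, hv, huniq⟩ := hθ.iso x hx B hB
  exact ⟨v, (hiff v).2 hv, fun w hw => huniq w ((hiff w).1 hw)⟩

/-- For a `|1|`-grading, regularity is automatic. -/
theorem IsCartanGauge.regularAt_JD {θ : M l → M l →ₗ[ℝ] Matrix (DIdx l) (DIdx l) ℝ}
    (hθ : IsCartanGauge (JD l) (wtD l) U θ) (hx : x ∈ U) : RegularAt (JD l) (wtD l) θ x := by
  intro i j hi hj v w hv hw
  by_cases hi' : i = 0
  · subst hi'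
    rw [hθ.eq_zero_of_mem hx hv, ← hθ.curvatureLin_apply hx, map_zero, LinearMap.zero_apply]
    exact zero_mem _
  · by_cases hj' : j = 0
    · subst hj'
      rw [hθ.eq_zero_of_mem hx hw, ← hθ.curvatureLin_apply hx, map_zero]
      exact zero_mem _
    · exact filt_JD_of_le (by omega) (hθ.curvatureForm_mem_so hx v w)

/-- The projection to the orthogonal complement of the image of `inclD`. -/
def coproj (l : ℕ) : Matrix (DIdx l) (DIdx l) ℝ := 1 - inclD l * (inclD l)ᵀ

theorem coproj_mul_inclD : coproj l * inclD l = 0 := by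
  rw [coproj, Matrix.sub_mul, Matrix.mul_assoc, inclD_isometry, Matrix.one_mul, Matrix.mul_one,
    sub_self]

theorem transpose_coproj : (coproj l)ᵀ = coproj l := by
  simp [coproj, Matrix.transpose_mul]

theorem transpose_inclD_mul_coproj : (inclD l)ᵀ * coproj l = 0 := by
  rw [← transpose_coproj, ← Matrix.transpose_mul, coproj_mul_inclD, Matrix.transpose_zero]

theorem coproj_mul_self : coproj l * coproj l = coproj l := by
  nth_rewrite 1 [coproj]
  rw [Matrix.sub_mul, Matrix.mul_assoc, transpose_inclD_mul_coproj, Matrix.one_mul, Matrix.mul_zero,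
    sub_zero]

theorem JD_mul_coproj : JD l * coproj l = coproj l * JD l := by
  rw [coproj, Matrix.mul_sub, Matrix.sub_mul, ← Matrix.mul_assoc, JD_mul_inclD, Matrix.mul_assoc,
    Matrix.mul_assoc, transpose_inclD_mul_JD, Matrix.one_mul, Matrix.mul_one]

/-- The extension of an isometry `g` of `ℝ^{l,l+1}` to `ℝ^{l+1,l+1}` by `d` on the orthogonal
complement. -/
def extIso (g : Matrix (BIdx l) (BIdx l) ℝ) (d : ℝ) : Matrix (DIdx l) (DIdx l) ℝ :=
  inclD l * g * (inclD l)ᵀ + d • coproj l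

variable {g h : Matrix (BIdx l) (BIdx l) ℝ} {d : ℝ}

theorem extIso_mul (hd : d * d = 1) : extIso g d * extIso h d = extIso (g * h) 1 := by
  have h1 : inclD l * g * (inclD l)ᵀ * (inclD l * h * (inclD l)ᵀ) =
      inclD l * (g * h) * (inclD l)ᵀ := by
    calc _ = inclD l * g * ((inclD l)ᵀ * inclD l) * h * (inclD l)ᵀ := by
          simp only [Matrix.mul_assoc]
      _ = _ := by
          rw [inclD_isometry]
          simp only [Matrix.mul_assoc, Matrix.one_mul]
  have h2 : inclD l * g * (inclD l)ᵀ * coproj l = 0 := by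
    rw [Matrix.mul_assoc, transpose_inclD_mul_coproj, Matrix.mul_zero]
  have h3 : coproj l * (inclD l * h * (inclD l)ᵀ) = 0 := by
    rw [← Matrix.mul_assoc, ← Matrix.mul_assoc, coproj_mul_inclD, Matrix.zero_mul, Matrix.zero_mul]
  simp only [extIso, Matrix.add_mul, Matrix.mul_add, Matrix.smul_mul, Matrix.mul_smul, h1, h2, h3,
    coproj_mul_self, smul_smul, hd, smul_zero, add_zero, zero_add]

theorem extIso_one : extIso (1 : Matrix (BIdx l) (BIdx l) ℝ) 1 = 1 := by
  rw [extIso, Matrix.mul_one, one_smul, coproj, add_sub_cancel]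

theorem extIso_mul_inclD : extIso g d * inclD l = inclD l * g := by
  rw [extIso, Matrix.add_mul, Matrix.mul_assoc, inclD_isometry, Matrix.smul_mul, coproj_mul_inclD,
    smul_zero, add_zero, Matrix.mul_one]

theorem transpose_inclD_mul_extIso : (inclD l)ᵀ * extIso g d = g * (inclD l)ᵀ := by
  rw [extIso, Matrix.mul_add, ← Matrix.mul_assoc, ← Matrix.mul_assoc, inclD_isometry,
    Matrix.mul_smul, transpose_inclD_mul_coproj, smul_zero, add_zero, Matrix.one_mul]

theorem extIso_inv (hg : g ∈ parab (JB l) (wtB l)) (hd : d * d = 1) :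
    (extIso g d)⁻¹ = extIso g⁻¹ d := by
  refine Matrix.inv_eq_left_inv ?_
  rw [extIso_mul hd, isGradedForm_JB.inv_mul hg, extIso_one]

/-- The middle diagonal entry of an element of the parabolic subgroup is `±1`. -/
theorem mid_mul_self (hg : g ∈ parab (JB l) (wtB l)) :
    g (.inr (.inl ())) (.inr (.inl ())) * g (.inr (.inl ())) (.inr (.inl ())) = 1 := by
  have h1 := congrFun (congrFun hg.1 (.inr (.inl ()))) (.inr (.inl ()))
  have h2 : ∀ i : Fin l, g (.inl i) (.inr (.inl ())) = 0 := fun i => hg.2 _ _ (by simp [wtB])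
  have h3 : ∀ j, ((g)ᵀ * JB l) (.inr (.inl ())) j = g (flipB j) (.inr (.inl ())) := by
    intro j
    have h : ∀ s, flipB s = j ↔ s = flipB j := fun s =>
      ⟨fun h => by rw [← h, flipB_flipB], fun h => by rw [h, flipB_flipB]⟩
    simp [Matrix.mul_apply, JB_apply, h]
  rw [Matrix.mul_apply] at h1
  simp only [h3] at h1
  simpa [h2, flipB, JB] using h1

/-- The value `d = g_{mid,mid}` on the complement is forced: the entry of `extIso g d` in row `f`
and column `f'` is `(g_{mid,mid} - d) / 2`, and it has to vanish. -/
theorem extIso_mem_parab (hg : g ∈ parab (JB l) (wtB l))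
    (hd : d = g (.inr (.inl ())) (.inr (.inl ()))) : extIso g d ∈ parab (JD l) (wtD l) := by
  have hd1 : d * d = 1 := hd ▸ mid_mul_self hg
  refine ⟨?_, ?_⟩
  · have h1 : (extIso g d)ᵀ * JD l = JD l * extIso (JB l * gᵀ * JB l) d := by
      have h2 : JD l * (JD l * coproj l) = coproj l := isGradedForm_JD.mul_left_cancel _
      simp only [extIso, Matrix.transpose_add, Matrix.transpose_smul, transpose_coproj,
        Matrix.transpose_mul, Matrix.transpose_transpose, Matrix.add_mul, Matrix.mul_add,
        Matrix.smul_mul, Matrix.mul_smul, JD_mul_coproj]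
      congr 1
      simp only [← Matrix.mul_assoc]
      rw [JD_mul_inclD, Matrix.mul_assoc (inclD l) (JB l) (JB l), isGradedForm_JB.sq,
        Matrix.mul_one]
      simp only [Matrix.mul_assoc, transpose_inclD_mul_JD]
    rw [h1, Matrix.mul_assoc, extIso_mul hd1, isGradedForm_JB.conj_transpose_mul hg.1, extIso_one,
      Matrix.mul_one]
  · have h1 : ∀ i j : DIdx l, extIso g d i j = coefD i * coefD j * g (idxD i) (idxD j) +
        d * ((1 : Matrix (DIdx l) (DIdx l) ℝ) i j -
          coefD i * coefD j * (1 : Matrix (BIdx l) (BIdx l) ℝ) (idxD i) (idxD j)) := by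
      intro i j
      rw [← alpha_apply, ← alpha_apply]
      change _ = (inclD l * g * (inclD l)ᵀ) i j +
        d * (_ - (inclD l * (1 : Matrix (BIdx l) (BIdx l) ℝ) * (inclD l)ᵀ) i j)
      rw [Matrix.mul_one]
      rfl
    have hlow := hg.2
    rintro (i | i) (j | j) <;> simp only [wtD] <;> intro h
    any_goals omega
    rw [h1]
    induction i using Fin.cases with
    | zero =>
      induction j using Fin.cases with
      | zero => simp [coefD, idxD, Matrix.one_apply, hd]; ring
      | succ j =>
        have h2 := hlow (.inr (.inl ())) (.inr (.inr j)) (by simp [wtB])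
        simp [coefD, idxD, Matrix.one_apply, h2]
    | succ i =>
      have h2 : ∀ r, g (.inl i) (.inr r) = 0 := fun r =>
        hlow _ _ (by rcases r with r | r <;> simp [wtB])
      induction j using Fin.cases with
      | zero => simp [coefD, idxD, Matrix.one_apply, h2]
      | succ j => simp [coefD, idxD, Matrix.one_apply, h2]

/-- The extensions of gauge equivalent connections are gauge equivalent. -/
theorem GaugeRel.extend (h : GaugeRel (JB l) (wtB l) θ₁ θ₂ x)
    (h₁ : ∀ v, MDiffAt (fun y => θ₁ y v) x) (h₂ : ∀ v, MDiffAt (fun y => θ₂ y v) x) :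
    GaugeRel (JD l) (wtD l) (extend l θ₁) (extend l θ₂) x := by
  obtain ⟨g, hg, h3, h4⟩ := h
  set d := g (.inr (.inl ())) (.inr (.inl ())) with hd
  have h5 : ∀ A, (extIso g d)⁻¹ * alpha l A * extIso g d = alpha l (g⁻¹ * A * g) := by
    intro A
    rw [extIso_inv hg (mid_mul_self hg)]
    change extIso g⁻¹ d * (inclD l * A * (inclD l)ᵀ) * extIso g d =
      inclD l * (g⁻¹ * A * g) * (inclD l)ᵀ
    calc _ = (extIso g⁻¹ d * inclD l) * A * ((inclD l)ᵀ * extIso g d) := by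
          simp only [Matrix.mul_assoc]
      _ = _ := by
          rw [extIso_mul_inclD, transpose_inclD_mul_extIso]
          simp only [Matrix.mul_assoc]
  refine ⟨extIso g d, extIso_mem_parab hg hd, fun v => ?_, fun v w => ?_⟩
  · change alpha l (θ₂ x v) - (extIso g d)⁻¹ * alpha l (θ₁ x v) * extIso g d ∈ _
    rw [h5, ← map_sub]
    exact (alpha_mem_filt_zero_iff (h3 v).1).2 (h3 v)
  · rw [curvatureForm_extend h₁, curvatureForm_extend h₂, h5, h4]

theorem skewUnit_apply_pair {m : ℕ} (q r : Pair m) :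
    skewUnit q r.1.1 r.1.2 = if r = q then 1 else 0 := by
  obtain ⟨⟨a, b⟩, hab⟩ := q
  obtain ⟨⟨i, j⟩, hij⟩ := r
  have h2 : ¬ (b = i ∧ a = j) := by
    rintro ⟨rfl, rfl⟩
    exact absurd hij (not_lt.2 (le_of_lt hab))
  simp [skewUnit, Matrix.single_apply, h2, eq_comm]

/-- The index pair of `so(l+1, l+1)` that corresponds to `q`; indices are shifted by one, as the
additional index is `0`. -/
def succPair (q : Pair l) : Pair (l + 1) := ⟨(q.1.1.succ, q.1.2.succ), Fin.succ_lt_succ_iff.2 q.2⟩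

theorem alpha_eB_inr (q : Pair l) : alpha l (eB l (.inr q)) = eD l (succPair q) := by
  ext i j
  rw [alpha_apply]
  rcases i with i | i <;> rcases j with j | j <;>
    refine Fin.cases ?_ (fun i => ?_) i <;> refine Fin.cases ?_ (fun j => ?_) j <;>
    simp [coefD, idxD, eB, negB, eD, skewUnit, succPair, Matrix.single_apply, Fin.succ_ne_zero]

variable (hl : 4 ≤ l) (ε : ℝ)

/-- The curvature of the extension of `formE` is, up to a factor, `E^{[01]} ∧ E^{[12]} ⊗ E_{[34]}`,
where the additional index is `0`; its entries commute, as `{0, 1, 2}` and `{3, 4}` are disjoint. -/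
theorem normalAt_extend_formE (x : M l) :
    NormalAt (JD l) (wtD l) (eD l) (zD l) (extend l (formE hl ε)) x := by
  have hg := isCartanGauge_formE hl ε
  have hgD := hg.extend
  set q01 : Pair (l + 1) := ⟨(0, (i1 hl).succ), Fin.succ_pos _⟩ with hq01
  refine codiff_eq_zero_of_decomposable (eD l) (zD l) _
    (fun a => if q01 = a then -√2 * ε else 0) (fun a => if succPair (q12 hl) = a then 1 else 0)
    ((-√2 * ε) • zD l q01) (zD l (succPair (q12 hl))) (eD l (succPair (q34 hl))) ?_ (by simp)
    (by simp) ?_ ?_ ?_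
  · intro a b
    have hspec : ∀ a, ∃ v, eD l a - extend l (formE hl ε) x v ∈ filt (JD l) (wtD l) 0 ∧
        coframe hl ε (.inl (i1 hl)) x v = (if q01 = a then -√2 else 0) ∧
        coframe hl ε (.inr (q12 hl)) x v = if succPair (q12 hl) = a then 1 else 0 := by
      intro a
      obtain ⟨v, hv, -⟩ := hgD.iso x (Set.mem_univ x) _ (isDualFrame_eD.e_mem a)
      refine ⟨v, hv, ?_, ?_⟩
      · have h1 := hv.2 (.inl (i1 hl).succ) (.inr 0) (by simp [wtD])
        have h2 : formE hl ε x v (.inl (i1 hl)) (.inr (.inl ())) =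
            coframe hl ε (.inl (i1 hl)) x v := by
          rw [coframe_eq_trace, trace_mul_zB_inl (formE_mem_so hl ε x v)]
        have h3 : skewUnit a (i1 hl).succ 0 = -if q01 = a then 1 else 0 := by
          rw [skewUnit_apply_swap, ← skewUnit_apply_pair]
        have h4 : √2 * (√2)⁻¹ = 1 := mul_inv_cancel₀ (by positivity)
        rw [Matrix.sub_apply, sub_eq_zero] at h1
        change skewUnit a (i1 hl).succ 0 = alpha l (formE hl ε x v) _ _ at h1
        rw [h3, alpha_apply] at h1
        change -(if q01 = a then (1 : ℝ) else 0) = 1 * (√2)⁻¹ *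
          formE hl ε x v (.inl (i1 hl)) (.inr (.inl ())) at h1
        rw [h2] at h1
        have h5 : (if q01 = a then -√2 else 0) = √2 * -(if q01 = a then (1 : ℝ) else 0) := by
          split_ifs <;> ring
        rw [h5, h1]
        linear_combination (-coframe hl ε (.inl (i1 hl)) x v) * h4
      · have h1 := hv.2 (.inl (q12 hl).1.1.succ) (.inr (q12 hl).1.2.succ) (by simp [wtD])
        have h2 : formE hl ε x v (.inl (q12 hl).1.1) (.inr (.inr (q12 hl).1.2)) =
            coframe hl ε (.inr (q12 hl)) x v := by
          rw [coframe_eq_trace, trace_mul_zB_inr (formE_mem_so hl ε x v)]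
        rw [Matrix.sub_apply, sub_eq_zero] at h1
        change skewUnit a (succPair (q12 hl)).1.1 (succPair (q12 hl)).1.2 =
          alpha l (formE hl ε x v) _ _ at h1
        rw [skewUnit_apply_pair, alpha_apply] at h1
        change _ = 1 * 1 *
          formE hl ε x v (.inl (q12 hl).1.1) (.inr (.inr (q12 hl).1.2)) at h1
        rw [h1, h2, mul_one, one_mul]
    obtain ⟨v, hv, hv1, hv2⟩ := hspec a
    obtain ⟨w, hw, hw1, hw2⟩ := hspec b
    rw [hgD.kappa_one (Set.mem_univ x) isGradedForm_JD hv hw,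
      curvatureForm_extend fun v => hg.mdiffAt (Set.mem_univ x) v, curvatureForm_formE, hv1, hv2,
      hw1, hw2, map_smul, alpha_eB_inr]
    congr 1
    split_ifs <;> ring
  · simp [Ring.lie_def, zD, Matrix.fromBlocks_multiply]
  · rw [smul_lie_mat, Ring.lie_def, zD, eD, Matrix.fromBlocks_multiply, Matrix.fromBlocks_multiply,
      skewUnit_mul_skewUnit, skewUnit_mul_skewUnit] <;>
      simp [hq01, succPair, q34, i1, Fin.ext_iff]
  · rw [Ring.lie_def, zD, eD, Matrix.fromBlocks_multiply, Matrix.fromBlocks_multiply,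
      skewUnit_mul_skewUnit, skewUnit_mul_skewUnit] <;>
      simp [succPair, q34, q12, Fin.ext_iff]

theorem isNormalSpinorial_extend (hθ : IsCartanGauge (JB l) (wtB l) U θ)
    (h : ∀ x ∈ U, GaugeRel (JB l) (wtB l) (formE hl ε) θ x) :
    IsNormalSpinorial l U (extend l θ) :=
  ⟨hθ.extend, hθ.extend.isRegular isGradedForm_JD fun _ hx => hθ.extend.regularAt_JD hx,
    hθ.extend.isNormal isGradedForm_JD isDualFrame_eD fun x hx =>
      ((h x hx).extend (fun v => (isCartanGauge_formE hl ε).mdiffAt (Set.mem_univ x) v)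
        fun v => hθ.mdiffAt hx v).normalAt (isCartanGauge_formE hl ε).extend (Set.mem_univ x)
          isGradedForm_JD isDualFrame_eD (normalAt_extend_formE hl ε x)⟩

end Extension

/-! ### The curvature of normal Cartan connections -/

section Conclusions

variable {l : ℕ} (hl : 4 ≤ l) (ε : ℝ)
variable {U : Set (M l)} {θ : M l → M l →ₗ[ℝ] Matrix (BIdx l) (BIdx l) ℝ} {x : M l}

theorem IsNormalFor.isNormalGauge {D : M l → Submodule ℝ (M l)} (hθ : IsNormalFor l D U θ) :
    IsNormalGauge l U θ :=
  ⟨hθ.gauge, fun _ hx => hθ.gauge.regularAt isGradedForm_JB hθ.regular hx,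
    fun x hx => hθ.normal x hx 1 one_mem_parabolic⟩

theorem IsNormalFor.gaugeRel (hθ : IsNormalFor l (distE hl ε) U θ) (hx : x ∈ U) :
    GaugeRel (JB l) (wtB l) (formE hl ε) θ x :=
  GaugeRel.symm isGradedForm_JB
    (gaugeRel_formE hl ε hθ.isNormalGauge (fun x hx v hv => (hθ.adapted x hx v).1 hv) hx)

theorem eB_ne_zero (a : Coord l) : eB l a ≠ 0 := by
  intro h
  have h1 := trace_eB_mul_zB a a
  rw [h, zero_mul, Matrix.trace_zero, if_pos rfl, mul_zero] at h1
  exact zero_ne_one h1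

/-- The curvature function of a normal Cartan connection of `distE` vanishes at no point of the
bundle, if `ε ≠ 0`. -/
theorem IsNormalFor.exists_kappa_ne_zero (hθ : IsNormalFor l (distE hl ε) U θ) (hε : ε ≠ 0)
    (hx : x ∈ U) {p : Matrix (BIdx l) (BIdx l) ℝ} (hp : p ∈ parabolic (JB l) (wtB l)) :
    ∃ A ∈ filt (JB l) (wtB l) (-2), ∃ B ∈ filt (JB l) (wtB l) (-2),
      kappa (JB l) (wtB l) θ x p A B ≠ 0 := by
  obtain ⟨g, hg, hk⟩ := exists_kappa_eq_of_gaugeRel isGradedForm_JB (hθ.gaugeRel hl ε hx)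
  replace hp := parabolic_subset_parab hp
  have hq := mul_mem_parab hg hp
  set q := g * p
  -- The components of degree less than `-2` of `𝔤` vanish, so that `𝔤^{-2} = 𝔤`.
  have hmem : ∀ a, q⁻¹ * eB l a * q ∈ filt (JB l) (wtB l) (-2) := fun a =>
    mem_filt_neg_two (isGradedForm_JB.conj_mem_so hq (eB_mem_so a)) le_rfl
  refine ⟨_, hmem (.inl (i1 hl)), _, hmem (.inr (q12 hl)), ?_⟩
  rw [hk p hp, (isCartanGauge_formE hl ε).kappa_eq (Set.mem_univ x) isGradedForm_JB hq
    (v := frameE hl ε (.inl (i1 hl)) x) (w := frameE hl ε (.inr (q12 hl)) x)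
    (by rw [formE_frameE, sub_self]; exact zero_mem _)
    (by rw [formE_frameE, sub_self]; exact zero_mem _), curvatureForm_formE]
  intro h
  have h1 := isGradedForm_JB.conj_inv_conj hq ((ε * (coframe hl ε (.inl (i1 hl)) x
    (frameE hl ε (.inl (i1 hl)) x) * coframe hl ε (.inr (q12 hl)) x
    (frameE hl ε (.inr (q12 hl)) x) - coframe hl ε (.inr (q12 hl)) x
    (frameE hl ε (.inl (i1 hl)) x) * coframe hl ε (.inl (i1 hl)) x
    (frameE hl ε (.inr (q12 hl)) x))) • eB l (.inr (q34 hl)))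
  rw [h, mul_zero, zero_mul] at h1
  simp only [coframe_frameE] at h1
  have h2 : ε • eB l (.inr (q34 hl)) = 0 := by simpa using h1.symm
  exact (smul_ne_zero hε (eB_ne_zero _)) h2

theorem IsNormalFor.kappa11Vanishes (hθ : IsNormalFor l (distE hl ε) U θ) :
    Kappa11Vanishes l U θ := by
  intro x hx p hp A hA B hB
  obtain ⟨g, hg, hk⟩ := exists_kappa_eq_of_gaugeRel isGradedForm_JB (hθ.gaugeRel hl ε hx)
  replace hp := parabolic_subset_parab hp
  have hq := mul_mem_parab hg hp
  rw [hk p hp]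
  set q := g * p
  have hgE := isCartanGauge_formE hl ε
  have hv : ∀ A ∈ gradeSet (JB l) (wtB l) (-1),
      formE hl ε x (omegaInv (JB l) (wtB l) (formE hl ε) x q A) ∈ filt (JB l) (wtB l) (-1) := by
    intro A hA
    have hA' : A ∈ filt (JB l) (wtB l) (-1) := ⟨hA.1, fun i j h => hA.2 i j h.ne⟩
    have h1 := isGradedForm_JB.conj_inv_mem_filt hq (sub_mem hA' (filt_mono (by norm_num)
      (hgE.omegaInv_spec (Set.mem_univ x) isGradedForm_JB hq hA.1)))
    rwa [sub_sub_cancel, isGradedForm_JB.conj_inv_conj hq] at h1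
  rw [kappa, curvatureForm_formE_eq_zero hl ε (hv A hA) (hv B hB), mul_zero, zero_mul]

theorem kappa_formE_zero (p A B : Matrix (BIdx l) (BIdx l) ℝ) :
    kappa (JB l) (wtB l) (formE hl 0) x p A B = 0 := by
  rw [kappa, curvatureForm_formE, zero_mul, zero_smul, mul_zero, zero_mul]

end Conclusions

/-! ### Local inequivalence -/

section Inequivalence

variable {l : ℕ} (hl : 4 ≤ l)

/-- The pull-back of the form `θ` by `φ`. -/
def pullback (φ : M l → M l) (θ : M l → M l →ₗ[ℝ] Matrix (BIdx l) (BIdx l) ℝ) :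
    M l → M l →ₗ[ℝ] Matrix (BIdx l) (BIdx l) ℝ :=
  fun x => θ (φ x) ∘ₗ (fderiv ℝ φ x : M l →ₗ[ℝ] M l)

theorem curvatureForm_pullback {φ : M l → M l} {θ : M l → M l →ₗ[ℝ] Matrix (BIdx l) (BIdx l) ℝ}
    {x : M l} (hθ : ∀ v, MDiffAt (fun y => θ y v) (φ x)) (hφ : ContDiffAt ℝ ∞ φ x) (v w : M l) :
    curvatureForm (pullback φ θ) x v w =
      curvatureForm θ (φ x) (fderiv ℝ φ x v) (fderiv ℝ φ x w) := by
  have hφ' : DifferentiableAt ℝ (fderiv ℝ φ) x :=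
    (hφ.fderiv_right (m := 1) (by norm_cast)).differentiableAt one_ne_zero
  have h : ∀ v w, mderiv (fun y => pullback φ θ y w) x v =
      mderiv (fun y => θ y (fderiv ℝ φ x w)) (φ x) (fderiv ℝ φ x v) +
        θ (φ x) (fderiv ℝ (fderiv ℝ φ) x v w) := by
    intro v w
    have h1 := mderiv_comp_field (W := fun y => fderiv ℝ φ y w) hθ (hφ.differentiableAt (by simp))
      (hφ'.clm_apply (differentiableAt_const w)) v
    rw [fderiv_clm_apply hφ' (differentiableAt_const w)] at h1
    simpa [pullback] using h1
  have hsymm : fderiv ℝ (fderiv ℝ φ) x v w = fderiv ℝ (fderiv ℝ φ) x w v :=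
    (hφ.isSymmSndFDerivAt (by simp; norm_cast)).eq v w
  rw [curvatureForm_def, curvatureForm_def, h, h, hsymm]
  simp only [pullback, LinearMap.comp_apply, ContinuousLinearMap.coe_coe]
  abel

/-- A diffeomorphism would pull the flat connection of `D` back to a flat normal Cartan connection
of `D'`. -/
theorem not_locallyEquivalent : ¬ LocallyEquivalent (distD' hl) (flatD l) := by
  rintro ⟨φ, ⟨x, hx⟩, hφ, hφs, hmap⟩
  rw [← distE_one, ← distE_zero hl] at hmap
  have hc : ∀ y ∈ φ.source, ContDiffAt ℝ ∞ φ y := fun y hy =>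
    hφ.contDiffAt (φ.open_source.mem_nhds hy)
  have hcs : ∀ y ∈ φ.source, ContDiffAt ℝ ∞ φ.symm (φ y) := fun y hy =>
    hφs.contDiffAt (φ.open_target.mem_nhds (φ.map_source hy))
  have hinv : ∀ y ∈ φ.source, (∀ v, fderiv ℝ φ.symm (φ y) (fderiv ℝ φ y v) = v) ∧
      ∀ v, fderiv ℝ φ y (fderiv ℝ φ.symm (φ y) v) = v := by
    intro y hy
    have h1 := ((hc y hy).differentiableAt (by simp)).hasFDerivAt
    have h2 := ((hcs y hy).differentiableAt (by simp)).hasFDerivAt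
    refine ⟨fun v => ?_, fun v => ?_⟩
    · have h3 := (h2.comp y h1).congr_of_eventuallyEq (f₁ := id) (by
        filter_upwards [φ.open_source.mem_nhds hy] with z hz
        simp [φ.left_inv hz])
      exact (congrArg (· v) (h3.unique (hasFDerivAt_id y)) :)
    · have h4 : HasFDerivAt φ (fderiv ℝ φ y) (φ.symm (φ y)) := by rwa [φ.left_inv hy]
      have h3 := (h4.comp (φ y) h2).congr_of_eventuallyEq (f₁ := id) (by
        filter_upwards [φ.open_target.mem_nhds (φ.map_source hy)] with z hz
        simp [φ.right_inv hz])
      exact (congrArg (· v) (h3.unique (hasFDerivAt_id (φ y))) :)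
  have hgE := isCartanGauge_formE hl 0
  set θ := pullback φ (formE hl 0)
  have hcurv : ∀ y ∈ φ.source, ∀ v w, curvatureForm θ y v w = 0 := by
    intro y hy v w
    rw [curvatureForm_pullback (fun v => hgE.mdiffAt (Set.mem_univ _) v) (hc y hy),
      curvatureForm_formE, zero_mul, zero_smul]
  have hkappa : ∀ y ∈ φ.source, ∀ p A B, kappa (JB l) (wtB l) θ y p A B = 0 := by
    intro y hy p A B
    rw [kappa, hcurv y hy, mul_zero, zero_mul]
  have hnormal : IsNormalFor l (distE hl 1) φ.source θ := by
    refine ⟨⟨φ.open_source, ?_, fun y _ v => formE_mem_so hl 0 _ _, ?_⟩, ?_, ?_, ?_⟩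
    · intro v i j
      have h1 : ∀ c, ContDiffOn ℝ ∞ (fun y => coframe hl 0 c (φ y) (fderiv ℝ φ y v)) φ.source := by
        intro c
        have h2 : ∀ a, ContDiffOn ℝ ∞ (fun y => φ y a) φ.source := contDiffOn_pi.1 hφ
        have h3 : ∀ a, ContDiffOn ℝ ∞ (fun y => fderiv ℝ φ y v a) φ.source :=
          contDiffOn_pi.1 ((hφ.fderiv_of_isOpen φ.open_source (by simp)).clm_apply contDiffOn_const)
        rcases c with c | c
        · exact h3 _
        · simp only [coframe_inr]
          split_ifs
          · exact ((h3 _).neg.sub ((h3 _).mul (h2 _))).add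
              ((contDiffOn_const.mul (h3 _)).mul (h2 _))
          · exact ((h3 _).neg.sub ((h3 _).mul (h2 _))).add contDiffOn_const
      simp only [θ, pullback, LinearMap.comp_apply, ContinuousLinearMap.coe_coe, formE_apply,
        Matrix.sum_apply, Matrix.smul_apply, smul_eq_mul]
      exact ContDiffOn.sum fun c _ => (h1 c).mul contDiffOn_const
    · intro y hy A hA
      obtain ⟨v, hv, huniq⟩ := hgE.iso (φ y) (Set.mem_univ _) A hA
      refine ⟨fderiv ℝ φ.symm (φ y) v, ?_, fun w hw => ?_⟩
      · change A - formE hl 0 (φ y) (fderiv ℝ φ y _) ∈ _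
        rwa [(hinv y hy).2]
      · rw [← huniq (fderiv ℝ φ y w) hw, (hinv y hy).1]
    · intro y hy v
      refine Iff.trans ?_ (mem_distE_iff hl 0 (φ y) (fderiv ℝ φ y v))
      rw [← hmap y hy]
      refine ⟨fun h => ⟨v, h, rfl⟩, ?_⟩
      rintro ⟨w, hw, hwv⟩
      have h1 := congrArg (fderiv ℝ φ.symm (φ y)) hwv
      rw [ContinuousLinearMap.coe_coe, (hinv y hy).1, (hinv y hy).1] at h1
      exact h1 ▸ hw
    · intro y hy p _ i j A _ B _
      rw [hkappa y hy]
      exact zero_mem _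
    · intro y hy p _
      simp only [codiff_eq, hkappa y hy, map_zero, Finset.sum_const_zero, smul_zero]
  obtain ⟨A, -, B, -, h⟩ :=
    hnormal.exists_kappa_ne_zero hl 1 one_ne_zero hx (p := 1) one_mem_parabolic
  exact h (hkappa x hx 1 A B)

end Inequivalence

end FreeDistribution

end

theorem mainTheorem6 (l : ℕ) (hl : 4 ≤ l) :
    -- the flat model: `D` is non-degenerate of rank `l`, with a flat normal Cartan connection
    (IsDistribution l (flatD l) ∧ IsNondegenerate (flatD l) ∧
      ∃ θ : M l → M l →ₗ[ℝ] Matrix (BIdx l) (BIdx l) ℝ,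
        IsNormalFor l (flatD l) Set.univ θ ∧
        ∀ x, ∀ p ∈ parabolic (JB l) (wtB l),
          ∀ A ∈ filt (JB l) (wtB l) (-2), ∀ B ∈ filt (JB l) (wtB l) (-2),
            kappa (JB l) (wtB l) θ x p A B = 0) ∧
    -- `D'` is non-degenerate of rank `l`
    IsDistribution l (distD' hl) ∧ IsNondegenerate (distD' hl) ∧
    -- `D'` has an explicit normal Cartan connection
    (∃ θ : M l → M l →ₗ[ℝ] Matrix (BIdx l) (BIdx l) ℝ,
      IsNormalFor l (distD' hl) Set.univ θ ∧
      (∀ x i, θ x (vecX' hl i x) = eB l (.inl i)) ∧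
      (∀ x q, θ x (-vecY q) = eB l (.inr q))) ∧
    -- every normal Cartan connection of `D'`, over any open set, has the asserted properties
    (∀ (U : Set (M l)) (θ : M l → M l →ₗ[ℝ] Matrix (BIdx l) (BIdx l) ℝ),
      IsNormalFor l (distD' hl) U θ →
        (∀ x ∈ U, ∀ p ∈ parabolic (JB l) (wtB l),
          ∃ A ∈ filt (JB l) (wtB l) (-2), ∃ B ∈ filt (JB l) (wtB l) (-2),
            kappa (JB l) (wtB l) θ x p A B ≠ 0) ∧
        Kappa11Vanishes l U θ ∧
        IsNormalSpinorial l U (extend l θ)) ∧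
    -- `D'` is not locally equivalent to the flat model
    ¬ LocallyEquivalent (distD' hl) (flatD l) := by
  refine ⟨?_, ?_, ?_, ?_, ?_, not_locallyEquivalent hl⟩
  · rw [← distE_zero hl]
    exact ⟨isDistribution_distE hl 0, isNondegenerate_distE hl 0, formE hl 0,
      isNormalFor_formE hl 0, fun x p _ A _ B _ => kappa_formE_zero hl p A B⟩
  · rw [← distE_one]
    exact isDistribution_distE hl 1
  · rw [← distE_one]
    exact isNondegenerate_distE hl 1
  · refine ⟨formE hl 1, distE_one hl ▸ isNormalFor_formE hl 1, fun x i => ?_,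
      fun x q => formE_frameE hl 1 (.inr q) x⟩
    rw [← vecE_one]
    exact formE_frameE hl 1 (.inl i) x
  · rw [← distE_one]
    exact fun U θ hθ => ⟨fun x hx p hp => hθ.exists_kappa_ne_zero hl 1 one_ne_zero hx hp,
      hθ.kappa11Vanishes hl 1,
      isNormalSpinorial_extend hl 1 hθ.gauge fun x hx => hθ.gaugeRel hl 1 hx⟩
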